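/- A \emph{3-manifold triangulation} is a finite collection of tetrahedra whose faces are affinely glued together in pairs (two faces of the same tetrahedron may be glued together) so that the resulting topological space is a closed connected 3-manifold. Two triangulations are \emph{isomorphic} if they agree up to relabelling the tetrahedra and reordering the four vertices of each tetrahedron. All moves below replace the interior of a configuration of \emph{distinct} tetrahedra, keeping its boundary faces and all other gluings (boundary faces may be glued to one another), and are taken up to isomorphism. A \emph{2-3 move} replaces two tetrahedra $xabc$, $yabc$ joined along the face $abc$ by three tetrahedra $xyab$, $xybc$, $xyca$ joined along the edge $xy$; a \emph{3-2 move} is the inverse. An \emph{octahedron flip} (4-4 move) replaces four tetrahedra $xya_ia_{i+1}$ ($i\in\mathbb Z/4$) surrounding an edge $xy$ of degree four, which form an octahedron, by the four tetrahedra $a_0a_2xa_1,\ a_0a_2a_1y,\ a_0a_2ya_3,\ a_0a_2a_3x$ surrounding the edge $a_0a_2$. A \emph{quadrilateral pillow} consists of two tetrahedra (front and rear) with vertices $a,b,c,d$ glued along the two adjacent faces $abc$ and $abd$; its outer faces are a front and a rear copy of each of $acd$ and $bcd$. A \emph{pillow flip} replaces a pillow on $a,b,c,d$ together with a third tetrahedron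 $bcdz$ attached to its rear face $bcd$ by a pillow on $a,z,c,d$ (glued along $azc$ and $azd$) together with a tetrahedron $bcdz$ attached to its front face $zcd$; the face $bcd$ of the new third tetrahedron is the old front face $bcd$, the rear face $zcd$ of the new pillow is the face $zcd$ of the old third tetrahedron, and the front and rear faces $acd$ are kept, as are the faces $bcz$ and $bdz$. For a \emph{prism flip}, consider a triangular prism with ends $abc$, $a'b'c'$ and vertical edges $aa',bb',cc'$, cut into the three tetrahedra $abcc'$, $abb'c'$, $aa'b'c'$, whose rectangular sides $aa'c'c$ and $bb'c'c$ are glued together, either by folding along $cc'$, that is $(a,a',c,c')\mapsto(b,b',c,c')$ (\emph{type A}), or by folding followed by a $180^\circ$ twist, that is $(a,a',c,c')\mapsto(c',c,b',b)$ (\emph{type B}). The prism flip applies to this configuration the half turn $a\leftrightarrow b'$, $b\leftrightarrow a'$, $c\leftrightarrow c'$, which interchanges the two ends: with the same prism, the same gluing of the two sides, and the same outer faces $abc$, $a'b'c'$, $abb'$, $aa'b'$, the three tetrahedra are replaced by $b'a'c'c$, $b'a'ac$, $b'bac$. \textbf{Theorem.} Let $\mathcal T$ and $\mathcal T'$ be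 3-manifold triangulations, where $\mathcal T'$ can be obtained from $\mathcal T$ by performing a 2-3 move followed by a 3-2 move. Then one of the following holds: \begin{itemize} \item $\mathcal T'$ is isomorphic to $\mathcal T$; \item $\mathcal T'$ can be obtained from $\mathcal T$ by performing a 3-2 move followed by a 2-3 move instead; \item $\mathcal T'$ can be obtained from $\mathcal T$ by performing a single octahedron flip, a single pillow flip, or a single prism flip (of type A or type B). \end{itemize} -/

import Mathlib

/-! ### Triangulations as face gluings of tetrahedra -/

/-- A gluing of the faces of a family of tetrahedra in pairs.  The vertices of each tetrahedron are
numbered `0, 1, 2, 3`, and face `f` is the face opposite vertex `f`.  Face `f` of the tetrahedron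
`t` is glued to face `perm t f f` of the tetrahedron `adj t f`, each vertex `v ≠ f` of the face
being sent to the vertex `perm t f v`; the gluing is the affine extension of this.
(The value `perm t f f` is thus forced by the other three.)  Two faces of the same tetrahedron may
be glued together, but no face is glued to itself. -/
structure FaceGluing (ι : Type) where
  adj : ι → Fin 4 → ι
  perm : ι → Fin 4 → Equiv.Perm (Fin 4)
  adj_adj : ∀ t f, adj (adj t f) (perm t f f) = t
  perm_perm : ∀ t f, perm (adj t f) (perm t f f) = (perm t f)⁻¹
  ne_self : ∀ t f, ¬ (adj t f = t ∧ perm t f f = f)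

namespace FaceGluing

variable {ι ι' : Type}

/-- The disjoint union of a family of tetrahedra. -/
abbrev Points (ι : Type) : Type := Σ _t : ι, stdSimplex ℝ (Fin 4)

/-- The identification of points made by the gluings.  A point of a tetrahedron is given by its
barycentric coordinates, and it lies on face `f` when its `f`-th coordinate is zero. -/
def GluedTo (T : FaceGluing ι) (x y : Points ι) : Prop :=
  ∃ f : Fin 4, x.2.1 f = 0 ∧ y.1 = T.adj x.1 f ∧ ∀ v, y.2.1 (T.perm x.1 f v) = x.2.1 v

/-- The topological space obtained from the disjoint union of the tetrahedra by gluing their faces: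
the quotient by the equivalence relation generated by the gluings. -/
abbrev Space (T : FaceGluing ι) : Type := Quot T.GluedTo

/-- The glued space is a closed connected 3-manifold: compact, connected, Hausdorff, second
countable, and locally homeomorphic to `ℝ³` (so without boundary). -/
structure IsThreeManifoldTriangulation (T : FaceGluing ι) : Prop where
  compact : CompactSpace T.Space
  connected : ConnectedSpace T.Space
  hausdorff : T2Space T.Space
  secondCountable : SecondCountableTopology T.Space
  locallyEuclidean : Nonempty (ChartedSpace (EuclideanSpace ℝ (Fin 3)) T.Space)

/-- Combinatorial isomorphism: a relabelling `e` of the tetrahedra, together with a reordering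
`σ t` of the four vertices of each tetrahedron `t`. -/
def Isomorphic (T : FaceGluing ι) (T' : FaceGluing ι') : Prop :=
  ∃ (e : ι ≃ ι') (σ : ι → Equiv.Perm (Fin 4)), ∀ t f,
    T'.adj (e t) (σ t f) = e (T.adj t f) ∧
    T'.perm (e t) (σ t f) = σ (T.adj t f) * T.perm t f * (σ t)⁻¹

end FaceGluing

/-! ### Local replacements -/

/-- A corner of a face: the vertex `vert` of the face `face` of the tetrahedron `tet`. -/
@[ext]
structure FaceCorner (ι : Type) where
  tet : ι
  face : Fin 4
  vert : Fin 4
  ne : vert ≠ face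

/-- Transport of face corners along a map of tetrahedra. -/
def FaceCorner.map {ι ι' : Type} (g : ι → ι') (x : FaceCorner ι) : FaceCorner ι' :=
  ⟨g x.tet, x.face, x.vert, x.ne⟩

/-- The face corner to which a face corner is glued. -/
def FaceGluing.glue {ι : Type} (T : FaceGluing ι) (x : FaceCorner ι) : FaceCorner ι :=
  ⟨T.adj x.tet x.face, T.perm x.tet x.face x.face, T.perm x.tet x.face x.vert,
    fun h => x.ne ((T.perm x.tet x.face).injective h)⟩

/-- A patch of `p` tetrahedra, some of whose faces are glued together, is described by labelling
its face corners: two faces of the patch are glued together, corner by corner, exactly when they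
carry the same labels.  A face whose labels occur only once is a boundary face of the patch. -/
abbrev Patch (p : ℕ) (L : Type) : Type := FaceCorner (Fin p) → L

/-- In the gluing `T`, the first `p` tetrahedra are glued among themselves as the patch says.
(The boundary faces of the patch may be glued in any way, also to one another.) -/
def Patch.IsIn {p : ℕ} {L ρ : Type} (P : Patch p L) (T : FaceGluing (Fin p ⊕ ρ)) : Prop :=
  ∀ x y : FaceCorner (Fin p), x ≠ y → P x = P y → T.glue (x.map Sum.inl) = y.map Sum.inl

/-- The correspondence of face corners when a patch `P` is exchanged for a patch `Q` with the same
boundary labels: corners of the tetrahedra outside correspond to themselves, and corners of the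
patches correspond when they have the same label. -/
inductive Patch.Corr {p q : ℕ} {L ρ : Type} (P : Patch p L) (Q : Patch q L) :
    FaceCorner (Fin p ⊕ ρ) → FaceCorner (Fin q ⊕ ρ) → Prop
  | outside (x : FaceCorner ρ) : Patch.Corr P Q (x.map Sum.inr) (x.map Sum.inr)
  | boundary (x : FaceCorner (Fin p)) (y : FaceCorner (Fin q)) (h : P x = Q y) :
      Patch.Corr P Q (x.map Sum.inl) (y.map Sum.inl)

/-- `T'` is obtained (up to isomorphism) from `T` by removing `p` distinct tetrahedra that form the
patch `P` and inserting in their place `q` new tetrahedra that form the patch `Q`, boundary faces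
being matched by their labels, and all gluings of the faces on the boundary of the patch and of the
faces outside remaining as they were. -/
def ReplacePatch {p q : ℕ} {L ι ι' : Type} (P : Patch p L) (Q : Patch q L)
    (T : FaceGluing ι) (T' : FaceGluing ι') : Prop :=
  ∃ (ρ : Type) (S : FaceGluing (Fin p ⊕ ρ)) (S' : FaceGluing (Fin q ⊕ ρ)),
    T.Isomorphic S ∧ S'.Isomorphic T' ∧ P.IsIn S ∧ Q.IsIn S' ∧
    ∀ x x' y', Patch.Corr P Q x x' → Patch.Corr P Q (S.glue x) y' → S'.glue x' = y'

/-- The vertices of the face of `x` in a patch whose `k`-th tetrahedron has the four vertices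
`v k 0, v k 1, v k 2, v k 3`. -/
def faceSet {p m : ℕ} (v : Fin p → Fin 4 → Fin m) (x : FaceCorner (Fin p)) : Finset (Fin m) :=
  (Finset.univ.erase x.face).image (v x.tet)

/-- The patch formed by tetrahedra with named vertices: faces with the same vertices are glued. -/
def simplicialPatch {p m : ℕ} (v : Fin p → Fin 4 → Fin m) : Patch p (Finset (Fin m) × Fin m) :=
  fun x => (faceSet v x, v x.tet x.vert)

/-- The patch formed by tetrahedra with named vertices, where a tag on each face distinguishes
different faces that have the same vertices: faces with the same vertices and the same tag are
glued. -/
def taggedPatch {p m : ℕ} (v : Fin p → Fin 4 → Fin m) (tag : Fin p → Fin 4 → Fin 2) :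
    Patch p ((Finset (Fin m) × Fin 2) × Fin m) :=
  fun x => ((faceSet v x, tag x.tet x.face), v x.tet x.vert)

/-- The patch formed by tetrahedra with named vertices, where in addition every face contained in
the side `s` is glued by the vertex map `ψ` to the face with vertex set its image. -/
def foldedPatch {p m : ℕ} (v : Fin p → Fin 4 → Fin m) (s : Finset (Fin m))
    (ψ : Fin m → Fin m) : Patch p (Finset (Fin m) × Fin m) :=
  fun x => if faceSet v x ⊆ s then ((faceSet v x).image ψ, ψ (v x.tet x.vert))
    else (faceSet v x, v x.tet x.vert)

/-! ### The Pachner moves 2-3 and 3-2 -/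

section Moves

variable {ι ι' : Type}

/-- The 2-3 move, in a triangular bipyramid with apexes `3, 4` and equator `0, 1, 2`: two distinct
tetrahedra joined along the face `012` are replaced by three joined along the edge `34`. -/
def Move23 (T : FaceGluing ι) (T' : FaceGluing ι') : Prop :=
  ReplacePatch
    (simplicialPatch (m := 5) ![![3, 0, 1, 2], ![4, 0, 1, 2]])
    (simplicialPatch (m := 5) ![![3, 4, 0, 1], ![3, 4, 1, 2], ![3, 4, 2, 0]]) T T'

/-- The 3-2 move, the inverse of the 2-3 move: three distinct tetrahedra joined along the edge `34`
(of degree three) are replaced by two joined along the face `012`. -/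
def Move32 (T : FaceGluing ι) (T' : FaceGluing ι') : Prop :=
  ReplacePatch
    (simplicialPatch (m := 5) ![![3, 4, 0, 1], ![3, 4, 1, 2], ![3, 4, 2, 0]])
    (simplicialPatch (m := 5) ![![3, 0, 1, 2], ![4, 0, 1, 2]]) T T'

/-! ### The composite moves -/

/-- The octahedron flip (4-4 move), in an octahedron with opposite vertices `0, 2`, `1, 3` and
`4, 5`: four distinct tetrahedra around the edge `45` of degree four are replaced by four around
the edge `02`. -/
def OctahedronFlip (T : FaceGluing ι) (T' : FaceGluing ι') : Prop :=
  ReplacePatch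
    (simplicialPatch (m := 6) ![![4, 5, 0, 1], ![4, 5, 1, 2], ![4, 5, 2, 3], ![4, 5, 3, 0]])
    (simplicialPatch (m := 6) ![![0, 2, 4, 1], ![0, 2, 1, 5], ![0, 2, 5, 3], ![0, 2, 3, 4]]) T T'

/-- The pillow flip.  Initially, the quadrilateral pillow consists of two tetrahedra, front and
rear, both with vertices `0, 1, 2, 3`, which are glued along the faces `012` and `013` around the
edge `01` of degree two.  Its outer faces are `023` and `123` at the front (tag `0`) and
`023` and `123` at the rear (tag `1`).  A third tetrahedron `1234` is attached to its rear face
`123`.  Finally, the pillow consists of two tetrahedra, rear and front, both with vertices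
`0, 4, 2, 3` and glued along `042` and `043`; its outer face `023` at the rear is the old rear face,
its outer face `023` at the front is the old front face, its rear face `423` is a face of the old
third tetrahedron, and the new third tetrahedron `1234` is attached to its front face `423`
(tag `1`), so that its face `123` is the old front face. -/
def PillowFlip (T : FaceGluing ι) (T' : FaceGluing ι') : Prop :=
  ReplacePatch
    (taggedPatch (m := 5)
      ![![0, 1, 2, 3], ![0, 1, 2, 3], ![1, 2, 3, 4]]
      ![![0, 0, 0, 0], ![1, 1, 0, 0], ![0, 0, 0, 1]])
    (taggedPatch (m := 5)
      ![![0, 4, 2, 3], ![0, 4, 2, 3], ![1, 2, 3, 4]]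
      ![![0, 1, 0, 0], ![1, 0, 0, 0], ![1, 0, 0, 0]]) T T'

/-- The prism flips.  The prism has ends `012` and `345`, and vertical edges `03`, `14`, `25`.  Its
rectangular side `{1, 2, 4, 5}` is glued to its rectangular side `{0, 2, 3, 5}` by the vertex map
`ψ`.  Initially the prism is cut into three tetrahedra by the diagonals `05`, `15` and `04`.  The
move applies to it the half turn `0 ↔ 4, 1 ↔ 3, 2 ↔ 5`, which interchanges the ends, interchanges
the two glued sides, and preserves the third side with its diagonal `04`; the result is the prism
cut by the diagonals `42`, `32` and `04`. -/
def PrismFlipAlong (ψ : Fin 6 → Fin 6) (T : FaceGluing ι) (T' : FaceGluing ι') : Prop :=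
  ReplacePatch
    (foldedPatch ![![0, 1, 2, 5], ![0, 1, 4, 5], ![0, 3, 4, 5]] {1, 2, 4, 5} ψ)
    (foldedPatch ![![4, 3, 5, 2], ![4, 3, 0, 2], ![4, 1, 0, 2]] {1, 2, 4, 5} ψ) T T'

/-- Prism flip of type A: the two sides are folded together along their common edge `25`,
so that `1, 2, 4, 5` are glued to `0, 2, 3, 5`. -/
def PrismFlipA (T : FaceGluing ι) (T' : FaceGluing ι') : Prop :=
  PrismFlipAlong ![0, 0, 2, 3, 3, 5] T T'

/-- Prism flip of type B: the same two sides are folded together with a half twist,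
so that `1, 2, 4, 5` are glued to `5, 3, 2, 0`. -/
def PrismFlipB (T : FaceGluing ι) (T' : FaceGluing ι') : Prop :=
  PrismFlipAlong ![0, 5, 3, 3, 2, 0] T T'

end Moves

/-!
Both `T` and `T'` arise from the same gluing `I` by a 3-2 move: one at an edge surrounded by three
tetrahedra `a i`, the other at an edge surrounded by three tetrahedra `b i`.  Everything depends on
how these two triples overlap.  The relation between a gluing and the result of a 3-2 move at a
given edge is `Reduces`, and the moves are translated into it by `Move23.exists_reduces`,
`Move32.exists_reduces` and `Reduces.replaced`.

If no tetrahedron is common, the two moves commute: the second edge survives the first move, the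
3-2 move at it can be performed (`exists_reduces_of_ring`), and the result is the same in either
order (`Reduces.commute`).  This is the second alternative of the theorem.

Otherwise take a common tetrahedron (`Reduces.of_common`).  In it the two edges are equal, adjacent
or opposite, and the symmetries of the two edges bring the positions to a normal form.

* If they are equal, the gluings around the edge force the two moves to be the same.
* If they are adjacent, the gluing of the face that contains them forces a second common
  tetrahedron.  With a third one the results are isomorphic; without it the composition is the
  pillow flip.
* If they are opposite and there is no other common tetrahedron, the composition is the octahedron
  flip.  With exactly one more common tetrahedron, the edges are opposite there too, and the gluings
  around the edges leave four ways in which the second tetrahedron can lie.  Two of them give the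
  two prism flips.  In the other two, one of `T` and `T'` has a tetrahedron two of whose faces are
  glued by a twist.  If all three tetrahedra are common, there is such a twist or the results are
  isomorphic.

For each overlap the finitely many tetrahedra concerned are described by a template `EdgeFrame`, and
a finite computation with the template checks the labels of the patches.  The outer parts are dealt
with once and for all by `IsBistellarAt.replacePatch` and `IsBistellarAt.isomorphic`.

The twist is the only place where the hypothesis on manifolds is used.  Two faces of a tetrahedron
glued by a map fixing one common vertex and moving the other make the link of the fixed vertex
contain a Möbius band, which is impossible in a manifold
(`FaceGluing.IsThreeManifoldTriangulation.not_isTwisted`).  No homology is needed for this: near the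
vertex, small spheres around the points of one tetrahedron can be carried through the twist, which
gives a homotopy between an embedding of the sphere and its composition with a reflection.  Such a
homotopy would turn into a family of quaternions relating a point of the sphere to its mirror image,
and from that into a nonvanishing tangent field on the sphere, against the hairy ball theorem, which
is proved here by lifting maps to the complex logarithm.
-/

/-! ### Tangent fields on the sphere and reflections -/

/-- Nonvanishing functions on the plane have continuous logarithms, so a relation of this kind would
give a continuous logarithm of `z ^ 2` on the unit circle. -/
theorem not_exists_continuous_eq_sq_on_circle {f g : ℂ → ℂ} (hf : Continuous f)
    (hg : Continuous g) (hf0 : ∀ z, f z ≠ 0) (hg0 : ∀ z, g z ≠ 0) :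
    ¬ ∀ z : ℂ, ‖z‖ = 1 → g z = - (starRingEnd ℂ (f z)) * z ^ 2 := by
  intro h
  have log : ∀ {k : ℂ → ℂ}, Continuous k → (∀ z, k z ≠ 0) →
      ∃ K : ℂ → ℂ, Continuous K ∧ ∀ z, Complex.exp (K z) = k z := by
    intro k hk hk0
    obtain ⟨K, hK, hK'⟩ := Complex.exists_continuousOn_eqOn_exp_comp (U := (Set.univ : Set ℂ))
      (by
        have : ContractibleSpace (Set.univ : Set ℂ) :=
          convex_univ.contractibleSpace Set.univ_nonempty
        exact (inferInstance : SimplyConnectedSpace (Set.univ : Set ℂ)))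
      isOpen_univ (g := k) hk.continuousOn (by
        rintro ⟨z, -, hz⟩; exact hk0 z hz)
    exact ⟨K, continuousOn_univ.1 hK, fun z => hK' (Set.mem_univ z)⟩
  obtain ⟨F, hF, hF'⟩ := log hf hf0
  obtain ⟨G, hG, hG'⟩ := log hg hg0
  let c : ℝ → ℂ := fun θ => Complex.exp (θ * Complex.I)
  have hc : Continuous c := by fun_prop
  let L : ℝ → ℂ := fun θ =>
    G (c θ) - starRingEnd ℂ (F (c θ)) + Real.pi * Complex.I - 2 * θ * Complex.I
  have hL : Continuous L := by
    have : Continuous fun θ => starRingEnd ℂ (F (c θ)) :=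
      Complex.continuous_conj.comp (hF.comp hc)
    have h2 : Continuous fun θ => G (c θ) := hG.comp hc
    fun_prop
  have hexp : ∀ θ, Complex.exp (L θ) = 1 := by
    intro θ
    have h1 : ‖c θ‖ = 1 := Complex.norm_exp_ofReal_mul_I θ
    have h2 := h _ h1
    have h3 : c θ ^ 2 = Complex.exp (2 * θ * Complex.I) := by
      rw [← Complex.exp_nat_mul]; congr 1; push_cast; ring
    have h4 : starRingEnd ℂ (f (c θ)) ≠ 0 := by simpa using hf0 (c θ)
    simp only [L]
    rw [Complex.exp_sub, Complex.exp_add, Complex.exp_sub, hG', ← h3, Complex.exp_conj, hF', h2,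
      Complex.exp_pi_mul_I]
    have h5 : c θ ≠ 0 := Complex.exp_ne_zero _
    field_simp
  have hint : ∀ θ, ∃ n : ℤ, L θ = n * (2 * Real.pi * Complex.I) := fun θ =>
    Complex.exp_eq_one_iff.1 (hexp θ)
  choose N hN using hint
  have hpi : (2 * Real.pi : ℝ) ≠ 0 := by positivity
  have hNc : Continuous fun θ => (N θ : ℝ) := by
    have : (fun θ => (N θ : ℝ)) = fun θ => (L θ).im / (2 * Real.pi) := by
      funext θ
      rw [hN θ]
      simp
    rw [this]
    fun_prop
  have hNc' : Continuous N := Int.isClosedEmbedding_coe_real.isInducing.continuous_iff.2 hNc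
  have hconst : N 0 = N (2 * Real.pi) :=
    PreconnectedSpace.constant inferInstance hNc'
  have hL0 : L 0 = L (2 * Real.pi) := by rw [hN, hN, hconst]
  have hcc : c (2 * Real.pi) = c 0 := by simp [c]
  simp only [L, hcc] at hL0
  have := congrArg Complex.im hL0
  simp only [Complex.sub_im, Complex.add_im, Complex.mul_im, Complex.ofReal_re, Complex.ofReal_im,
    Complex.I_re, Complex.I_im, Complex.mul_re, Complex.re_ofNat, Complex.im_ofNat] at this
  linarith [Real.pi_pos]

/-- The standard three-dimensional Euclidean space. -/
abbrev E3 : Type := EuclideanSpace ℝ (Fin 3)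

/-- The unit sphere in `E3`. -/
abbrev S2 : Type := Metric.sphere (0 : E3) 1

theorem S2.sq_add_sq_add_sq (v : S2) : v.1 0 ^ 2 + v.1 1 ^ 2 + v.1 2 ^ 2 = 1 := by
  have h := EuclideanSpace.norm_sq_eq v.1
  have h1 : ‖v.1‖ = 1 := by simp
  rw [h1] at h
  simpa [Fin.sum_univ_three] using h.symm

/-- The hairy ball theorem in dimension two. -/
theorem not_exists_tangent_field (w : S2 → E3) (hw : Continuous w) (hw0 : ∀ v, w v ≠ 0) :
    ¬ ∀ v : S2, w v 0 * v.1 0 + w v 1 * v.1 1 + w v 2 * v.1 2 = 0 := by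
  intro htan
  -- the point of the upper (`s = 1`) or lower (`s = -1`) hemisphere above the radial
  -- retraction of `z` to the closed unit disc
  let ρ : ℂ → ℂ := fun z => z / (max 1 ‖z‖ : ℝ)
  have hρc : Continuous ρ := by
    refine continuous_id.div (by fun_prop) (fun z => ?_)
    have : (0 : ℝ) < max 1 ‖z‖ := lt_max_of_lt_left one_pos
    exact_mod_cast this.ne'
  have hρn : ∀ z, Complex.normSq (ρ z) ≤ 1 := by
    intro z
    have hpos : (0 : ℝ) < max 1 ‖z‖ := lt_max_of_lt_left one_pos
    rw [Complex.normSq_eq_norm_sq]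
    have : ‖ρ z‖ ≤ 1 := by
      simp only [ρ, norm_div, Complex.norm_real, Real.norm_eq_abs, abs_of_pos hpos]
      exact (div_le_one hpos).2 (le_max_right _ _)
    nlinarith [norm_nonneg (ρ z)]
  have hρ1 : ∀ z : ℂ, ‖z‖ = 1 → ρ z = z := by
    intro z hz; simp [ρ, hz]
  let P : ℝ → ℂ → E3 := fun s z => !₂[(ρ z).re, (ρ z).im, s * √(1 - Complex.normSq (ρ z))]
  have hP : ∀ s : ℝ, s ^ 2 = 1 → ∀ z, P s z ∈ Metric.sphere (0 : E3) 1 := by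
    intro s hs z
    have h1 : ‖P s z‖ ^ 2 = 1 := by
      rw [EuclideanSpace.norm_sq_eq]
      have := Real.sq_sqrt (sub_nonneg.2 (hρn z))
      simp [Fin.sum_univ_three, P, mul_pow, hs, this]
      rw [Complex.normSq_apply]; ring
    have h2 : ‖P s z‖ = 1 := by
      have := norm_nonneg (P s z)
      nlinarith
    simp [h2]
  have hPc : ∀ s : ℝ, Continuous (P s) := by
    intro s
    have h1 : Continuous fun z => Complex.normSq (ρ z) := Complex.continuous_normSq.comp hρc
    refine (PiLp.continuous_toLp 2 _).comp ?_
    refine continuous_pi fun i => ?_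
    fin_cases i
    · exact Complex.continuous_re.comp hρc
    · exact Complex.continuous_im.comp hρc
    · exact continuous_const.mul (Real.continuous_sqrt.comp (continuous_const.sub h1))
  -- the horizontal part of the field after rotating the tangent plane to the pole `(0, 0, s)`
  let f : (s : ℝ) → (s ^ 2 = 1) → ℂ → ℂ := fun s hs z =>
    let u := w ⟨P s z, hP s hs z⟩
    ⟨(1 + s * P s z 2) * u 0 - s * u 2 * P s z 0, (1 + s * P s z 2) * u 1 - s * u 2 * P s z 1⟩
  have hfc : ∀ s hs, Continuous (f s hs) := by
    intro s hs
    have hu : Continuous fun z => w ⟨P s z, hP s hs z⟩ :=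
      hw.comp (Continuous.subtype_mk (hPc s) _)
    have hui : ∀ i, Continuous fun z => w ⟨P s z, hP s hs z⟩ i := fun i =>
      (PiLp.continuous_apply 2 _ i).comp hu
    have hPi : ∀ i, Continuous fun z => P s z i := fun i =>
      (PiLp.continuous_apply 2 _ i).comp (hPc s)
    have hre : Continuous fun z => (f s hs z).re := by
      simp only [f]; fun_prop
    have him : Continuous fun z => (f s hs z).im := by
      simp only [f]; fun_prop
    have : f s hs = fun z => ((f s hs z).re : ℂ) + (f s hs z).im * Complex.I := by
      funext z; simp
    rw [this]
    fun_prop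
  have hf0 : ∀ s hs z, f s hs z ≠ 0 := by
    intro s hs z h
    have h0 := hw0 ⟨P s z, hP s hs z⟩
    have ht := htan ⟨P s z, hP s hs z⟩
    have hsq := S2.sq_add_sq_add_sq ⟨P s z, hP s hs z⟩
    have hnn : 0 ≤ s * P s z 2 := by
      have : s * P s z 2 = s ^ 2 * √(1 - Complex.normSq (ρ z)) := by simp [P]; ring
      rw [this]; positivity
    have hre := congrArg Complex.re h
    have him := congrArg Complex.im h
    simp only [f, Complex.zero_re, Complex.zero_im] at hre him ht hsq
    set u := w ⟨P s z, hP s hs z⟩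
    set x := P s z
    have h2 : u 2 = 0 := by
      have e : (1 + s * x 2) * u 2 = 0 := by
        linear_combination s * (1 + s * x 2) * ht - s * x 0 * hre - s * x 1 * him
          - s ^ 2 * u 2 * hsq - u 2 * hs
      have : (1 + s * x 2) ≠ 0 := by positivity
      simpa [this] using e
    have hp : (1 + s * x 2) ≠ 0 := by positivity
    have h00 : u 0 = 0 := by simpa [h2, hp] using hre
    have h11 : u 1 = 0 := by simpa [h2, hp] using him
    apply h0
    ext i
    fin_cases i
    · exact h00
    · exact h11
    · exact h2
  refine not_exists_continuous_eq_sq_on_circle (hfc 1 (by norm_num)) (hfc (-1) (by norm_num))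
    (hf0 1 (by norm_num)) (hf0 (-1) (by norm_num)) ?_
  intro z hz
  have hn : Complex.normSq z = 1 := by rw [Complex.normSq_eq_norm_sq, hz]; norm_num
  have hz2 : z.re * z.re + z.im * z.im = 1 := by rw [← Complex.normSq_apply]; exact hn
  have hPz : ∀ s, P s z = !₂[z.re, z.im, 0] := by
    intro s; simp [P, hρ1 z hz, hn]
  have hw' : w ⟨P (-1) z, hP (-1) (by norm_num) z⟩ = w ⟨P 1 z, hP 1 (by norm_num) z⟩ := by
    congr 2; rw [hPz, hPz]
  have ht := htan ⟨P 1 z, hP 1 (by norm_num) z⟩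
  have q0 : ∀ s, P s z 0 = z.re := fun s => by rw [hPz]; simp
  have q1 : ∀ s, P s z 1 = z.im := fun s => by rw [hPz]; simp
  have q2 : ∀ s, P s z 2 = 0 := fun s => by rw [hPz]; simp
  simp only [q0, q1, q2] at ht
  set u := w ⟨P 1 z, hP 1 (by norm_num) z⟩
  apply Complex.ext
  · simp only [f, hw', q0, q1, q2, Complex.mul_re, Complex.neg_re, Complex.conj_re, Complex.neg_im,
      Complex.conj_im, pow_two, Complex.mul_im]
    linear_combination (2 * z.re) * ht + (-u 2 * z.re - u 0) * hz2
  · simp only [f, hw', q0, q1, q2, Complex.mul_re, Complex.neg_re, Complex.conj_re, Complex.neg_im,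
      Complex.conj_im, pow_two, Complex.mul_im]
    linear_combination (2 * z.im) * ht + (-u 2 * z.im - u 1) * hz2

/-! ### Homotopic maps from the sphere and rotations -/

section Rotations

open scoped Quaternion unitInterval

/-- The nonzero vectors of `E3`, a space homotopy equivalent to the sphere. -/
abbrev Punctured : Type := {y : E3 // y ≠ 0}

/-- The imaginary quaternion with given coordinates. -/
noncomputable def imagQuaternion (y : E3) : ℍ[ℝ] :=
  Quaternion.linearIsometryEquivTuple.symm !₂[0, y 0, y 1, y 2]

@[simp] theorem imagQuaternion_re (y : E3) : (imagQuaternion y).re = 0 := by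
  simp [imagQuaternion, Quaternion.linearIsometryEquivTuple_symm_apply]

@[simp] theorem imagQuaternion_imI (y : E3) : (imagQuaternion y).imI = y 0 := by
  simp [imagQuaternion, Quaternion.linearIsometryEquivTuple_symm_apply]

@[simp] theorem imagQuaternion_imJ (y : E3) : (imagQuaternion y).imJ = y 1 := by
  simp [imagQuaternion, Quaternion.linearIsometryEquivTuple_symm_apply]

@[simp] theorem imagQuaternion_imK (y : E3) : (imagQuaternion y).imK = y 2 := by
  simp [imagQuaternion, Quaternion.linearIsometryEquivTuple_symm_apply]

theorem continuous_imagQuaternion : Continuous imagQuaternion := by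
  have hi : ∀ i : Fin 3, Continuous fun y : E3 => y i := fun i => PiLp.continuous_apply 2 _ i
  refine Quaternion.linearIsometryEquivTuple.symm.continuous.comp
    ((PiLp.continuous_toLp 2 _).comp (continuous_pi fun i => ?_))
  fin_cases i
  · exact continuous_const
  · exact hi 0
  · exact hi 1
  · exact hi 2

/-- The unit imaginary quaternion in the direction of a nonzero vector. -/
noncomputable def unitImag (y : Punctured) : ℍ[ℝ] := ‖y.1‖⁻¹ • imagQuaternion y.1

theorem continuous_unitImag : Continuous unitImag := by
  have h : Continuous fun y : Punctured => ‖y.1‖ := continuous_norm.comp continuous_subtype_val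
  refine (h.inv₀ fun y => ?_).smul (continuous_imagQuaternion.comp continuous_subtype_val)
  simpa using y.2

theorem unitImag_mul_self (y : Punctured) : unitImag y * unitImag y = -1 := by
  have h := EuclideanSpace.norm_sq_eq y.1
  have h0 : ‖y.1‖ ≠ 0 := by simpa using y.2
  simp only [Fin.sum_univ_three, Real.norm_eq_abs, sq_abs] at h
  have h3 : ‖y.1‖⁻¹ * ‖y.1‖⁻¹ * (y.1 0 ^ 2 + y.1 1 ^ 2 + y.1 2 ^ 2) = 1 := by
    rw [← h]; field_simp
  ext
  · simp [unitImag]; linear_combination -h3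
  · simp [unitImag]; exact Or.inr (by ring)
  · simp [unitImag]; exact Or.inr (by ring)
  · simp [unitImag]; exact Or.inr (by ring)

theorem norm_unitImag (y : Punctured) : ‖unitImag y‖ = 1 := by
  have h := congrArg norm (unitImag_mul_self y)
  rw [norm_mul, norm_neg, norm_one] at h
  nlinarith [norm_nonneg (unitImag y)]

/-- Homotopic maps from the sphere to the punctured space differ by a continuous family of
rotations, represented by nonzero quaternions.  Nearby maps differ by the family of the shortest
rotations, and the relation is transitive. -/
theorem exists_quaternion_of_homotopic {f g : C(S2, Punctured)} (h : f.Homotopic g) :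
    ∃ Q : S2 → ℍ[ℝ], Continuous Q ∧ (∀ v, Q v ≠ 0) ∧
      ∀ v, Q v * unitImag (f v) = unitImag (g v) * Q v := by
  obtain ⟨H⟩ := h
  let K : C(I, C(S2, ℍ[ℝ])) :=
    ContinuousMap.curry ⟨fun p => unitImag (H p), continuous_unitImag.comp H.continuous⟩
  have key := (isPreconnected_univ (α := I)).induction₂
    (fun s t => ∃ Q : S2 → ℍ[ℝ], Continuous Q ∧ (∀ v, Q v ≠ 0) ∧
      ∀ v, Q v * K s v = K t v * Q v) ?_ ?_ ?_ (Set.mem_univ 0) (Set.mem_univ 1)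
  · simpa [K] using key
  · intro s _
    rw [nhdsWithin_univ]
    have h1 : ∀ᶠ t in nhds s, dist (K t) (K s) < 1 :=
      (K.continuous.tendsto s).eventually (Metric.ball_mem_nhds _ one_pos)
    filter_upwards [h1] with t ht
    refine ⟨fun v => 1 - K t v * K s v, by fun_prop, fun v h0 => ?_, fun v => ?_⟩
    · have hd : dist (K t v) (K s v) < 1 := lt_of_le_of_lt (ContinuousMap.dist_apply_le_dist v) ht
      have hs : K s v * K s v = -1 := unitImag_mul_self _
      have e : K s v + K t v = 0 := by
        have : (1 - K t v * K s v) * K s v = 0 := by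
          show (fun v => 1 - K t v * K s v) v * K s v = 0
          rw [h0, zero_mul]
        rw [sub_mul, mul_assoc, hs] at this
        simpa using this
      have e2 : K t v = - K s v := by
        rw [eq_neg_iff_add_eq_zero, add_comm]; exact e
      have hn : ‖K s v‖ = 1 := norm_unitImag _
      rw [e2, dist_eq_norm, ← neg_add', norm_neg, ← two_smul ℝ, norm_smul, hn] at hd
      norm_num at hd
    · have hs : K s v * K s v = -1 := unitImag_mul_self _
      have ht : K t v * K t v = -1 := unitImag_mul_self _
      simp only [sub_mul, mul_sub, one_mul, mul_one]
      rw [mul_assoc, hs, ← mul_assoc, ht, mul_neg, mul_one, neg_mul, one_mul, sub_neg_eq_add,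
        sub_neg_eq_add, add_comm]
  · rintro s t r - - - ⟨Q, hQ, hQ0, hQe⟩ ⟨R, hR, hR0, hRe⟩
    refine ⟨fun v => R v * Q v, hR.mul hQ, fun v => mul_ne_zero (hR0 v) (hQ0 v), fun v => ?_⟩
    simp only
    rw [mul_assoc, hQe, ← mul_assoc, hRe, mul_assoc]
  · rintro s t - - ⟨Q, hQ, hQ0, hQe⟩
    refine ⟨fun v => (Q v)⁻¹, hQ.inv₀ hQ0, fun v => inv_ne_zero (hQ0 v), fun v => ?_⟩
    have := hQ0 v
    simp only
    rw [inv_mul_eq_iff_eq_mul₀ this, ← mul_assoc, hQe, mul_assoc, mul_inv_cancel₀ this, mul_one]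

/-- The reflection of the sphere that changes the sign of the second coordinate. -/
noncomputable def reflectS2 : C(S2, S2) where
  toFun v := ⟨!₂[v.1 0, -v.1 1, v.1 2], by
    have h := S2.sq_add_sq_add_sq v
    have h1 : ‖(!₂[v.1 0, -v.1 1, v.1 2] : E3)‖ ^ 2 = 1 := by
      rw [EuclideanSpace.norm_sq_eq]
      simpa [Fin.sum_univ_three] using h
    have h2 := norm_nonneg (!₂[v.1 0, -v.1 1, v.1 2] : E3)
    rw [mem_sphere_zero_iff_norm]
    nlinarith⟩
  continuous_toFun := by
    have hi : ∀ i : Fin 3, Continuous fun y : S2 => y.1 i := fun i =>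
      (PiLp.continuous_apply 2 _ i).comp continuous_subtype_val
    refine Continuous.subtype_mk ((PiLp.continuous_toLp 2 _).comp (continuous_pi fun i => ?_)) _
    fin_cases i
    · exact hi 0
    · exact (hi 1).neg
    · exact hi 2

/-- The inclusion of the sphere into the punctured space. -/
def inclS2 : C(S2, Punctured) where
  toFun v := ⟨v.1, by rintro h; have := v.2; rw [h] at this; simp at this⟩
  continuous_toFun := by fun_prop

/-- A reflection of the sphere is not homotopic to the identity.  The quaternions `Q v` relating the
two, multiplied by the quaternion unit whose half turn is the antipode of the reflection,
anticommute with `v`, so they form a nonvanishing tangent field. -/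
theorem not_homotopic_reflection : ¬ inclS2.Homotopic (inclS2.comp reflectS2) := by
  intro h
  obtain ⟨Q, hQ, hQ0, hQe⟩ := exists_quaternion_of_homotopic h
  -- `q = j Q`
  refine not_exists_tangent_field (fun v => !₂[(Q v).imK, (Q v).re, -(Q v).imI]) ?_ ?_ ?_
  · refine (PiLp.continuous_toLp 2 _).comp (continuous_pi fun i => ?_)
    fin_cases i
    · exact Quaternion.continuous_imK.comp hQ
    · exact Quaternion.continuous_re.comp hQ
    · exact (Quaternion.continuous_imI.comp hQ).neg
  all_goals
    have eq : ∀ v : S2, Q v * imagQuaternion v.1 = imagQuaternion (reflectS2 v).1 * Q v := by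
      intro v
      have h1 : ‖v.1‖ = 1 := by simp
      have h2 : ‖(reflectS2 v).1‖ = 1 := by simp
      simpa [unitImag, inclS2, h1, h2] using hQe v
  · intro v h0
    have e0 : (Q v).imK = 0 := by simpa using congrArg (fun y : E3 => y 0) h0
    have e1 : (Q v).re = 0 := by simpa using congrArg (fun y : E3 => y 1) h0
    have e2 : (Q v).imI = 0 := by simpa using congrArg (fun y : E3 => y 2) h0
    have h1 := congrArg QuaternionAlgebra.re (eq v)
    have h2 := congrArg QuaternionAlgebra.imI (eq v)
    have h3 := congrArg QuaternionAlgebra.imK (eq v)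
    simp [reflectS2, e0, e1, e2] at h1 h2 h3
    have hs := S2.sq_add_sq_add_sq v
    refine hQ0 v (QuaternionAlgebra.ext e1 e2 ?_ e0)
    show (Q v).imJ = 0
    linear_combination (-(Q v).imJ) * hs - v.1 1 / 2 * h1 + v.1 2 / 2 * h2 - v.1 0 / 2 * h3
  · intro v
    have h1 := congrArg QuaternionAlgebra.imJ (eq v)
    simp [reflectS2] at h1 ⊢
    linear_combination h1 / 2

end Rotations


/-! ### Local orientations of homeomorphisms of three-space -/

section LocalOrientation

open scoped unitInterval

/-- A family of nonvanishing vector-valued functions on the sphere, continuous on `[0, 1] × S²`,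
gives a homotopy between its ends. -/
theorem homotopic_of_family {f g : C(S2, Punctured)} (H : I → S2 → E3)
    (hH : Continuous fun p : I × S2 => H p.1 p.2) (hH0 : ∀ t v, H t v ≠ 0)
    (h0 : ∀ v, H 0 v = (f v).1) (h1 : ∀ v, H 1 v = (g v).1) : f.Homotopic g :=
  ⟨{ toFun := fun p => ⟨H p.1 p.2, hH0 _ _⟩
     continuous_toFun := hH.subtype_mk _
     map_zero_left := fun v => Subtype.ext (h0 v)
     map_one_left := fun v => Subtype.ext (h1 v) }⟩

/-- The map from the sphere to the punctured space given by the image of a small sphere around `p`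
under a map that is injective near `p`. -/
noncomputable def sphereImage (g : E3 → E3) (C : Set E3) (hg : ContinuousOn g C)
    (hi : Set.InjOn g C) (p : E3) (ε : ℝ) (hε : 0 < ε) (hC : Metric.closedBall p ε ⊆ C) :
    C(S2, Punctured) where
  toFun v := ⟨g (p + ε • v.1) - g p, by
    have h1 : p + ε • v.1 ∈ C := hC (by simp [norm_smul, abs_of_pos hε])
    have h2 : p ∈ C := hC (Metric.mem_closedBall_self hε.le)
    intro h
    have h3 := hi h1 h2 (sub_eq_zero.1 h)
    have h4 : ε • v.1 = 0 := by simpa using h3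
    have h5 : ‖v.1‖ = 1 := by simp
    rw [smul_eq_zero] at h4
    rcases h4 with h4 | h4
    · exact hε.ne' h4
    · rw [h4] at h5; simp at h5⟩
  continuous_toFun := by
    refine Continuous.subtype_mk (Continuous.sub ?_ continuous_const) _
    refine hg.comp_continuous (by fun_prop) fun v => hC ?_
    simp [norm_smul, abs_of_pos hε]

/-- The homotopy class of `sphereImage` depends neither on the centre nor on the radius. -/
theorem sphereImage_homotopic {g : E3 → E3} {C : Set E3} (hg : ContinuousOn g C)
    (hi : Set.InjOn g C) (hconv : Convex ℝ C) {p q : E3} {ε δ : ℝ} (hε : 0 < ε) (hδ : 0 < δ)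
    (hp : Metric.closedBall p ε ⊆ C) (hq : Metric.closedBall q δ ⊆ C) :
    (sphereImage g C hg hi p ε hε hp).Homotopic (sphereImage g C hg hi q δ hδ hq) := by
  have mem : ∀ (t : I) (v : E3), ‖v‖ ≤ 1 →
      ((1 - t : ℝ) • p + (t : ℝ) • q) + ((1 - t : ℝ) * ε + t * δ) • v ∈ C := by
    intro t v hv
    have e : ((1 - t : ℝ) • p + (t : ℝ) • q) + ((1 - t : ℝ) * ε + t * δ) • v =
        (1 - t : ℝ) • (p + ε • v) + (t : ℝ) • (q + δ • v) := by module
    rw [e]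
    refine hconv (hp ?_) (hq ?_) (sub_nonneg.2 t.2.2) t.2.1 (by ring)
    · simp only [Metric.mem_closedBall, dist_self_add_left, norm_smul, Real.norm_eq_abs,
        abs_of_pos hε]
      nlinarith
    · simp only [Metric.mem_closedBall, dist_self_add_left, norm_smul, Real.norm_eq_abs,
        abs_of_pos hδ]
      nlinarith
  have mem0 : ∀ t : I, ((1 - t : ℝ) • p + (t : ℝ) • q) ∈ C := by
    intro t; simpa using mem t 0 (by simp)
  refine homotopic_of_family (fun t v =>
    g (((1 - t : ℝ) • p + (t : ℝ) • q) + ((1 - t : ℝ) * ε + t * δ) • v.1)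
      - g ((1 - t : ℝ) • p + (t : ℝ) • q)) ?_ ?_ ?_ ?_
  · refine Continuous.sub (hg.comp_continuous (by fun_prop) fun x => mem _ _ (by simp))
      (hg.comp_continuous (by fun_prop) fun x => mem0 _)
  · intro t v h
    have h3 := hi (mem t v.1 (by simp)) (mem0 t) (sub_eq_zero.1 h)
    have h4 : ((1 - t : ℝ) * ε + t * δ) • v.1 = 0 := by simpa using h3
    have h5 : ‖v.1‖ = 1 := by simp
    have h6 : (0 : ℝ) < (1 - t : ℝ) * ε + t * δ := by
      rcases t.2.1.eq_or_lt with h | h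
      · rw [← h]; simpa using hε
      · have := mul_pos h hδ
        have := mul_nonneg (sub_nonneg.2 t.2.2) hε.le
        linarith
    rw [smul_eq_zero] at h4
    rcases h4 with h4 | h4
    · exact h6.ne' h4
    · rw [h4] at h5; simp at h5
  · intro v; simp [sphereImage]
  · intro v; simp [sphereImage]

/-- A homeomorphism between open subsets of three-space has a well-defined local orientation
behaviour on a convex set: the images of small spheres are never related by a reflection. -/
theorem not_homotopic_sphereImage_reflection (g : OpenPartialHomeomorph E3 E3) {C : Set E3}
    (hC : C ⊆ g.source) (hconv : Convex ℝ C) {p q : E3} {ε δ : ℝ} (hε : 0 < ε) (hδ : 0 < δ)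
    (hp : Metric.closedBall p ε ⊆ C) (hq : Metric.closedBall q δ ⊆ C) :
    ¬ (sphereImage g C (g.continuousOn.mono hC) (g.injOn.mono hC) p ε hε hp).Homotopic
      ((sphereImage g C (g.continuousOn.mono hC) (g.injOn.mono hC) q δ hδ hq).comp
        reflectS2) := by
  intro h
  have hgc := g.continuousOn.mono hC
  have hgi := g.injOn.mono hC
  have hpC : p ∈ C := hp (Metric.mem_closedBall_self hε.le)
  have hgp : g p ∈ g.target := g.map_source (hC hpC)
  -- a ball around `g p` in the target, and a sphere around `p` mapped into it
  obtain ⟨r, hr, hrt⟩ := Metric.isOpen_iff.1 g.open_target _ hgp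
  obtain ⟨η₀, hη₀, hη₀r⟩ := Metric.continuousWithinAt_iff.1 (hgc p hpC) r hr
  obtain ⟨η, hη, hη1, hη2⟩ : ∃ η > 0, η ≤ ε ∧ η < η₀ :=
    ⟨min ε (η₀ / 2), lt_min hε (by positivity), min_le_left _ _,
      lt_of_le_of_lt (min_le_right _ _) (by linarith)⟩
  have hpη : Metric.closedBall p η ⊆ C := (Metric.closedBall_subset_closedBall hη1).trans hp
  set ψ := sphereImage g C hgc hgi p η hη hpη with hψ
  have hmemC : ∀ v : S2, p + η • v.1 ∈ C := fun v => hpη (by simp [norm_smul, abs_of_pos hη])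
  have hψr : ∀ v, ‖(ψ v).1‖ < r := by
    intro v
    have := hη₀r (hmemC v) (by simpa [norm_smul, abs_of_pos hη] using hη2)
    rwa [dist_eq_norm] at this
  have hψψ : ψ.Homotopic (ψ.comp reflectS2) :=
    ((sphereImage_homotopic hgc hgi hconv hη hε hpη hp).trans h).trans
      ((sphereImage_homotopic hgc hgi hconv hδ hη hq hpη).comp (.refl _))
  have hball : ∀ y : E3, ‖y‖ < r → g p + y ∈ g.target := fun y hy => hrt (by simpa using hy)
  have hinj : ∀ y : E3, ‖y‖ < r → y ≠ 0 → g.symm (g p + y) - p ≠ 0 := by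
    intro y hy hy0 h0
    have e : g.symm (g p + y) = p := sub_eq_zero.1 h0
    have := g.right_inv (hball y hy)
    rw [e] at this
    exact hy0 (by simpa using this)
  -- radial projection to a small sphere followed by the inverse of `g`
  have hnorm : ∀ y : Punctured, ‖(r / 2 * ‖y.1‖⁻¹) • y.1‖ < r := by
    intro y
    have : ‖y.1‖ ≠ 0 := by simpa using y.2
    rw [norm_smul, Real.norm_eq_abs, abs_of_nonneg (by positivity), mul_assoc,
      inv_mul_cancel₀ this]
    linarith
  have hnc : Continuous fun y : Punctured => ‖y.1‖⁻¹ :=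
    Continuous.inv₀ (continuous_norm.comp continuous_subtype_val) fun y => by simpa using y.2
  let Θ : C(Punctured, Punctured) :=
    { toFun := fun y => ⟨g.symm (g p + (r / 2 * ‖y.1‖⁻¹) • y.1) - p, hinj _ (hnorm y) (by
        have : ‖y.1‖ ≠ 0 := by simpa using y.2
        have h1 : r / 2 * ‖y.1‖⁻¹ ≠ 0 := by positivity
        exact smul_ne_zero h1 y.2)⟩
      continuous_toFun := by
        refine Continuous.subtype_mk (Continuous.sub ?_ continuous_const) _
        exact g.symm.continuousOn.comp_continuous (by fun_prop) fun y => hball _ (hnorm y) }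
  have key : (Θ.comp ψ).Homotopic inclS2 := by
    let sc : C(S2, Punctured) :=
      ⟨fun v => ⟨η • v.1, smul_ne_zero hη.ne' (inclS2 v).2⟩, by fun_prop⟩
    have k1 : sc.Homotopic inclS2 := by
      refine homotopic_of_family (fun t v => ((1 - t : ℝ) * η + t) • v.1) (by fun_prop) ?_ ?_ ?_
      · intro t v
        refine smul_ne_zero ?_ (inclS2 v).2
        rcases t.2.1.eq_or_lt with h | h
        · rw [← h]; simpa using hη.ne'
        · have := mul_nonneg (sub_nonneg.2 t.2.2) hη.le
          positivity
      · intro v; simp [sc]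
      · intro v; simp [inclS2]
    have k2 : (Θ.comp ψ).Homotopic sc := by
      have bd : ∀ (t : I) (v : S2),
          0 < (1 - t : ℝ) * (r / 2 * ‖(ψ v).1‖⁻¹) + t ∧
          ‖((1 - t : ℝ) * (r / 2 * ‖(ψ v).1‖⁻¹) + t) • (ψ v).1‖ < r := by
        intro t v
        have h0 : 0 < ‖(ψ v).1‖ := by simpa using (ψ v).2
        have t0 := t.2.1
        have t1 : (0 : ℝ) ≤ 1 - t := sub_nonneg.2 t.2.2
        have hpos : 0 < (1 - t : ℝ) * (r / 2 * ‖(ψ v).1‖⁻¹) + t := by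
          rcases t0.eq_or_lt with h | h
          · rw [← h]; simp; positivity
          · positivity
        refine ⟨hpos, ?_⟩
        rw [norm_smul, Real.norm_eq_abs, abs_of_pos hpos, add_mul, mul_assoc, mul_assoc,
          inv_mul_cancel₀ h0.ne']
        have := hψr v
        rcases t0.eq_or_lt with h | h
        · rw [← h]; linarith
        · nlinarith
      refine homotopic_of_family (fun t v =>
        g.symm (g p + ((1 - t : ℝ) * (r / 2 * ‖(ψ v).1‖⁻¹) + t) • (ψ v).1) - p) ?_ ?_ ?_ ?_
      · refine Continuous.sub ?_ continuous_const
        have hc : Continuous fun v : S2 => (ψ v).1 := continuous_subtype_val.comp ψ.continuous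
        have hc' : Continuous fun v : S2 => ‖(ψ v).1‖⁻¹ := hnc.comp ψ.continuous
        have c1 : Continuous fun x : I × S2 => (ψ x.2).1 := hc.comp continuous_snd
        have c2 : Continuous fun x : I × S2 => ‖(ψ x.2).1‖⁻¹ := hc'.comp continuous_snd
        refine g.symm.continuousOn.comp_continuous ?_ fun x => hball _ (bd x.1 x.2).2
        fun_prop
      · intro t v
        exact hinj _ (bd t v).2 (smul_ne_zero (bd t v).1.ne' (ψ v).2)
      · intro v; simp [Θ]
      · intro v
        have : g.symm (g (p + η • v.1)) = p + η • v.1 := g.left_inv (hC (hmemC v))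
        simp [sc, hψ, sphereImage, this]
    exact k2.trans k1
  exact not_homotopic_reflection
    ((key.symm.trans ((ContinuousMap.Homotopic.refl Θ).comp hψψ)).trans (key.comp (.refl _)))

end LocalOrientation


/-! ### A tetrahedron with two faces glued by a twist -/

namespace FaceGluing

variable {ι : Type}

/-- The permutation `1 ↦ 2 ↦ 3 ↦ 1` of the vertices of a tetrahedron. -/
def rot3 : Equiv.Perm (Fin 4) := ⟨![0, 2, 3, 1], ![0, 3, 1, 2], by decide, by decide⟩

/-- The face `012` of the tetrahedron `t`, in the frame `s`, is glued to the face `023` of the same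
tetrahedron by `0 ↦ 0`, `1 ↦ 2`, `2 ↦ 3`, so that the link of the vertex `0` contains the Möbius
band formed by the triangle `123` with its side `12` glued to its side `23`. -/
def IsTwisted (T : FaceGluing ι) (t : ι) (s : Equiv.Perm (Fin 4)) : Prop :=
  T.adj t (s 3) = t ∧ T.perm t (s 3) = s * rot3 * s⁻¹

open Classical in
/-- The point of the tetrahedron `t` with barycentric coordinates `y` in the frame `s` (an
arbitrary point when `y` is not a vector of barycentric coordinates). -/
noncomputable def framePoint (T : FaceGluing ι) (t : ι) (s : Equiv.Perm (Fin 4))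
    (y : Fin 4 → ℝ) : T.Space :=
  Quot.mk _ ⟨t, if h : y ∘ s.symm ∈ stdSimplex ℝ (Fin 4) then ⟨_, h⟩
    else ⟨_, single_mem_stdSimplex ℝ 0⟩⟩

theorem comp_perm_mem_stdSimplex {y : Fin 4 → ℝ} (s : Equiv.Perm (Fin 4)) :
    y ∘ s ∈ stdSimplex ℝ (Fin 4) ↔ y ∈ stdSimplex ℝ (Fin 4) := by
  simp only [stdSimplex, Set.mem_ofPred_eq, Function.comp_apply, Equiv.sum_comp s y]
  exact and_congr_left fun _ => s.forall_congr_left.trans (by simp)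

theorem framePoint_eq (T : FaceGluing ι) (t : ι) (s : Equiv.Perm (Fin 4)) {y : Fin 4 → ℝ}
    (hy : y ∈ stdSimplex ℝ (Fin 4)) :
    T.framePoint t s y = Quot.mk _ ⟨t, ⟨y ∘ s.symm, (comp_perm_mem_stdSimplex _).2 hy⟩⟩ := by
  have h : y ∘ s.symm ∈ stdSimplex ℝ (Fin 4) := (comp_perm_mem_stdSimplex _).2 hy
  simp only [framePoint, dif_pos h]

theorem mk_eq_framePoint (T : FaceGluing ι) (t : ι) (s : Equiv.Perm (Fin 4))
    (p : stdSimplex ℝ (Fin 4)) :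
    (Quot.mk _ ⟨t, p⟩ : T.Space) = T.framePoint t s (p.1 ∘ s) := by
  rw [framePoint_eq T t s ((comp_perm_mem_stdSimplex s).2 p.2)]
  congr 2
  apply Subtype.ext
  funext v
  exact congrArg p.1 (s.apply_symm_apply v).symm

theorem continuousOn_framePoint (T : FaceGluing ι) (t : ι) (s : Equiv.Perm (Fin 4)) :
    ContinuousOn (T.framePoint t s) (stdSimplex ℝ (Fin 4)) := by
  rw [continuousOn_iff_continuous_domRestrict]
  have h : Continuous fun y : stdSimplex ℝ (Fin 4) =>
      (Quot.mk _ ⟨t, ⟨y.1 ∘ s.symm, (comp_perm_mem_stdSimplex _).2 y.2⟩⟩ : T.Space) := by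
    refine continuous_quot_mk.comp (continuous_sigmaMk.comp (Continuous.subtype_mk ?_ _))
    exact continuous_pi fun i => (continuous_apply _).comp continuous_subtype_val
  refine h.congr fun y => ?_
  exact (framePoint_eq T t s y.2).symm

theorem GluedTo.symm {T : FaceGluing ι} {p q : Points ι} (h : T.GluedTo p q) : T.GluedTo q p := by
  obtain ⟨f, hf, h1, h2⟩ := h
  obtain ⟨tp, p⟩ := p
  obtain ⟨tq, q⟩ := q
  simp only at h1 h2 hf
  subst h1
  refine ⟨T.perm tp f f, (h2 f).trans hf, (T.adj_adj tp f).symm, fun v => ?_⟩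
  have := h2 ((T.perm tp f)⁻¹ v)
  simp only [Equiv.Perm.coe_inv, Equiv.apply_symm_apply] at this
  simp only [T.perm_perm, this]
  rfl

section Twisted

variable {T : FaceGluing ι} {t : ι} {s : Equiv.Perm (Fin 4)}

theorem IsTwisted.framePoint_eq (h : T.IsTwisted t s) {y : Fin 4 → ℝ}
    (hy : y ∈ stdSimplex ℝ (Fin 4)) (hy3 : y 3 = 0) :
    T.framePoint t s y = T.framePoint t s ![y 0, 0, y 1, y 2] := by
  have hy' : ![y 0, 0, y 1, y 2] ∈ stdSimplex ℝ (Fin 4) := by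
    refine ⟨fun i => ?_, ?_⟩
    · fin_cases i
      · exact hy.1 0
      · exact le_rfl
      · exact hy.1 1
      · exact hy.1 2
    · have := hy.2
      simp [Fin.sum_univ_four, hy3] at this ⊢
      linarith
  rw [FaceGluing.framePoint_eq T t s hy, FaceGluing.framePoint_eq T t s hy']
  refine Quot.sound ⟨s 3, by simpa using hy3, h.1.symm, fun v => ?_⟩
  obtain ⟨i, rfl⟩ := s.surjective v
  simp only [h.2, Equiv.Perm.mul_apply, Equiv.Perm.coe_inv, Function.comp_apply,
    Equiv.symm_apply_apply]
  fin_cases i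
  · rfl
  · rfl
  · rfl
  · exact hy3.symm

/-- A function of the barycentric coordinates of a twisted tetrahedron that descends to the glued
space when it is extended by zero to the other tetrahedra. -/
structure Descends (F : (Fin 4 → ℝ) → ℝ) : Prop where
  continuous : Continuous F
  zero_left : ∀ y, y 0 = 0 → F y = 0
  zero_right : ∀ y, y 2 = 0 → F y = 0
  glue : ∀ y, y ∈ stdSimplex ℝ (Fin 4) → y 3 = 0 → F ![y 0, 0, y 1, y 2] = F y

open Classical in
/-- The function on the glued space induced by a function on a twisted tetrahedron. -/
noncomputable def descend (T : FaceGluing ι) (t : ι) (s : Equiv.Perm (Fin 4))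
    (h : T.IsTwisted t s) {F : (Fin 4 → ℝ) → ℝ} (hF : Descends F) : T.Space → ℝ :=
  Quot.lift (fun p => if p.1 = t then F (p.2.1 ∘ s) else 0) (by
    -- half of the claim suffices, since the gluing relation is symmetric
    have main : ∀ p q, T.GluedTo p q → (if p.1 = t then F (p.2.1 ∘ s) else 0) ≠ 0 →
        (if q.1 = t then F (q.2.1 ∘ s) else 0) = (if p.1 = t then F (p.2.1 ∘ s) else 0) := by
      rintro ⟨tp, p⟩ ⟨tq, q⟩ ⟨f, hf, h1, h2⟩ h0
      simp only at h1 h2 hf h0 ⊢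
      by_cases htp : tp = t
      swap
      · simp [htp] at h0
      subst htp
      simp only [if_true] at h0 ⊢
      have hpm := (comp_perm_mem_stdSimplex s).2 p.2
      have hqm := (comp_perm_mem_stdSimplex s).2 q.2
      obtain ⟨i, rfl⟩ := s.surjective f
      have inv : T.adj tp (s 1) = tp ∧ T.perm tp (s 1) = s * rot3⁻¹ * s⁻¹ := by
        have e : T.perm tp (s 3) (s 3) = s 1 := by rw [h.2]; simp [rot3]
        have a1 := T.adj_adj tp (s 3)
        have a2 := T.perm_perm tp (s 3)
        rw [h.1, e] at a1 a2
        refine ⟨a1, ?_⟩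
        rw [a2, h.2]
        group
      fin_cases i
      · exact absurd (hF.zero_left _ hf) h0
      · have hq : tq = tp := h1.trans inv.1
        subst hq
        rw [if_pos rfl]
        have e : ∀ j, q.1 (s (rot3⁻¹ j)) = p.1 (s j) := by
          intro j
          have := h2 (s j)
          simp only [Fin.mk_one, Fin.isValue] at this
          rw [inv.2] at this
          simpa using this
        have e0 : q.1 (s 0) = p.1 (s 0) := e 0
        have e1 : q.1 (s 3) = p.1 (s 1) := e 1
        have e2 : q.1 (s 1) = p.1 (s 2) := e 2
        have e3 : q.1 (s 2) = p.1 (s 3) := e 3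
        have hf' : p.1 (s 1) = 0 := hf
        rw [← hF.glue _ hqm (e1.trans hf')]
        congr 1
        funext j
        fin_cases j
        · exact e0
        · exact hf'.symm
        · exact e2
        · exact e3
      · exact absurd (hF.zero_right _ hf) h0
      · have hq : tq = tp := h1.trans h.1
        subst hq
        rw [if_pos rfl]
        have e : ∀ j, q.1 (s (rot3 j)) = p.1 (s j) := by
          intro j
          have := h2 (s j)
          simp only [Fin.reduceFinMk] at this
          rw [h.2] at this
          simpa using this
        rw [← hF.glue _ hpm hf]
        congr 1
        funext j
        fin_cases j
        · exact e 0
        · exact (e 3).trans hf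
        · exact e 1
        · exact e 2
    intro p q hpq
    by_cases hp : (if p.1 = t then F (p.2.1 ∘ s) else 0) = 0
    · by_cases hq : (if q.1 = t then F (q.2.1 ∘ s) else 0) = 0
      · rw [hp, hq]
      · exact main _ _ hpq.symm hq
    · exact (main _ _ hpq hp).symm)

theorem descend_framePoint (h : T.IsTwisted t s) {F : (Fin 4 → ℝ) → ℝ} (hF : Descends F)
    {y : Fin 4 → ℝ} (hy : y ∈ stdSimplex ℝ (Fin 4)) :
    descend T t s h hF (T.framePoint t s y) = F y := by
  rw [FaceGluing.framePoint_eq T t s hy]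
  simp only [descend, if_true]
  congr 1
  funext i
  simp

theorem descend_eq_zero (h : T.IsTwisted t s) {F : (Fin 4 → ℝ) → ℝ} (hF : Descends F) {t' : ι}
    (ht : t' ≠ t) (p : stdSimplex ℝ (Fin 4)) :
    descend T t s h hF (Quot.mk _ ⟨t', p⟩) = 0 := by
  simp [descend, ht]

theorem continuous_descend (h : T.IsTwisted t s) {F : (Fin 4 → ℝ) → ℝ} (hF : Descends F) :
    Continuous (descend T t s h hF) := by
  classical
  refine continuous_quot_lift _ (continuous_sigma fun t' => ?_)
  by_cases ht : t' = t
  · simp only [ht, if_true]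
    refine hF.continuous.comp ?_
    exact continuous_pi fun i => (continuous_apply _).comp continuous_subtype_val
  · simp only [ht, if_false]
    exact continuous_const

end Twisted

end FaceGluing


namespace FaceGluing

variable {ι : Type} {T : FaceGluing ι} {t : ι} {s : Equiv.Perm (Fin 4)}

/-- Points in the interior of a tetrahedron are not identified with each other. -/
theorem IsTwisted.framePoint_injective (h : T.IsTwisted t s) {y z : Fin 4 → ℝ}
    (hy : y ∈ stdSimplex ℝ (Fin 4)) (hz : z ∈ stdSimplex ℝ (Fin 4)) (hy0 : ∀ i, 0 < y i)
    (e : T.framePoint t s y = T.framePoint t s z) : y = z := by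
  have hP : Descends fun y => y 0 * y 1 * y 2 * y 3 :=
    ⟨by fun_prop, fun y h => by simp [h], fun y h => by simp [h], fun y _ h => by simp [h]⟩
  have hPi : ∀ i, Descends fun y => y 0 * y 1 * y 2 * y 3 * y i := fun i =>
    ⟨by fun_prop, fun y h => by simp [h], fun y h => by simp [h], fun y _ h => by simp [h]⟩
  have e0 := congrArg (descend T t s h hP) e
  rw [descend_framePoint h hP hy, descend_framePoint h hP hz] at e0
  have hpos : 0 < y 0 * y 1 * y 2 * y 3 := by
    have := hy0 0; have := hy0 1; have := hy0 2; have := hy0 3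
    positivity
  funext i
  have ei := congrArg (descend T t s h (hPi i)) e
  rw [descend_framePoint h (hPi i) hy, descend_framePoint h (hPi i) hz] at ei
  rw [← e0] at ei
  exact mul_left_cancel₀ hpos.ne' ei

/-- The weight `y₀ y₂ |y₁ - y₃|`, which vanishes outside the domain of the chart. -/
def chartWeight (y : Fin 4 → ℝ) : ℝ :=
  y 0 * y 2 * (max (y 1 - y 3) 0 + max (y 3 - y 1) 0)

/-- The coordinates of the chart across the face `012`, multiplied by the weight.  The coordinates
are `y₃, y₂ - y₁, 1 - y₀` on the side of the face `012`, where `y₁ > y₃`, and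
`-y₁, y₃ - y₂, 1 - y₀` on the side of the face `023`, where `y₃ > y₁`. -/
def chartCoord (i : Fin 3) (y : Fin 4 → ℝ) : ℝ :=
  y 0 * y 2 * (max (y 1 - y 3) 0 * ![y 3, y 2 - y 1, 1 - y 0] i
    + max (y 3 - y 1) 0 * ![-y 1, y 3 - y 2, 1 - y 0] i)

theorem descends_chartWeight : Descends chartWeight where
  continuous := by unfold chartWeight; fun_prop
  zero_left y h := by simp [chartWeight, h]
  zero_right y h := by simp [chartWeight, h]
  glue y hy h := by
    have h1 := hy.1 1
    have h2 := hy.1 2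
    simp [chartWeight, h, h1, h2]
    ring

theorem descends_chartCoord (i : Fin 3) : Descends (chartCoord i) where
  continuous := by unfold chartCoord; fin_cases i <;> simp <;> fun_prop
  zero_left y h := by simp [chartCoord, h]
  zero_right y h := by simp [chartCoord, h]
  glue y hy h := by
    have h1 := hy.1 1
    have h2 := hy.1 2
    fin_cases i <;> simp [chartCoord, h, h1, h2] <;> ring

/-- The cone of chart coordinates of height at most `r`. -/
def chartCone (r : ℝ) : Set E3 := {k | 3 * |k 0| + |k 1| < k 2 ∧ k 2 < r}

theorem continuous_coord (i : Fin 3) : Continuous fun k : E3 => k i := PiLp.continuous_apply 2 _ i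

theorem isOpen_chartCone (r : ℝ) : IsOpen (chartCone r) := by
  have h := continuous_coord
  exact (isOpen_lt (((h 0).abs.const_mul 3).add (h 1).abs) (h 2)).inter
    (isOpen_lt (h 2) continuous_const)

theorem convex_chartCone (r : ℝ) : Convex ℝ (chartCone r) := by
  rintro k ⟨hk, hk'⟩ l ⟨hl, hl'⟩ a b ha hb hab
  simp only [chartCone, Set.mem_ofPred_eq, PiLp.add_apply, PiLp.smul_apply, smul_eq_mul]
  have h0 : |a * k 0 + b * l 0| ≤ a * |k 0| + b * |l 0| :=
    (abs_add_le _ _).trans (by rw [abs_mul, abs_mul, abs_of_nonneg ha, abs_of_nonneg hb])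
  have h1 : |a * k 1 + b * l 1| ≤ a * |k 1| + b * |l 1| :=
    (abs_add_le _ _).trans (by rw [abs_mul, abs_mul, abs_of_nonneg ha, abs_of_nonneg hb])
  obtain rfl : b = 1 - a := by linarith
  rcases ha.eq_or_lt with rfl | ha
  · constructor <;> simp at * <;> linarith
  · constructor <;> nlinarith

/-- The point with given chart coordinates on the side of the face `012`. -/
noncomputable def sidePos (k : E3) : Fin 4 → ℝ :=
  ![1 - k 2, (k 2 - k 0 - k 1) / 2, (k 2 - k 0 + k 1) / 2, k 0]

/-- The point with given chart coordinates on the side of the face `023`. -/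
noncomputable def sideNeg (k : E3) : Fin 4 → ℝ :=
  ![1 - k 2, -k 0, (k 2 + k 0 - k 1) / 2, (k 2 + k 0 + k 1) / 2]

theorem sidePos_mem {k : E3} (hk : k ∈ chartCone 1) (h0 : 0 ≤ k 0) :
    sidePos k ∈ stdSimplex ℝ (Fin 4) := by
  obtain ⟨h1, h2⟩ := hk
  rw [abs_of_nonneg h0] at h1
  have := abs_lt.1 (show |k 1| < k 2 - 3 * k 0 by linarith)
  refine ⟨fun i => ?_, ?_⟩
  · fin_cases i <;> simp [sidePos] <;> linarith
  · simp [sidePos, Fin.sum_univ_four]; ring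

theorem sideNeg_mem {k : E3} (hk : k ∈ chartCone 1) (h0 : k 0 ≤ 0) :
    sideNeg k ∈ stdSimplex ℝ (Fin 4) := by
  obtain ⟨h1, h2⟩ := hk
  rw [abs_of_nonpos h0] at h1
  have := abs_lt.1 (show |k 1| < k 2 + 3 * k 0 by linarith)
  refine ⟨fun i => ?_, ?_⟩
  · fin_cases i <;> simp [sideNeg] <;> linarith
  · simp [sideNeg, Fin.sum_univ_four]; ring

theorem continuous_sidePos : Continuous sidePos := by
  have h := continuous_coord
  refine continuous_pi fun i => ?_
  fin_cases i <;> simp [sidePos] <;> fun_prop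

theorem continuous_sideNeg : Continuous sideNeg := by
  have h := continuous_coord
  refine continuous_pi fun i => ?_
  fin_cases i <;> simp [sideNeg] <;> fun_prop

open Classical in
/-- The inverse of the chart across the twisted face. -/
noncomputable def chartInv (T : FaceGluing ι) (t : ι) (s : Equiv.Perm (Fin 4)) (k : E3) :
    T.Space :=
  if 0 ≤ k 0 then T.framePoint t s (sidePos k) else T.framePoint t s (sideNeg k)

theorem IsTwisted.framePoint_sidePos (h : T.IsTwisted t s) {k : E3} (hk : k ∈ chartCone 1)
    (h0 : k 0 = 0) : T.framePoint t s (sidePos k) = T.framePoint t s (sideNeg k) := by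
  rw [h.framePoint_eq (sidePos_mem hk h0.ge) (by simp [sidePos, h0])]
  congr 1
  simp [sidePos, sideNeg, h0]

theorem IsTwisted.chartInv_of_nonpos (h : T.IsTwisted t s) {k : E3} (hk : k ∈ chartCone 1)
    (h0 : k 0 ≤ 0) : chartInv T t s k = T.framePoint t s (sideNeg k) := by
  unfold chartInv
  split_ifs with h1
  · exact h.framePoint_sidePos hk (le_antisymm h0 h1)
  · rfl

theorem chartInv_of_nonneg {k : E3} (h0 : 0 ≤ k 0) :
    chartInv T t s k = T.framePoint t s (sidePos k) := if_pos h0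

theorem IsTwisted.continuousOn_chartInv (h : T.IsTwisted t s) :
    ContinuousOn (chartInv T t s) (chartCone 1) := by
  have hc : Continuous fun k : chartCone 1 => k.1 0 :=
    (continuous_coord 0).comp continuous_subtype_val
  rw [continuousOn_iff_continuous_domRestrict]
  have h1 : ContinuousOn ((chartCone 1).domRestrict (chartInv T t s)) {k | 0 ≤ k.1 0} := by
    have : ContinuousOn (fun k : chartCone 1 => T.framePoint t s (sidePos k.1))
        {k | 0 ≤ k.1 0} :=
      (continuousOn_framePoint T t s).comp
        (continuous_sidePos.comp continuous_subtype_val).continuousOn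
        fun k hk => sidePos_mem k.2 hk
    exact this.congr fun k hk => chartInv_of_nonneg hk
  have h2 : ContinuousOn ((chartCone 1).domRestrict (chartInv T t s)) {k | k.1 0 ≤ 0} := by
    have : ContinuousOn (fun k : chartCone 1 => T.framePoint t s (sideNeg k.1))
        {k | k.1 0 ≤ 0} :=
      (continuousOn_framePoint T t s).comp
        (continuous_sideNeg.comp continuous_subtype_val).continuousOn
        fun k hk => sideNeg_mem k.2 hk
    exact this.congr fun k hk => h.chartInv_of_nonpos k.2 hk
  rw [← continuousOn_univ]
  refine (h1.union_of_isClosed h2 (isClosed_le continuous_const hc)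
    (isClosed_le hc continuous_const)).mono fun k _ => ?_
  exact (le_total 0 (k.1 0)).imp id id

/-- A chart of the glued space around the face at which a tetrahedron is glued to itself by a
twist. -/
noncomputable def twistChart (h : T.IsTwisted t s) : OpenPartialHomeomorph T.Space E3 := by
  let w := descend T t s h descends_chartWeight
  let K : T.Space → E3 := fun Y =>
    WithLp.toLp 2 fun i => descend T t s h (descends_chartCoord i) Y / w Y
  have hw : Continuous w := continuous_descend h _
  have hK : ContinuousOn K {Y | w Y ≠ 0} := by
    refine (PiLp.continuous_toLp 2 _).comp_continuousOn (continuousOn_pi.2 fun i => ?_)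
    exact (continuous_descend h (descends_chartCoord i)).continuousOn.div hw.continuousOn
      fun Y hY => hY
  have hopen : IsOpen {Y | w Y ≠ 0} := isOpen_ne_fun hw continuous_const
  have hwf : ∀ {y}, y ∈ stdSimplex ℝ (Fin 4) → w (T.framePoint t s y) = chartWeight y :=
    fun hy => descend_framePoint h _ hy
  have hKf : ∀ {y}, y ∈ stdSimplex ℝ (Fin 4) → ∀ i,
      K (T.framePoint t s y) i = chartCoord i y / chartWeight y := by
    intro y hy i
    simp only [K, hwf hy, descend_framePoint h _ hy]
  -- the values of the coordinates on the two sides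
  have hpos : ∀ {y}, y ∈ stdSimplex ℝ (Fin 4) → chartWeight y ≠ 0 → y 3 < y 1 →
      K (T.framePoint t s y) = !₂[y 3, y 2 - y 1, 1 - y 0] := by
    intro y hy hy0 hlt
    ext i
    rw [hKf hy]
    have e1 : max (y 1 - y 3) 0 = y 1 - y 3 := max_eq_left (by linarith)
    have e2 : max (y 3 - y 1) 0 = 0 := max_eq_right (by linarith)
    rw [div_eq_iff hy0]
    fin_cases i <;> simp [chartCoord, chartWeight, e1, e2] <;> ring
  have hneg : ∀ {y}, y ∈ stdSimplex ℝ (Fin 4) → chartWeight y ≠ 0 → y 1 < y 3 →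
      K (T.framePoint t s y) = !₂[-y 1, y 3 - y 2, 1 - y 0] := by
    intro y hy hy0 hlt
    ext i
    rw [hKf hy]
    have e1 : max (y 1 - y 3) 0 = 0 := max_eq_right (by linarith)
    have e2 : max (y 3 - y 1) 0 = y 3 - y 1 := max_eq_left (by linarith)
    rw [div_eq_iff hy0]
    fin_cases i <;> simp [chartCoord, chartWeight, e1, e2] <;> ring
  have hright : ∀ k ∈ chartCone 1, w (chartInv T t s k) ≠ 0 ∧ K (chartInv T t s k) = k := by
    intro k hk
    have ⟨a1, a2⟩ := hk
    rcases le_total 0 (k 0) with h0 | h0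
    · have hm := sidePos_mem hk h0
      rw [abs_of_nonneg h0] at a1
      have := abs_lt.1 (show |k 1| < k 2 - 3 * k 0 by linarith)
      have hlt : sidePos k 3 < sidePos k 1 := by simp [sidePos]; linarith
      have hw0 : chartWeight (sidePos k) ≠ 0 := by
        have e1 : 0 < sidePos k 0 := by simp [sidePos]; linarith
        have e2 : 0 < sidePos k 2 := by simp [sidePos]; linarith
        have e3 : 0 < sidePos k 1 - sidePos k 3 := by linarith
        have e4 : max (sidePos k 3 - sidePos k 1) 0 = 0 := max_eq_right (by linarith)
        rw [chartWeight, max_eq_left e3.le, e4]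
        positivity
      rw [chartInv_of_nonneg h0, hpos hm hw0 hlt, hwf hm]
      refine ⟨hw0, ?_⟩
      ext i
      fin_cases i <;> simp [sidePos]; ring
    · have hm := sideNeg_mem hk h0
      rw [abs_of_nonpos h0] at a1
      have := abs_lt.1 (show |k 1| < k 2 + 3 * k 0 by linarith)
      have hlt : sideNeg k 1 < sideNeg k 3 := by simp [sideNeg]; linarith
      have hw0 : chartWeight (sideNeg k) ≠ 0 := by
        have e1 : 0 < sideNeg k 0 := by simp [sideNeg]; linarith
        have e2 : 0 < sideNeg k 2 := by simp [sideNeg]; linarith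
        have e3 : 0 < sideNeg k 3 - sideNeg k 1 := by linarith
        have e4 : max (sideNeg k 1 - sideNeg k 3) 0 = 0 := max_eq_right (by linarith)
        rw [chartWeight, max_eq_left e3.le, e4]
        positivity
      rw [h.chartInv_of_nonpos hk h0, hneg hm hw0 hlt, hwf hm]
      refine ⟨hw0, ?_⟩
      ext i
      fin_cases i <;> simp [sideNeg]; ring
  have hleft : ∀ Y, w Y ≠ 0 → K Y ∈ chartCone 1 → chartInv T t s (K Y) = Y := by
    intro Y
    induction Y using Quot.ind with
    | mk q =>
      obtain ⟨t', p⟩ := q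
      intro hY
      by_cases ht : t' = t
      swap
      · exact absurd (descend_eq_zero h descends_chartWeight ht p) hY
      subst ht
      rw [mk_eq_framePoint T t' s p] at hY ⊢
      have hy : p.1 ∘ s ∈ stdSimplex ℝ (Fin 4) := (comp_perm_mem_stdSimplex s).2 p.2
      generalize p.1 ∘ s = y at hy hY ⊢
      have hw0 : chartWeight y ≠ 0 := by rwa [hwf hy] at hY
      have hsum := hy.2
      rw [Fin.sum_univ_four] at hsum
      rcases lt_trichotomy (y 3) (y 1) with hlt | heq | hlt
      · rw [hpos hy hw0 hlt]
        intro hk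
        rw [chartInv_of_nonneg (by simpa using hy.1 3)]
        congr 1
        funext i
        fin_cases i <;> simp [sidePos] <;> linarith
      · exact absurd (by simp [chartWeight, heq]) hw0
      · rw [hneg hy hw0 hlt]
        intro hk
        rw [h.chartInv_of_nonpos hk (by simpa using hy.1 1)]
        congr 1
        funext i
        fin_cases i <;> simp [sideNeg] <;> linarith
  exact
    { toFun := K
      invFun := chartInv T t s
      source := {Y | w Y ≠ 0} ∩ K ⁻¹' chartCone 1
      target := chartCone 1
      map_source' := fun Y hY => hY.2
      map_target' := fun k hk => ⟨(hright k hk).1, by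
        rw [Set.mem_preimage, (hright k hk).2]; exact hk⟩
      left_inv' := fun Y hY => hleft Y hY.1 hY.2
      right_inv' := fun k hk => (hright k hk).2
      open_source := hK.isOpen_inter_preimage hopen (isOpen_chartCone 1)
      open_target := isOpen_chartCone 1
      continuousOn_toFun := hK.mono Set.inter_subset_left
      continuousOn_invFun := h.continuousOn_chartInv }

end FaceGluing


namespace FaceGluing

open scoped unitInterval

variable {ι : Type} {T : FaceGluing ι} {t : ι} {s : Equiv.Perm (Fin 4)}

theorem abs_apply_le_of_mem_closedBall {k p : E3} {ε : ℝ} (hk : k ∈ Metric.closedBall p ε)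
    (i : Fin 3) : |k i - p i| ≤ ε := by
  have h := PiLp.norm_apply_le (k - p) i
  rw [Metric.mem_closedBall, dist_eq_norm] at hk
  rw [PiLp.sub_apply, Real.norm_eq_abs] at h
  exact h.trans hk

/-- In a triangulation of a 3-manifold no face of a tetrahedron is glued to another face of the same
tetrahedron by a map with one fixed vertex, that is, by one that makes the link of the vertex
contain a Möbius band.  Otherwise a small sphere around a point on one side of the glued face could
be moved through the tetrahedron to the other side, and it would return as its mirror image. -/
theorem IsThreeManifoldTriangulation.not_isTwisted (hT : T.IsThreeManifoldTriangulation) :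
    ¬ T.IsTwisted t s := by
  intro h
  obtain ⟨hch⟩ := hT.locallyEuclidean
  -- a chart of the manifold at the vertex, and a neighbourhood of the vertex in its domain
  let e₀ : Fin 4 → ℝ := Pi.single 0 1
  have he₀ : e₀ ∈ stdSimplex ℝ (Fin 4) := single_mem_stdSimplex ℝ 0
  let φ := chartAt E3 (T.framePoint t s e₀)
  have hφ : T.framePoint t s e₀ ∈ φ.source := mem_chart_source E3 _
  have hnhds : φ.source ∈ nhds (T.framePoint t s e₀) := φ.open_source.mem_nhds hφ
  obtain ⟨δ, hδ, hδ'⟩ := Metric.mem_nhdsWithin_iff.1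
    (continuousOn_framePoint T t s e₀ he₀ hnhds)
  obtain ⟨r, hr, hr1, hrδ⟩ : ∃ r > 0, r ≤ 1 ∧ r ≤ δ :=
    ⟨min 1 δ, lt_min one_pos hδ, min_le_left _ _, min_le_right _ _⟩
  have hsource : ∀ y ∈ stdSimplex ℝ (Fin 4), 1 - y 0 < r → T.framePoint t s y ∈ φ.source := by
    intro y hy hyr
    refine hδ' ⟨?_, hy⟩
    rw [Metric.mem_ball, dist_pi_lt_iff hδ]
    have hs := hy.2
    rw [Fin.sum_univ_four] at hs
    have h0 := hy.1 0
    have h1 := hy.1 1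
    have h2 := hy.1 2
    have h3 := hy.1 3
    intro i
    rw [Real.dist_eq, abs_lt]
    fin_cases i <;> simp [e₀] <;> constructor <;> linarith
  have hcone : chartCone r ⊆ chartCone 1 := fun k hk => ⟨hk.1, hk.2.trans_le hr1⟩
  let g := (twistChart h).symm.trans φ
  have hgk : ∀ k, g k = φ (chartInv T t s k) := fun k => rfl
  have hC : chartCone r ⊆ g.source := by
    intro k hk
    refine ⟨hcone hk, ?_⟩
    show chartInv T t s k ∈ φ.source
    rcases le_total 0 (k 0) with h0 | h0
    · rw [chartInv_of_nonneg h0]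
      refine hsource _ (sidePos_mem (hcone hk) h0) ?_
      simpa [sidePos] using hk.2
    · rw [h.chartInv_of_nonpos (hcone hk) h0]
      refine hsource _ (sideNeg_mem (hcone hk) h0) ?_
      simpa [sideNeg] using hk.2
  -- balls on the two sides of the glued face
  let p : E3 := !₂[r / 16, 0, r / 2]
  let q : E3 := !₂[-(r / 16), 0, r / 2]
  have hε : 0 < r / 64 := by positivity
  have hball : ∀ k : E3, |k 0| ≤ r / 16 + r / 64 → |k 1| ≤ r / 64 → |k 2 - r / 2| ≤ r / 64 →
      k ∈ chartCone r := by
    intro k h0 h1 h2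
    have := abs_le.1 h2
    constructor <;> linarith
  have hp' : ∀ k ∈ Metric.closedBall p (r / 64),
      0 ≤ k 0 ∧ k ∈ chartCone r ∧ ∀ i, 0 < sidePos k i := by
    intro k hk
    have h0 := abs_le.1 (abs_apply_le_of_mem_closedBall hk 0)
    have h1 := abs_le.1 (abs_apply_le_of_mem_closedBall hk 1)
    have h2 := abs_le.1 (abs_apply_le_of_mem_closedBall hk 2)
    simp [p] at h0 h1 h2
    refine ⟨by linarith, hball k (abs_le.2 ⟨by linarith, by linarith⟩)
      (abs_le.2 ⟨by linarith, by linarith⟩) (abs_le.2 ⟨by linarith, by linarith⟩), fun i => ?_⟩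
    fin_cases i <;> simp [sidePos] <;> linarith
  have hq' : ∀ k ∈ Metric.closedBall q (r / 64),
      k 0 ≤ 0 ∧ k ∈ chartCone r ∧ ∀ i, 0 < sideNeg k i := by
    intro k hk
    have h0 := abs_le.1 (abs_apply_le_of_mem_closedBall hk 0)
    have h1 := abs_le.1 (abs_apply_le_of_mem_closedBall hk 1)
    have h2 := abs_le.1 (abs_apply_le_of_mem_closedBall hk 2)
    simp [q] at h0 h1 h2
    refine ⟨by linarith, hball k (abs_le.2 ⟨by linarith, by linarith⟩)
      (abs_le.2 ⟨by linarith, by linarith⟩) (abs_le.2 ⟨by linarith, by linarith⟩), fun i => ?_⟩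
    fin_cases i <;> simp [sideNeg] <;> linarith
  refine not_homotopic_sphereImage_reflection g hC (convex_chartCone r) hε hε
    (fun k hk => (hp' k hk).2.1) (fun k hk => (hq' k hk).2.1) ?_
  -- the straight path through the tetrahedron
  let refl3 : E3 → E3 := fun v => !₂[v 0, -v 1, v 2]
  have hrefl : ∀ v : E3, ‖refl3 v‖ = ‖v‖ := by
    intro v
    rw [EuclideanSpace.norm_eq, EuclideanSpace.norm_eq]
    simp [Fin.sum_univ_three, refl3]
  have hreflc : Continuous refl3 := by
    have hi := continuous_coord
    refine (PiLp.continuous_toLp 2 _).comp (continuous_pi fun i => ?_)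
    fin_cases i
    · exact hi 0
    · exact (hi 1).neg
    · exact hi 2
  let Y : I → E3 → Fin 4 → ℝ := fun τ v =>
    (1 - τ : ℝ) • sidePos (p + (r / 64) • v) + (τ : ℝ) • sideNeg (q + (r / 64) • refl3 v)
  have hYc : Continuous fun x : I × E3 => Y x.1 x.2 := by
    have h1 := continuous_sidePos
    have h2 := continuous_sideNeg
    fun_prop
  have hpv : ∀ v : E3, ‖v‖ ≤ 1 → p + (r / 64) • v ∈ Metric.closedBall p (r / 64) := by
    intro v hv
    simp only [Metric.mem_closedBall, dist_self_add_left, norm_smul, Real.norm_eq_abs,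
      abs_of_pos hε]
    nlinarith
  have hqv : ∀ v : E3, ‖v‖ ≤ 1 → q + (r / 64) • refl3 v ∈ Metric.closedBall q (r / 64) := by
    intro v hv
    simp only [Metric.mem_closedBall, dist_self_add_left, norm_smul, Real.norm_eq_abs,
      abs_of_pos hε, hrefl]
    nlinarith
  have hY : ∀ τ v, ‖v‖ ≤ 1 → Y τ v ∈ stdSimplex ℝ (Fin 4) ∧ (∀ i, 0 < Y τ v i) ∧
      T.framePoint t s (Y τ v) ∈ φ.source := by
    intro τ v hv
    obtain ⟨a0, a1, a2⟩ := hp' _ (hpv v hv)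
    obtain ⟨b0, b1, b2⟩ := hq' _ (hqv v hv)
    have t0 := τ.2.1
    have t1 : (0 : ℝ) ≤ 1 - τ := sub_nonneg.2 τ.2.2
    have hm : Y τ v ∈ stdSimplex ℝ (Fin 4) :=
      convex_stdSimplex ℝ (Fin 4) (sidePos_mem (hcone a1) a0) (sideNeg_mem (hcone b1) b0) t1 t0
        (by ring)
    refine ⟨hm, fun i => ?_, hsource _ hm ?_⟩
    · have c1 := a2 i
      have c2 := b2 i
      simp only [Y, Pi.add_apply, Pi.smul_apply, smul_eq_mul]
      rcases t0.eq_or_lt with h | h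
      · rw [← h]; simpa using c1
      · have := mul_nonneg t1 c1.le
        positivity
    · have c1 := a1.2
      have c2 := b1.2
      have d1 : sidePos (p + (r / 64) • v) 0 = 1 - (p + (r / 64) • v) 2 := rfl
      have d2 : sideNeg (q + (r / 64) • refl3 v) 0 = 1 - (q + (r / 64) • refl3 v) 2 := rfl
      simp only [Y, Pi.add_apply, Pi.smul_apply, smul_eq_mul, d1, d2]
      rcases t0.eq_or_lt with h | h
      · rw [← h]; linarith
      · nlinarith
  have hY0 : ∀ τ v, ‖v‖ ≤ 1 → Y τ v = Y τ 0 → v = 0 := by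
    intro τ v _ he
    have e0 := congrFun he 0
    have e1 := congrFun he 1
    have e2 := congrFun he 2
    simp [Y, sidePos, sideNeg, p, q, refl3] at e0 e1 e2
    have hrn := hr.ne'
    have c2 : v 2 = 0 := by
      have : r / 64 * v 2 = 0 := by linear_combination -e0
      simpa [hrn] using this
    have t0 := τ.2.1
    have t1 : (0 : ℝ) ≤ 1 - τ := sub_nonneg.2 τ.2.2
    have c1 : v 1 = (1 - 2 * τ) * v 0 := by
      have : r * (v 1 - (1 - 2 * τ) * v 0) = 0 := by
        linear_combination 128 * e2 - r * c2
      have := (mul_eq_zero.1 this).resolve_left hrn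
      linarith
    have c0 : v 0 = 0 := by
      have : r * (((1 - τ) ^ 2 + τ) * v 0) = 0 := by
        linear_combination -64 * e1 + r * (1 - τ) / 2 * c2 - r * (1 - τ) / 2 * c1
      have := (mul_eq_zero.1 this).resolve_left hrn
      refine (mul_eq_zero.1 this).resolve_left ?_
      rcases t0.eq_or_lt with h | h
      · rw [← h]; norm_num
      · positivity
    ext i
    fin_cases i
    · exact c0
    · show v 1 = 0
      rw [c1, c0, mul_zero]
    · exact c2
  have hYzero : ∀ τ, Y τ 0 ∈ stdSimplex ℝ (Fin 4) ∧ (∀ i, 0 < Y τ 0 i) ∧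
      T.framePoint t s (Y τ 0) ∈ φ.source := fun τ => hY τ 0 (by simp)
  refine homotopic_of_family (fun τ v => φ (T.framePoint t s (Y τ v.1))
    - φ (T.framePoint t s (Y τ 0))) ?_ ?_ ?_ ?_
  · have hcont : ∀ f : I × S2 → E3, Continuous f → (∀ x, ‖f x‖ ≤ 1) →
        Continuous fun x : I × S2 => φ (T.framePoint t s (Y x.1 (f x))) := by
      intro f hf hf1
      refine φ.continuousOn.comp_continuous ?_ fun x => (hY _ _ (hf1 x)).2.2
      exact (continuousOn_framePoint T t s).comp_continuous
        (hYc.comp (continuous_fst.prodMk hf)) fun x => (hY _ _ (hf1 x)).1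
    exact (hcont (fun x => x.2.1) (by fun_prop) (fun x => by simp)).sub
      (hcont (fun _ => 0) continuous_const (fun x => by simp))
  · intro τ v h0
    have hv : ‖v.1‖ = 1 := by simp
    obtain ⟨m1, m2, m3⟩ := hY τ v.1 hv.le
    obtain ⟨n1, n2, n3⟩ := hYzero τ
    have h1 := φ.injOn m3 n3 (sub_eq_zero.1 h0)
    have h2 := h.framePoint_injective m1 n1 m2 h1
    rw [hY0 τ v.1 hv.le h2, norm_zero] at hv
    exact one_ne_zero hv.symm
  · intro v
    have hv : ‖v.1‖ ≤ 1 := by simp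
    have a := (hp' _ (hpv v.1 hv)).1
    have b := (hp' _ (hpv 0 (by simp))).1
    rw [smul_zero, add_zero] at b
    simp only [sphereImage, ContinuousMap.coe_mk, hgk, chartInv_of_nonneg a, chartInv_of_nonneg b]
    simp [Y]
  · intro v
    have hv : ‖v.1‖ ≤ 1 := by simp
    obtain ⟨a, a', -⟩ := hq' _ (hqv v.1 hv)
    obtain ⟨b, b', -⟩ := hq' q (Metric.mem_closedBall_self hε.le)
    have e : (reflectS2 v).1 = refl3 v.1 := rfl
    have z0 : refl3 0 = 0 := by
      ext i; fin_cases i <;> simp [refl3]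
    simp only [sphereImage, ContinuousMap.comp_apply, ContinuousMap.coe_mk, hgk, e,
      h.chartInv_of_nonpos (hcone a') a, h.chartInv_of_nonpos (hcone b') b]
    simp [Y, z0]

end FaceGluing


/-! ### Flags and relabellings -/

/-- A tetrahedron with two of its faces or vertices: `(t, f, v)` stands for the corner `v` of the
face `f` of `t` if `v ≠ f`, and for the face `f` itself if `v = f`. -/
abbrev TetFlag (ι : Type) : Type := ι × Fin 4 × Fin 4

/-- Transport of flags along a map of tetrahedra with a reordering of their vertices. -/
def TetFlag.place {π ι : Type} (u : π → ι) (s : π → Equiv.Perm (Fin 4)) (x : TetFlag π) :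
    TetFlag ι :=
  (u x.1, s x.1 x.2.1, s x.1 x.2.2)

theorem TetFlag.place_injective {π ι : Type} {u : π → ι} (hu : Function.Injective u)
    (s : π → Equiv.Perm (Fin 4)) : Function.Injective (TetFlag.place u s) := by
  rintro ⟨t, f, v⟩ ⟨t', f', v'⟩ h
  simp only [TetFlag.place, Prod.mk.injEq] at h
  obtain ⟨h1, h2, h3⟩ := h
  obtain rfl := hu h1
  rw [(s t).injective h2, (s t).injective h3]

/-- The flag of a face corner. -/
def FaceCorner.flag {ι : Type} (x : FaceCorner ι) : TetFlag ι := (x.tet, x.face, x.vert)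

theorem FaceCorner.flag_injective {ι : Type} :
    Function.Injective (FaceCorner.flag : FaceCorner ι → TetFlag ι) := by
  intro x y h
  simp only [FaceCorner.flag, Prod.mk.injEq] at h
  exact FaceCorner.ext h.1 h.2.1 h.2.2

theorem FaceCorner.flag_map {ι κ : Type} (g : ι → κ) (x : FaceCorner ι) :
    (x.map g).flag = TetFlag.place g (fun _ => 1) x.flag := rfl

namespace FaceGluing

variable {ι ι' κ : Type}

/-- The gluing as a map of flags. -/
def flagGlue (T : FaceGluing ι) (x : TetFlag ι) : TetFlag ι :=
  (T.adj x.1 x.2.1, T.perm x.1 x.2.1 x.2.1, T.perm x.1 x.2.1 x.2.2)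

theorem flag_glue (T : FaceGluing ι) (x : FaceCorner ι) : (T.glue x).flag = T.flagGlue x.flag :=
  rfl

@[simp] theorem flagGlue_flagGlue (T : FaceGluing ι) (x : TetFlag ι) :
    T.flagGlue (T.flagGlue x) = x := by
  obtain ⟨t, f, v⟩ := x
  simp [flagGlue, T.adj_adj, T.perm_perm]

theorem flagGlue_eq_iff (T : FaceGluing ι) {x y : TetFlag ι} :
    T.flagGlue x = y ↔ T.flagGlue y = x := by
  constructor <;> rintro rfl <;> simp

theorem isomorphic_iff {T : FaceGluing ι} {T' : FaceGluing ι'} :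
    T.Isomorphic T' ↔ ∃ (e : ι ≃ ι') (σ : ι → Equiv.Perm (Fin 4)), ∀ x,
      T'.flagGlue (TetFlag.place e σ x) = TetFlag.place e σ (T.flagGlue x) := by
  constructor
  · rintro ⟨e, σ, h⟩
    refine ⟨e, σ, fun x => ?_⟩
    simp [flagGlue, TetFlag.place, h]
  · rintro ⟨e, σ, h⟩
    refine ⟨e, σ, fun t f => ⟨congrArg Prod.fst (h (t, f, f)), ?_⟩⟩
    ext1 v
    have := congrArg (fun x => x.2.2) (h (t, f, (σ t)⁻¹ v))
    simpa [flagGlue, TetFlag.place] using this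

theorem Isomorphic.trans {T : FaceGluing ι} {T' : FaceGluing ι'} {T'' : FaceGluing κ}
    (h : T.Isomorphic T') (h' : T'.Isomorphic T'') : T.Isomorphic T'' := by
  obtain ⟨e, σ, h⟩ := isomorphic_iff.1 h
  obtain ⟨e', σ', h'⟩ := isomorphic_iff.1 h'
  refine isomorphic_iff.2 ⟨e.trans e', fun t => σ' (e t) * σ t, fun x => ?_⟩
  have := h' (TetFlag.place e σ x)
  rw [h] at this
  exact this

/-- The gluing induced by relabelling the tetrahedra and reordering their vertices. -/
def pull (T : FaceGluing ι) (u : κ ≃ ι) (s : κ → Equiv.Perm (Fin 4)) : FaceGluing κ where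
  adj t f := u.symm (T.adj (u t) (s t f))
  perm t f := (s (u.symm (T.adj (u t) (s t f))))⁻¹ * T.perm (u t) (s t f) * s t
  adj_adj t f := by simp [T.adj_adj]
  perm_perm t f := by
    simp [T.perm_perm, T.adj_adj, mul_assoc]
  ne_self t f h := by
    obtain ⟨h1, h2⟩ := h
    rw [h1] at h2
    refine T.ne_self (u t) (s t f) ⟨(Equiv.symm_apply_eq u).1 h1, ?_⟩
    simp only [Equiv.Perm.mul_apply] at h2
    exact ((s t).symm_apply_eq.1 h2)

theorem place_flagGlue_pull (T : FaceGluing ι) (u : κ ≃ ι) (s : κ → Equiv.Perm (Fin 4))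
    (x : TetFlag κ) :
    TetFlag.place u s ((T.pull u s).flagGlue x) = T.flagGlue (TetFlag.place u s x) := by
  simp [flagGlue, TetFlag.place, pull]

theorem pull_isomorphic (T : FaceGluing ι) (u : κ ≃ ι) (s : κ → Equiv.Perm (Fin 4)) :
    (T.pull u s).Isomorphic T :=
  isomorphic_iff.2 ⟨u, s, fun x => (place_flagGlue_pull T u s x).symm⟩

theorem Isomorphic.symm {T : FaceGluing ι} {T' : FaceGluing ι'} (h : T.Isomorphic T') :
    T'.Isomorphic T := by
  obtain ⟨e, σ, h⟩ := isomorphic_iff.1 h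
  refine isomorphic_iff.2 ⟨e.symm, fun t => (σ (e.symm t))⁻¹, fun x => ?_⟩
  have hp : ∀ x : TetFlag ι',
      TetFlag.place e σ (TetFlag.place e.symm (fun t => (σ (e.symm t))⁻¹) x) = x := by
    intro x; simp [TetFlag.place]
  apply TetFlag.place_injective e.injective σ
  rw [← h, hp, hp]

theorem isomorphic_pull (T : FaceGluing ι) (u : κ ≃ ι) (s : κ → Equiv.Perm (Fin 4)) :
    T.Isomorphic (T.pull u s) :=
  (pull_isomorphic T u s).symm

theorem glue_pull_eq_iff (T : FaceGluing ι) (u : κ ≃ ι) (s : κ → Equiv.Perm (Fin 4))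
    (x y : FaceCorner κ) : (T.pull u s).glue x = y ↔
      T.flagGlue (TetFlag.place u s x.flag) = TetFlag.place u s y.flag := by
  rw [← place_flagGlue_pull, (TetFlag.place_injective u.injective s).eq_iff, ← flag_glue,
    FaceCorner.flag_injective.eq_iff]

end FaceGluing

/-! ### Patch replacements in terms of flags -/

section Replace

variable {p q : ℕ} {L ι ι' ρ : Type} {P : Patch p L} {Q : Patch q L}

theorem ReplacePatch.intro {T : FaceGluing ι} {T' : FaceGluing ι'} (u : Fin p ⊕ ρ ≃ ι)
    (s : Fin p ⊕ ρ → Equiv.Perm (Fin 4)) (u' : Fin q ⊕ ρ ≃ ι')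
    (s' : Fin q ⊕ ρ → Equiv.Perm (Fin 4))
    (hP : ∀ x y : FaceCorner (Fin p), x ≠ y → P x = P y →
      T.flagGlue (TetFlag.place (u ∘ Sum.inl) (s ∘ Sum.inl) x.flag) =
        TetFlag.place (u ∘ Sum.inl) (s ∘ Sum.inl) y.flag)
    (hQ : ∀ x y : FaceCorner (Fin q), x ≠ y → Q x = Q y →
      T'.flagGlue (TetFlag.place (u' ∘ Sum.inl) (s' ∘ Sum.inl) x.flag) =
        TetFlag.place (u' ∘ Sum.inl) (s' ∘ Sum.inl) y.flag)
    (hc : ∀ (x y : FaceCorner (Fin p ⊕ ρ)) (x' y' : FaceCorner (Fin q ⊕ ρ)),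
      Patch.Corr P Q x x' → Patch.Corr P Q y y' →
      T.flagGlue (TetFlag.place u s x.flag) = TetFlag.place u s y.flag →
      T'.flagGlue (TetFlag.place u' s' x'.flag) = TetFlag.place u' s' y'.flag) :
    ReplacePatch P Q T T' := by
  refine ⟨ρ, T.pull u s, T'.pull u' s', T.isomorphic_pull u s, T'.pull_isomorphic u' s', ?_, ?_, ?_⟩
  · intro x y hxy h
    exact (FaceGluing.glue_pull_eq_iff _ _ _ _ _).2 (hP x y hxy h)
  · intro x y hxy h
    exact (FaceGluing.glue_pull_eq_iff _ _ _ _ _).2 (hQ x y hxy h)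
  · intro x x' y' hx hy
    exact (FaceGluing.glue_pull_eq_iff _ _ _ _ _).2
      (hc x _ x' y' hx hy ((FaceGluing.glue_pull_eq_iff _ _ _ _ _).1 rfl))

/-- The labels of `P` that occur only once are labels of `Q`, and the others are not. -/
structure Patch.Complementary (P : Patch p L) (Q : Patch q L) : Prop where
  exists_or : ∀ x, (∃ y, P x = Q y) ∨ ∃ x', x' ≠ x ∧ P x = P x'
  eq_of_eq : ∀ x x' y, P x = Q y → P x = P x' → x = x'

theorem ReplacePatch.elim {T : FaceGluing ι} {T' : FaceGluing ι'} (hPQ : P.Complementary Q)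
    (h : ReplacePatch P Q T T') :
    ∃ (ρ : Type) (u : Fin p ⊕ ρ ≃ ι) (s : Fin p ⊕ ρ → Equiv.Perm (Fin 4)) (u' : Fin q ⊕ ρ ≃ ι')
      (s' : Fin q ⊕ ρ → Equiv.Perm (Fin 4)),
      (∀ x y : FaceCorner (Fin p), x ≠ y → P x = P y →
        T.flagGlue (TetFlag.place (u ∘ Sum.inl) (s ∘ Sum.inl) x.flag) =
          TetFlag.place (u ∘ Sum.inl) (s ∘ Sum.inl) y.flag) ∧
      (∀ x y : FaceCorner (Fin q), x ≠ y → Q x = Q y →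
        T'.flagGlue (TetFlag.place (u' ∘ Sum.inl) (s' ∘ Sum.inl) x.flag) =
          TetFlag.place (u' ∘ Sum.inl) (s' ∘ Sum.inl) y.flag) ∧
      ∀ (x y : FaceCorner (Fin p ⊕ ρ)) (x' y' : FaceCorner (Fin q ⊕ ρ)),
        Patch.Corr P Q x x' → Patch.Corr P Q y y' →
        (T.flagGlue (TetFlag.place u s x.flag) = TetFlag.place u s y.flag ↔
        T'.flagGlue (TetFlag.place u' s' x'.flag) = TetFlag.place u' s' y'.flag) := by
  obtain ⟨ρ, S, S', hS, hS', hPS, hQS, hc⟩ := h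
  obtain ⟨u, s, hu⟩ := FaceGluing.isomorphic_iff.1 hS.symm
  obtain ⟨u', s', hu'⟩ := FaceGluing.isomorphic_iff.1 hS'
  have conv : ∀ x y, T.flagGlue (TetFlag.place u s x.flag) = TetFlag.place u s y.flag ↔
      S.glue x = y := by
    intro x y
    rw [hu, (TetFlag.place_injective u.injective s).eq_iff, ← FaceGluing.flag_glue,
      FaceCorner.flag_injective.eq_iff]
  have conv' : ∀ x y, T'.flagGlue (TetFlag.place u' s' x.flag) = TetFlag.place u' s' y.flag ↔
      S'.glue x = y := by
    intro x y
    rw [hu', (TetFlag.place_injective u'.injective s').eq_iff, ← FaceGluing.flag_glue,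
      FaceCorner.flag_injective.eq_iff]
  have invol : ∀ x, S.glue (S.glue x) = x := fun x =>
    FaceCorner.flag_injective (by simp only [FaceGluing.flag_glue, FaceGluing.flagGlue_flagGlue])
  refine ⟨ρ, u, s, u', s', fun x y hxy h => (conv _ _).2 (hPS x y hxy h),
    fun x y hxy h => (conv' _ _).2 (hQS x y hxy h), fun x y x' y' hx hy => ?_⟩
  rw [conv, conv']
  constructor
  · rintro rfl
    exact hc x x' y' hx hy
  · intro h'
    -- a correspondent of `S.glue x` must be `y'`, so that `S.glue x = y`
    have left_unique : ∀ z, Patch.Corr P Q z y' → z = y := by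
      intro z hz
      cases hy with
      | outside w =>
        generalize hw : w.map Sum.inr = w' at hz
        cases hz with
        | outside w₂ =>
          rw [FaceCorner.ext_iff] at hw
          simp only [FaceCorner.map, Sum.inr.injEq] at hw
          obtain rfl : w = w₂ := FaceCorner.ext hw.1 hw.2.1 hw.2.2
          rfl
        | boundary a b hab => simp [FaceCorner.map] at hw
      | boundary a b hab =>
        generalize hw : b.map Sum.inl = w' at hz
        cases hz with
        | outside w₂ => simp [FaceCorner.map] at hw
        | boundary a₂ b₂ hab₂ =>
          rw [FaceCorner.ext_iff] at hw
          simp only [FaceCorner.map, Sum.inl.injEq] at hw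
          obtain rfl : b = b₂ := FaceCorner.ext hw.1 hw.2.1 hw.2.2
          rw [hPQ.eq_of_eq a a₂ b hab (hab.trans hab₂.symm)]
    have from_corr : ∀ z', Patch.Corr P Q (S.glue x) z' → S.glue x = y := by
      intro z' hz
      have := hc x x' z' hx hz
      rw [h'] at this
      subst this
      exact left_unique _ hz
    rcases hz : S.glue x with ⟨t | t, f, v, hv⟩
    · let z : FaceCorner (Fin p) := ⟨t, f, v, hv⟩
      have hz' : S.glue x = z.map Sum.inl := hz
      rcases hPQ.exists_or z with ⟨w, hw⟩ | ⟨w, hw, hzw⟩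
      · rw [← hz]
        exact from_corr (w.map Sum.inl) (hz' ▸ Patch.Corr.boundary z w hw)
      · have h1 := hPS z w hw.symm hzw
        rw [← hz', invol] at h1
        subst h1
        generalize hw' : w.map Sum.inl = w' at hx
        cases hx with
        | outside w₂ => simp [FaceCorner.map] at hw'
        | boundary a b hab =>
          rw [FaceCorner.ext_iff] at hw'
          simp only [FaceCorner.map, Sum.inl.injEq] at hw'
          obtain rfl : w = a := FaceCorner.ext hw'.1 hw'.2.1 hw'.2.2
          exact absurd (hPQ.eq_of_eq w z b hab hzw.symm) hw
    · let z : FaceCorner ρ := ⟨t, f, v, hv⟩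
      have hz' : S.glue x = z.map Sum.inr := hz
      rw [← hz]
      exact from_corr (z.map Sum.inr) (hz' ▸ Patch.Corr.outside z)

end Replace


/-! ### The two patches of the bistellar moves -/

/-- Face corners of a patch as triples. -/
def FaceCorner.equivSubtype (ι : Type) :
    FaceCorner ι ≃ {x : TetFlag ι // x.2.2 ≠ x.2.1} where
  toFun x := ⟨x.flag, x.ne⟩
  invFun x := ⟨x.1.1, x.1.2.1, x.1.2.2, x.2⟩
  left_inv _ := rfl
  right_inv _ := rfl

/-- The face corner of a flag, with a default value on the flags that are not corners. -/
def TetFlag.corner {ι : Type} (x : TetFlag ι) : FaceCorner ι :=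
  if h : x.2.2 ≠ x.2.1 then ⟨x.1, x.2.1, x.2.2, h⟩ else ⟨x.1, x.2.1, x.2.1 + 1, by
    generalize x.2.1 = f; revert f; decide⟩

theorem FaceCorner.corner_flag {ι : Type} (x : FaceCorner ι) : x.flag.corner = x := by
  obtain ⟨t, f, v, h⟩ := x
  simp [TetFlag.corner, FaceCorner.flag, h]

theorem TetFlag.flag_corner {ι : Type} {x : TetFlag ι} (hx : x.2.2 ≠ x.2.1) :
    x.corner.flag = x := by
  simp [TetFlag.corner, FaceCorner.flag, hx]

/-- An encoding of the labels of a patch by numbers. -/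
def labelCode {m : ℕ} (l : Finset (Fin m) × Fin m) : ℕ := (∑ i ∈ l.1, 2 ^ i.val) * 8 + l.2.val

/-- The two tetrahedra of a bipyramid, joined along the equator. -/
abbrev diskPatch : Patch 2 (Finset (Fin 5) × Fin 5) :=
  simplicialPatch (m := 5) ![![3, 0, 1, 2], ![4, 0, 1, 2]]

/-- The three tetrahedra of a bipyramid, joined along the axis. -/
abbrev edgePatch : Patch 3 (Finset (Fin 5) × Fin 5) :=
  simplicialPatch (m := 5) ![![3, 4, 0, 1], ![3, 4, 1, 2], ![3, 4, 2, 0]]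

/-- The flag of `edgePatch` at the same place of the boundary of the bipyramid as a given flag of
`diskPatch`: the boundary faces of the three tetrahedra around the axis are numbered `0` and `1`,
and those of the two tetrahedra at the equator are numbered `1, 2, 3`. -/
def edgeFlag (x : TetFlag (Fin 2)) : TetFlag (Fin 3) :=
  let g : Fin 4 → Fin 4 := ![![![0, 1, 2, 3], ![0, 1, 2, 3], ![0, 3, 1, 2], ![0, 2, 3, 1]],
    ![![0, 1, 2, 3], ![1, 0, 2, 3], ![1, 3, 0, 2], ![1, 2, 3, 0]]] x.1 x.2.1
  (![0, 1, 2, 0] x.2.1, g x.2.1, g x.2.2)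

/-- The gluing of the three tetrahedra around the axis: the face `2` of each to the face `3` of the
next. -/
def ringNext (x : TetFlag (Fin 3)) : TetFlag (Fin 3) := (x.1 + 1, 3, Equiv.swap 2 3 x.2.2)

/-- Two flags of `edgePatch` are glued. -/
def RingGlued (x y : TetFlag (Fin 3)) : Prop :=
  (x.2.1 = 2 ∧ y = ringNext x) ∨ (y.2.1 = 2 ∧ x = ringNext y)

/-- Two flags of `diskPatch` are glued. -/
def DiskGlued (x y : TetFlag (Fin 2)) : Prop :=
  x.2.1 = 0 ∧ y = (x.1 + 1, 0, x.2.2)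

instance (x y : TetFlag (Fin 3)) : Decidable (RingGlued x y) :=
  inferInstanceAs (Decidable (_ ∨ _))

instance (x y : TetFlag (Fin 2)) : Decidable (DiskGlued x y) :=
  inferInstanceAs (Decidable (_ ∧ _))

/-- The vertex sets of the faces of `edgePatch`, as sums of powers of two. -/
def edgeCode (x : TetFlag (Fin 3)) : ℕ :=
  ![![19, 11, 26, 25], ![22, 14, 28, 26], ![21, 13, 25, 28]] x.1 x.2.1 * 8 +
    ![![3, 4, 0, 1], ![3, 4, 1, 2], ![3, 4, 2, 0]] x.1 x.2.2

/-- The vertex sets of the faces of `diskPatch`, as sums of powers of two. -/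
def diskCode (x : TetFlag (Fin 2)) : ℕ :=
  ![![7, 14, 13, 11], ![7, 22, 21, 19]] x.1 x.2.1 * 8 + ![![3, 0, 1, 2], ![4, 0, 1, 2]] x.1 x.2.2

theorem labelCode_edgePatch (x : FaceCorner (Fin 3)) :
    labelCode (edgePatch x) = edgeCode x.flag := by
  have h : ∀ x : TetFlag (Fin 3), x.2.2 ≠ x.2.1 → labelCode (edgePatch x.corner) = edgeCode x := by
    decide +kernel
  simpa [FaceCorner.corner_flag] using h x.flag x.ne

theorem labelCode_diskPatch (x : FaceCorner (Fin 2)) :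
    labelCode (diskPatch x) = diskCode x.flag := by
  have h : ∀ x : TetFlag (Fin 2), x.2.2 ≠ x.2.1 → labelCode (diskPatch x.corner) = diskCode x := by
    decide +kernel
  simpa [FaceCorner.corner_flag] using h x.flag x.ne

theorem edgePatch_eq_iff {x y : FaceCorner (Fin 3)} (hxy : x ≠ y) :
    edgePatch x = edgePatch y ↔ RingGlued x.flag y.flag := by
  constructor
  · intro h
    have h1 := congrArg labelCode h
    rw [labelCode_edgePatch, labelCode_edgePatch] at h1
    have key : ∀ x y : TetFlag (Fin 3), x.2.2 ≠ x.2.1 → y.2.2 ≠ y.2.1 →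
        edgeCode x = edgeCode y → x ≠ y → RingGlued x y := by decide +kernel
    exact key _ _ x.ne y.ne h1 fun e => hxy (FaceCorner.flag_injective e)
  · have key : ∀ x : TetFlag (Fin 3), x.2.2 ≠ x.2.1 → x.2.1 = 2 →
        edgePatch x.corner = edgePatch (ringNext x).corner := by decide +kernel
    rintro (⟨h1, h2⟩ | ⟨h1, h2⟩)
    · have := key _ x.ne h1
      rwa [← h2, FaceCorner.corner_flag, FaceCorner.corner_flag] at this
    · have := key _ y.ne h1
      rw [← h2, FaceCorner.corner_flag, FaceCorner.corner_flag] at this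
      exact this.symm

theorem diskPatch_eq_iff {x y : FaceCorner (Fin 2)} (hxy : x ≠ y) :
    diskPatch x = diskPatch y ↔ DiskGlued x.flag y.flag := by
  constructor
  · intro h
    have h1 := congrArg labelCode h
    rw [labelCode_diskPatch, labelCode_diskPatch] at h1
    have key : ∀ x y : TetFlag (Fin 2), x.2.2 ≠ x.2.1 → y.2.2 ≠ y.2.1 →
        diskCode x = diskCode y → x ≠ y → DiskGlued x y := by decide +kernel
    exact key _ _ x.ne y.ne h1 fun e => hxy (FaceCorner.flag_injective e)
  · have key : ∀ x : TetFlag (Fin 2), x.2.2 ≠ x.2.1 → x.2.1 = 0 →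
        diskPatch x.corner = diskPatch (TetFlag.corner (x.1 + 1, 0, x.2.2)) := by decide +kernel
    rintro ⟨h1, h2⟩
    have := key _ x.ne h1
    rwa [← h2, FaceCorner.corner_flag, FaceCorner.corner_flag] at this

theorem diskPatch_eq_edgePatch_iff {x : FaceCorner (Fin 2)} {y : FaceCorner (Fin 3)} :
    diskPatch x = edgePatch y ↔ x.flag.2.1 ≠ 0 ∧ y.flag = edgeFlag x.flag := by
  constructor
  · intro h
    have h1 := congrArg labelCode h
    rw [labelCode_diskPatch, labelCode_edgePatch] at h1
    have key : ∀ (x : TetFlag (Fin 2)) (y : TetFlag (Fin 3)), x.2.2 ≠ x.2.1 → y.2.2 ≠ y.2.1 →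
        diskCode x = edgeCode y → x.2.1 ≠ 0 ∧ y = edgeFlag x := by decide +kernel
    exact key _ _ x.ne y.ne h1
  · have key : ∀ x : TetFlag (Fin 2), x.2.2 ≠ x.2.1 → x.2.1 ≠ 0 →
        diskPatch x.corner = edgePatch (edgeFlag x).corner := by decide +kernel
    rintro ⟨h1, h2⟩
    have := key _ x.ne h1
    rwa [← h2, FaceCorner.corner_flag, FaceCorner.corner_flag] at this

theorem edgeFlag_corner : ∀ x : TetFlag (Fin 2), x.2.2 ≠ x.2.1 → x.2.1 ≠ 0 →
    (edgeFlag x).2.2 ≠ (edgeFlag x).2.1 := by decide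

theorem edgePatch_complementary : edgePatch.Complementary diskPatch where
  exists_or y := by
    have key : ∀ y : TetFlag (Fin 3), y.2.2 ≠ y.2.1 →
        (∃ x : TetFlag (Fin 2), x.2.2 ≠ x.2.1 ∧ x.2.1 ≠ 0 ∧ y = edgeFlag x) ∨
        ∃ z : TetFlag (Fin 3), z.2.2 ≠ z.2.1 ∧ z ≠ y ∧ RingGlued y z := by decide +kernel
    rcases key y.flag y.ne with ⟨x, h1, h2, h3⟩ | ⟨z, h1, h2, h3⟩
    · refine .inl ⟨x.corner, (diskPatch_eq_edgePatch_iff.2 ?_).symm⟩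
      rw [TetFlag.flag_corner h1]
      exact ⟨h2, h3⟩
    · have hz : z.corner ≠ y := by
        rintro rfl; exact h2 (TetFlag.flag_corner h1).symm
      refine .inr ⟨z.corner, hz, (edgePatch_eq_iff hz.symm).2 ?_⟩
      rwa [TetFlag.flag_corner h1]
  eq_of_eq y z x h1 h2 := by
    by_contra hyz
    have h3 := (diskPatch_eq_edgePatch_iff.1 h1.symm).2
    have h5 := (diskPatch_eq_edgePatch_iff.1 (h1.symm.trans h2)).2
    exact hyz (FaceCorner.flag_injective (h3.trans h5.symm))

theorem diskPatch_complementary : diskPatch.Complementary edgePatch where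
  exists_or x := by
    by_cases h : x.flag.2.1 = 0
    · have hc : ((x.flag.1 + 1, 0, x.flag.2.2) : TetFlag (Fin 2)).2.2 ≠ 0 := by
        rw [← h]; exact x.ne
      have hx : TetFlag.corner (x.flag.1 + 1, 0, x.flag.2.2) ≠ x := by
        intro e
        have := congrArg (fun x => x.flag.1) e
        simp only [TetFlag.flag_corner hc] at this
        revert this
        generalize x.flag.1 = j
        revert j
        decide
      refine .inr ⟨_, hx, (diskPatch_eq_iff hx.symm).2 ?_⟩
      rw [TetFlag.flag_corner hc]
      exact ⟨h, rfl⟩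
    · refine .inl ⟨(edgeFlag x.flag).corner, diskPatch_eq_edgePatch_iff.2 ⟨h, ?_⟩⟩
      exact TetFlag.flag_corner (edgeFlag_corner _ x.ne h)
  eq_of_eq x y z h1 h2 := by
    by_contra hxy
    have h3 := (diskPatch_eq_edgePatch_iff.1 h1).1
    exact h3 ((diskPatch_eq_iff hxy).1 h2).1


/-! ### Bistellar moves in place -/

section Bistellar

variable {ι ι' κ : Type}

/-- The tetrahedra `c i` and the tetrahedra `o k`, for `k` in `D`, are different and are all the
tetrahedra there are. -/
structure IsPartition {p : ℕ} (c : Fin p → ι) (o : κ → ι) (D : Set κ) : Prop where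
  left_inj : Function.Injective c
  right_inj : Set.InjOn o D
  ne : ∀ i, ∀ k ∈ D, c i ≠ o k
  cover : ∀ t, (∃ i, c i = t) ∨ ∃ k ∈ D, o k = t

/-- The enumeration of all tetrahedra given by a partition. -/
noncomputable def IsPartition.equiv {p : ℕ} {c : Fin p → ι} {o : κ → ι} {D : Set κ}
    (h : IsPartition c o D) : Fin p ⊕ D ≃ ι :=
  Equiv.ofBijective (Sum.elim c (fun k => o k)) (by
    constructor
    · rintro (i | k) (j | l) e
      · exact congrArg _ (h.left_inj e)
      · exact absurd e (h.ne i l l.2)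
      · exact absurd e.symm (h.ne j k k.2)
      · exact congrArg _ (Subtype.ext (h.right_inj k.2 l.2 e))
    · intro t
      rcases h.cover t with ⟨i, hi⟩ | ⟨k, hk, hk'⟩
      · exact ⟨.inl i, hi⟩
      · exact ⟨.inr ⟨k, hk⟩, hk'⟩)

/-- The correspondence of face corners under the exchange of the tetrahedra `a i` around an edge for
the tetrahedra `c j`. -/
inductive BistellarCorr (a : Fin 3 → κ) (α : Fin 3 → Equiv.Perm (Fin 4)) (c : Fin 2 → ι)
    (γ : Fin 2 → Equiv.Perm (Fin 4)) (o : κ → ι) (ω : κ → Equiv.Perm (Fin 4)) :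
    TetFlag ι → TetFlag κ → Prop
  | outside (z : TetFlag κ) (hz : z.2.2 ≠ z.2.1) (h : z.1 ∉ Set.range a) :
      BistellarCorr a α c γ o ω (z.place o ω) z
  | boundary (x : TetFlag (Fin 2)) (hx : x.2.2 ≠ x.2.1) (h : x.2.1 ≠ 0) :
      BistellarCorr a α c γ o ω (x.place c γ) ((edgeFlag x).place a α)

/-- In the gluing `J`, the three tetrahedra `a i`, in the frames `α i`, surround an edge, and the
3-2 move at this edge gives the gluing `T`, with new tetrahedra `c j` in the frames `γ j`; every
other tetrahedron `k` of `J` becomes the tetrahedron `o k` of `T`, with its vertices reordered by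
`ω k`. -/
structure IsBistellar (J : FaceGluing κ) (a : Fin 3 → κ) (α : Fin 3 → Equiv.Perm (Fin 4))
    (T : FaceGluing ι) (c : Fin 2 → ι) (γ : Fin 2 → Equiv.Perm (Fin 4)) (o : κ → ι)
    (ω : κ → Equiv.Perm (Fin 4)) : Prop where
  inj : Function.Injective a
  part : IsPartition c o (Set.range a)ᶜ
  ring : ∀ x : TetFlag (Fin 3), x.2.1 = 2 →
    J.flagGlue (x.place a α) = (ringNext x).place a α
  disk : ∀ x : TetFlag (Fin 2), x.2.1 = 0 →
    T.flagGlue (x.place c γ) = TetFlag.place c γ (x.1 + 1, 0, x.2.2)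
  compat : ∀ x y x' y', BistellarCorr a α c γ o ω x x' → BistellarCorr a α c γ o ω y y' →
    (T.flagGlue x = y ↔ J.flagGlue x' = y')

/-- The gluing `T` is the result of the 3-2 move on `J` at the edge surrounded by the tetrahedra
`a i` in the frames `α i`. -/
def Reduces (J : FaceGluing κ) (a : Fin 3 → κ) (α : Fin 3 → Equiv.Perm (Fin 4))
    (T : FaceGluing ι) : Prop :=
  ∃ (c : Fin 2 → ι) (γ : Fin 2 → Equiv.Perm (Fin 4)) (o : κ → ι) (ω : κ → Equiv.Perm (Fin 4)),
    IsBistellar J a α T c γ o ω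

theorem FaceGluing.flagGlue_face (T : FaceGluing ι) {t t' : ι} {f v f' v' : Fin 4}
    (h : T.flagGlue (t, f, v) = (t', f', v')) : T.flagGlue (t, f, f) = (t', f', f') := by
  simp only [FaceGluing.flagGlue, Prod.mk.injEq] at h ⊢
  exact ⟨h.1, h.2.1, h.2.1⟩

theorem exists_reduces_of_data {ρ : Type} {J : FaceGluing κ} {T : FaceGluing ι}
    (u : Fin 3 ⊕ ρ ≃ κ) (s : Fin 3 ⊕ ρ → Equiv.Perm (Fin 4)) (u' : Fin 2 ⊕ ρ ≃ ι)
    (s' : Fin 2 ⊕ ρ → Equiv.Perm (Fin 4))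
    (hQ : ∀ x y : FaceCorner (Fin 3), x ≠ y → edgePatch x = edgePatch y →
      J.flagGlue (TetFlag.place (u ∘ Sum.inl) (s ∘ Sum.inl) x.flag) =
        TetFlag.place (u ∘ Sum.inl) (s ∘ Sum.inl) y.flag)
    (hP : ∀ x y : FaceCorner (Fin 2), x ≠ y → diskPatch x = diskPatch y →
      T.flagGlue (TetFlag.place (u' ∘ Sum.inl) (s' ∘ Sum.inl) x.flag) =
        TetFlag.place (u' ∘ Sum.inl) (s' ∘ Sum.inl) y.flag)
    (hc : ∀ (x y : FaceCorner (Fin 2 ⊕ ρ)) (x' y' : FaceCorner (Fin 3 ⊕ ρ)),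
      Patch.Corr diskPatch edgePatch x x' → Patch.Corr diskPatch edgePatch y y' →
      (T.flagGlue (TetFlag.place u' s' x.flag) = TetFlag.place u' s' y.flag ↔
      J.flagGlue (TetFlag.place u s x'.flag) = TetFlag.place u s y'.flag)) :
    ∃ a α, Reduces J a α T := by
  let o : κ → ι := fun k => Sum.elim (fun _ => u' (.inl 0)) (fun r => u' (.inr r)) (u.symm k)
  let ω : κ → Equiv.Perm (Fin 4) := fun k =>
    Sum.elim (fun _ => 1) (fun r => s' (.inr r) * (s (.inr r))⁻¹) (u.symm k)
  have out : ∀ k ∉ Set.range (u ∘ Sum.inl), ∃ r, k = u (.inr r) := by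
    intro k hk
    rcases h : u.symm k with i | r
    · exact absurd ⟨i, by simp [← h]⟩ hk
    · exact ⟨r, by simp [← h]⟩
  have ho : ∀ r, o (u (.inr r)) = u' (.inr r) := fun r => by simp [o]
  have hω : ∀ r, ω (u (.inr r)) = s' (.inr r) * (s (.inr r))⁻¹ := fun r => by simp [ω]
  refine ⟨u ∘ Sum.inl, s ∘ Sum.inl, u' ∘ Sum.inl, s' ∘ Sum.inl, o, ω,
    u.injective.comp Sum.inl_injective, ⟨u'.injective.comp Sum.inl_injective, ?_, ?_, ?_⟩,
    ?_, ?_, ?_⟩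
  · intro k hk l hl e
    obtain ⟨r, rfl⟩ := out k hk
    obtain ⟨r', rfl⟩ := out l hl
    rw [ho, ho, u'.injective.eq_iff, Sum.inr.injEq] at e
    rw [e]
  · intro i k hk e
    obtain ⟨r, rfl⟩ := out k hk
    rw [ho] at e
    simp at e
  · intro t
    rcases h : u'.symm t with i | r
    · exact .inl ⟨i, by simp [← h]⟩
    · refine .inr ⟨u (.inr r), ?_, by simp [ho, ← h]⟩
      rintro ⟨i, hi⟩
      simp at hi
  · -- the gluing of a whole face follows from that of one of its corners
    have key : ∀ x : TetFlag (Fin 3), x.2.2 ≠ x.2.1 → x.2.1 = 2 →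
        J.flagGlue (x.place (u ∘ Sum.inl) (s ∘ Sum.inl)) =
          (ringNext x).place (u ∘ Sum.inl) (s ∘ Sum.inl) := by
      intro x hx h2
      have hy : (ringNext x).2.2 ≠ (ringNext x).2.1 := by
        have : ∀ x : TetFlag (Fin 3), x.2.2 ≠ x.2.1 → x.2.1 = 2 →
          (ringNext x).2.2 ≠ (ringNext x).2.1 := by decide
        exact this x hx h2
      have hne : x.corner ≠ (ringNext x).corner := by
        intro e
        have := congrArg (fun x => x.flag.2.1) e
        rw [TetFlag.flag_corner hx, TetFlag.flag_corner hy, h2] at this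
        exact absurd this (by simp [ringNext])
      have h3 : RingGlued x.corner.flag (ringNext x).corner.flag := by
        rw [TetFlag.flag_corner hx, TetFlag.flag_corner hy]
        exact .inl ⟨h2, rfl⟩
      have := hQ _ _ hne ((edgePatch_eq_iff hne).2 h3)
      rwa [TetFlag.flag_corner hx, TetFlag.flag_corner hy] at this
    rintro ⟨i, f, v⟩ hf
    simp only at hf
    subst hf
    by_cases hv : v = 2
    · subst hv
      have := J.flagGlue_face (key (i, 2, 0) (by simp) rfl)
      simpa [ringNext, TetFlag.place] using this
    · exact key _ hv rfl
  · have key : ∀ x : TetFlag (Fin 2), x.2.2 ≠ x.2.1 → x.2.1 = 0 →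
        T.flagGlue (x.place (u' ∘ Sum.inl) (s' ∘ Sum.inl)) =
          TetFlag.place (u' ∘ Sum.inl) (s' ∘ Sum.inl) (x.1 + 1, 0, x.2.2) := by
      intro x hx h2
      have hy : ((x.1 + 1, 0, x.2.2) : TetFlag (Fin 2)).2.2 ≠ 0 := by rw [← h2]; exact hx
      have hne : x.corner ≠ TetFlag.corner (x.1 + 1, 0, x.2.2) := by
        intro e
        have := congrArg (fun x => x.flag.1) e
        rw [TetFlag.flag_corner hx, TetFlag.flag_corner hy] at this
        have hj : ∀ j : Fin 2, j ≠ j + 1 := by decide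
        exact hj _ this
      have h3 : DiskGlued x.corner.flag (TetFlag.corner (x.1 + 1, 0, x.2.2)).flag := by
        rw [TetFlag.flag_corner hx, TetFlag.flag_corner hy]
        exact ⟨h2, rfl⟩
      have := hP _ _ hne ((diskPatch_eq_iff hne).2 h3)
      rwa [TetFlag.flag_corner hx, TetFlag.flag_corner hy] at this
    rintro ⟨i, f, v⟩ hf
    simp only at hf
    subst hf
    by_cases hv : v = 0
    · subst hv
      exact T.flagGlue_face (key (i, 0, 1) (by simp) rfl)
    · exact key _ hv rfl
  · have lift : ∀ x x', BistellarCorr (u ∘ Sum.inl) (s ∘ Sum.inl) (u' ∘ Sum.inl) (s' ∘ Sum.inl) o ω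
        x x' → ∃ X X', Patch.Corr diskPatch edgePatch X X' ∧ x = TetFlag.place u' s' X.flag ∧
          x' = TetFlag.place u s X'.flag := by
      intro x x' h
      cases h with
      | outside _ hz h =>
        obtain ⟨k, f, v⟩ := x'
        obtain ⟨r, rfl⟩ := out k h
        refine ⟨_, _, Patch.Corr.outside ⟨r, (s (.inr r))⁻¹ f, (s (.inr r))⁻¹ v, by simpa using hz⟩,
          ?_, ?_⟩
        · simp [TetFlag.place, FaceCorner.map, FaceCorner.flag, ho, hω]
        · simp [TetFlag.place, FaceCorner.map, FaceCorner.flag]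
      | boundary z hz h =>
        refine ⟨_, _, Patch.Corr.boundary z.corner (edgeFlag z).corner
          (diskPatch_eq_edgePatch_iff.2 ?_), ?_, ?_⟩
        · rw [TetFlag.flag_corner hz, TetFlag.flag_corner (edgeFlag_corner z hz h)]
          exact ⟨h, rfl⟩
        · rw [FaceCorner.flag_map, TetFlag.flag_corner hz]
          rfl
        · rw [FaceCorner.flag_map, TetFlag.flag_corner (edgeFlag_corner z hz h)]
          rfl
    intro x y x' y' hx hy
    obtain ⟨X, X', hX, rfl, rfl⟩ := lift _ _ hx
    obtain ⟨Y, Y', hY, rfl, rfl⟩ := lift _ _ hy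
    exact hc X Y X' Y' hX hY

theorem Patch.Corr.symm {p q : ℕ} {L ρ : Type} {P : Patch p L} {Q : Patch q L}
    {x : FaceCorner (Fin p ⊕ ρ)} {y : FaceCorner (Fin q ⊕ ρ)} (h : Patch.Corr P Q x y) :
    Patch.Corr Q P y x := by
  cases h with
  | outside z => exact .outside z
  | boundary a b hab => exact .boundary b a hab.symm

theorem Move32.exists_reduces {J : FaceGluing κ} {T : FaceGluing ι} (h : Move32 J T) :
    ∃ a α, Reduces J a α T := by
  obtain ⟨ρ, u, s, u', s', hQ, hP, hc⟩ := ReplacePatch.elim edgePatch_complementary h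
  exact exists_reduces_of_data u s u' s' hQ hP fun x y x' y' hx hy =>
    (hc x' y' x y hx.symm hy.symm).symm

theorem Move23.exists_reduces {J : FaceGluing κ} {T : FaceGluing ι} (h : Move23 T J) :
    ∃ a α, Reduces J a α T := by
  obtain ⟨ρ, u, s, u', s', hP, hQ, hc⟩ := ReplacePatch.elim diskPatch_complementary h
  exact exists_reduces_of_data u' s' u s hQ hP hc

/-- A general criterion for a patch replacement, in which the tetrahedra outside the patches are
indexed by a set of some type. -/
theorem ReplacePatch.of_partition {p q : ℕ} {L : Type} {P : Patch p L} {Q : Patch q L}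
    {T : FaceGluing ι} {T' : FaceGluing ι'} {D : Set κ}
    {c : Fin p → ι} {o : κ → ι} (hp : IsPartition c o D) (γ : Fin p → Equiv.Perm (Fin 4))
    (ω : κ → Equiv.Perm (Fin 4)) {c' : Fin q → ι'} {o' : κ → ι'} (hp' : IsPartition c' o' D)
    (γ' : Fin q → Equiv.Perm (Fin 4)) (ω' : κ → Equiv.Perm (Fin 4))
    (hP : ∀ x y : FaceCorner (Fin p), x ≠ y → P x = P y →
      T.flagGlue (x.flag.place c γ) = y.flag.place c γ)
    (hQ : ∀ x y : FaceCorner (Fin q), x ≠ y → Q x = Q y →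
      T'.flagGlue (x.flag.place c' γ') = y.flag.place c' γ')
    (R : TetFlag ι → TetFlag ι' → Prop)
    (hR : ∀ x y x' y', R x x' → R y y' → T.flagGlue x = y → T'.flagGlue x' = y')
    (hout : ∀ z : TetFlag κ, z.2.2 ≠ z.2.1 → z.1 ∈ D → R (z.place o ω) (z.place o' ω'))
    (hbd : ∀ x y, P x = Q y → R (x.flag.place c γ) (y.flag.place c' γ')) :
    ReplacePatch P Q T T' := by
  refine ReplacePatch.intro hp.equiv (Sum.elim γ fun k => ω k) hp'.equiv (Sum.elim γ' fun k => ω' k)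
    hP hQ ?_
  have lift : ∀ x x', Patch.Corr P Q x x' →
      R (TetFlag.place hp.equiv (Sum.elim γ fun k => ω k) x.flag)
        (TetFlag.place hp'.equiv (Sum.elim γ' fun k => ω' k) x'.flag) := by
    intro x x' h
    cases h with
    | outside z => exact hout (z.tet, z.face, z.vert) z.ne z.tet.2
    | boundary x y h => exact hbd x y h
  intro x y x' y' hx hy
  exact hR _ _ _ _ (lift _ _ hx) (lift _ _ hy)

theorem IsPartition.compl_range {a : Fin 3 → κ} (ha : Function.Injective a) :
    IsPartition a id (Set.range a)ᶜ :=
  ⟨ha, Function.injective_id.injOn, fun i k hk e => hk ⟨i, e⟩, fun t => by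
    by_cases h : t ∈ Set.range a
    · exact .inl h
    · exact .inr ⟨t, h, rfl⟩⟩

theorem Reduces.replaced {J : FaceGluing κ} {a : Fin 3 → κ} {α : Fin 3 → Equiv.Perm (Fin 4)}
    {T : FaceGluing ι} (h : Reduces J a α T) : Move32 J T ∧ Move23 T J := by
  obtain ⟨c, γ, o, ω, h⟩ := h
  have hring : ∀ x y : FaceCorner (Fin 3), x ≠ y → edgePatch x = edgePatch y →
      J.flagGlue (x.flag.place a α) = y.flag.place a α := by
    intro x y hxy e
    rcases (edgePatch_eq_iff hxy).1 e with ⟨h1, h2⟩ | ⟨h1, h2⟩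
    · rw [h.ring _ h1, h2]
    · rw [J.flagGlue_eq_iff, h.ring _ h1, h2]
  have hdisk : ∀ x y : FaceCorner (Fin 2), x ≠ y → diskPatch x = diskPatch y →
      T.flagGlue (x.flag.place c γ) = y.flag.place c γ := by
    intro x y hxy e
    obtain ⟨h1, h2⟩ := (diskPatch_eq_iff hxy).1 e
    rw [h.disk _ h1, h2]
  have hbd : ∀ x y, diskPatch x = edgePatch y →
      BistellarCorr a α c γ o ω (x.flag.place c γ) (y.flag.place a α) := by
    intro x y e
    obtain ⟨h1, h2⟩ := diskPatch_eq_edgePatch_iff.1 e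
    rw [h2]
    exact .boundary _ x.ne h1
  constructor
  · refine ReplacePatch.of_partition (.compl_range h.inj) α (fun _ => 1) h.part γ ω hring hdisk
      (fun x' x => BistellarCorr a α c γ o ω x x') ?_ ?_ ?_
    · exact fun x y x' y' hx hy => (h.compat x' y' x y hx hy).2
    · exact fun z hz hk => .outside z hz hk
    · exact fun x y e => hbd y x e.symm
  · refine ReplacePatch.of_partition h.part γ ω (.compl_range h.inj) α (fun _ => 1) hdisk hring
      (fun x x' => BistellarCorr a α c γ o ω x x') ?_ ?_ ?_
    · exact fun x y x' y' hx hy => (h.compat x y x' y' hx hy).1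
    · exact fun z hz hk => .outside z hz hk
    · exact fun x y e => hbd x y e

end Bistellar


/-! ### The symmetries of an edge of degree three -/

section Symmetry

variable {ι ι' κ : Type}

/-- A symmetry of the bipyramid, which permutes the tetrahedra around the axis by `π` and those at
the equator by `χ`, gives another description of the same move. -/
theorem Reduces.of_symmetry {J : FaceGluing κ} {a : Fin 3 → κ} {α : Fin 3 → Equiv.Perm (Fin 4)}
    {T : FaceGluing ι} (h : Reduces J a α T) (π : Equiv.Perm (Fin 3)) (g : Equiv.Perm (Fin 4))
    (χ : Equiv.Perm (Fin 2)) (η : Equiv.Perm (Fin 4))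
    (hring : ∀ x : TetFlag (Fin 3), x.2.1 = 2 →
      RingGlued (x.place π fun _ => g) ((ringNext x).place π fun _ => g))
    (hη : η 0 = 0)
    (hedge : ∀ x : TetFlag (Fin 2), x.2.1 ≠ 0 →
      edgeFlag (x.place χ fun _ => η) = (edgeFlag x).place π fun _ => g) :
    Reduces J (a ∘ π) (fun i => α (π i) * g) T := by
  obtain ⟨c, γ, o, ω, h⟩ := h
  have hrange : Set.range (a ∘ π) = Set.range a := π.surjective.range_comp a
  refine ⟨c ∘ χ, fun j => γ (χ j) * η, o, ω, h.inj.comp π.injective, ?_, ?_, ?_, ?_⟩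
  · rw [hrange]
    refine ⟨h.part.left_inj.comp χ.injective, h.part.right_inj, fun j => h.part.ne (χ j),
      fun t => ?_⟩
    rcases h.part.cover t with ⟨j, hj⟩ | hk
    · exact .inl ⟨χ.symm j, by simpa using hj⟩
    · exact .inr hk
  · intro x hx
    change J.flagGlue (TetFlag.place a α (x.place π fun _ => g)) =
      TetFlag.place a α ((ringNext x).place π fun _ => g)
    rcases hring x hx with ⟨h1, h2⟩ | ⟨h1, h2⟩
    · rw [h.ring _ h1, h2]
    · rw [J.flagGlue_eq_iff, h.ring _ h1, h2]
  · intro x hx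
    have hχ : ∀ (χ : Equiv.Perm (Fin 2)) (j : Fin 2), χ (j + 1) = χ j + 1 := by decide
    have := h.disk (x.place χ fun _ => η) (by simpa [TetFlag.place, hx] using hη)
    refine this.trans ?_
    simp [TetFlag.place, hχ, hη]
  · have lift : ∀ x x', BistellarCorr (a ∘ π) (fun i => α (π i) * g) (c ∘ χ)
        (fun j => γ (χ j) * η) o ω x x' → BistellarCorr a α c γ o ω x x' := by
      intro x x' hx
      cases hx with
      | outside _ hz hk => exact .outside _ hz (hrange ▸ hk)
      | boundary x hx h0 =>
        have := BistellarCorr.boundary (a := a) (α := α) (c := c) (γ := γ) (o := o) (ω := ω)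
          (x.place χ fun _ => η) (by simpa [TetFlag.place] using hx)
          (by
            simp only [TetFlag.place]
            rw [← hη]
            exact fun e => h0 (η.injective e))
        rwa [hedge x h0] at this
    exact fun x y x' y' hx hy => h.compat x y x' y' (lift _ _ hx) (lift _ _ hy)

theorem Reduces.rotate {J : FaceGluing κ} {a : Fin 3 → κ} {α : Fin 3 → Equiv.Perm (Fin 4)}
    {T : FaceGluing ι} (h : Reduces J a α T) (k : Fin 3) :
    Reduces J (fun i => a (i + k)) (fun i => α (i + k)) T := by
  have key : ∀ {a : Fin 3 → κ} {α : Fin 3 → Equiv.Perm (Fin 4)}, Reduces J a α T →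
      Reduces J (fun i => a (i + 1)) (fun i => α (i + 1)) T := fun h =>
    h.of_symmetry (Equiv.addRight 1) 1 1 FaceGluing.rot3 (by decide +kernel) (by decide)
      (by decide +kernel)
  fin_cases k
  · simpa using h
  · exact key h
  · have e : ∀ i : Fin 3, i + 1 + 1 = i + 2 := by decide
    simpa [e] using key (key h)

/-- The reflection in a plane through the axis. -/
theorem Reduces.reflect {J : FaceGluing κ} {a : Fin 3 → κ} {α : Fin 3 → Equiv.Perm (Fin 4)}
    {T : FaceGluing ι} (h : Reduces J a α T) :
    Reduces J (fun i => a (-i)) (fun i => α (-i) * Equiv.swap 2 3) T :=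
  h.of_symmetry (Equiv.neg (Fin 3)) (Equiv.swap 2 3) 1 (Equiv.swap 1 2) (by decide +kernel)
    (by decide) (by decide +kernel)

/-- The reflection in the equator. -/
theorem Reduces.flip {J : FaceGluing κ} {a : Fin 3 → κ} {α : Fin 3 → Equiv.Perm (Fin 4)}
    {T : FaceGluing ι} (h : Reduces J a α T) :
    Reduces J a (fun i => α i * Equiv.swap 0 1) T :=
  h.of_symmetry 1 (Equiv.swap 0 1) (Equiv.swap 0 1) 1 (by decide +kernel) (by decide)
    (by decide +kernel)

theorem Reduces.injective {J : FaceGluing κ} {a : Fin 3 → κ} {α : Fin 3 → Equiv.Perm (Fin 4)}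
    {T : FaceGluing ι} (h : Reduces J a α T) : Function.Injective a := by
  obtain ⟨c, γ, o, ω, h⟩ := h
  exact h.inj

theorem Reduces.flagGlue_two {J : FaceGluing κ} {a : Fin 3 → κ} {α : Fin 3 → Equiv.Perm (Fin 4)}
    {T : FaceGluing ι} (h : Reduces J a α T) (i : Fin 3) (v : Fin 4) :
    J.flagGlue (a i, α i 2, α i v) = (a (i + 1), α (i + 1) 3, α (i + 1) (Equiv.swap 2 3 v)) := by
  obtain ⟨c, γ, o, ω, h⟩ := h
  exact h.ring (i, 2, v) rfl

theorem Reduces.flagGlue_three {J : FaceGluing κ} {a : Fin 3 → κ} {α : Fin 3 → Equiv.Perm (Fin 4)}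
    {T : FaceGluing ι} (h : Reduces J a α T) (i : Fin 3) (v : Fin 4) :
    J.flagGlue (a (i + 1), α (i + 1) 3, α (i + 1) v) = (a i, α i 2, α i (Equiv.swap 2 3 v)) := by
  rw [J.flagGlue_eq_iff, h.flagGlue_two]
  simp

end Symmetry

/-! ### Templates for overlapping edges of degree three -/

/-- A template for the three tetrahedra around an edge of degree three, among `d` tetrahedra:
which they are, and in which order their vertices are to be taken. -/
structure EdgeFrame (d : ℕ) where
  tet : Fin 3 → Fin d
  frame : Fin 3 → Equiv.Perm (Fin 4)

namespace EdgeFrame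

variable {d : ℕ}

/-- The flags that are glued around the edge. -/
def Glued (A : EdgeFrame d) (x y : TetFlag (Fin d)) : Prop :=
  ∃ i v, (x = TetFlag.place A.tet A.frame (i, 2, v) ∧
      y = TetFlag.place A.tet A.frame (i + 1, 3, Equiv.swap 2 3 v)) ∨
    (y = TetFlag.place A.tet A.frame (i, 2, v) ∧
      x = TetFlag.place A.tet A.frame (i + 1, 3, Equiv.swap 2 3 v))

instance (A : EdgeFrame d) (x y : TetFlag (Fin d)) : Decidable (A.Glued x y) :=
  by unfold Glued; infer_instance

/-- The gluings required by two edges contradict each other. -/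
def Conflict (A B : EdgeFrame d) : Prop :=
  ∃ i v j u,
    let x := TetFlag.place A.tet A.frame (i, 2, v)
    let y := TetFlag.place A.tet A.frame (ringNext (i, 2, v))
    let x' := TetFlag.place B.tet B.frame (j, 2, u)
    let y' := TetFlag.place B.tet B.frame (ringNext (j, 2, u))
    ¬ ((x = x' ↔ y = y') ∧ (x = y' ↔ y = x'))

instance (A B : EdgeFrame d) : Decidable (A.Conflict B) := by unfold Conflict; infer_instance

/-- The flag around the edge that corresponds to a flag of the tetrahedra replacing those around the
edge or remaining from the `d` tetrahedra.  The former are numbered by `Fin 2`; their common face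
corresponds to nothing. -/
def lift {p : ℕ} (A : EdgeFrame d) (t : Fin p → Fin 2 ⊕ Fin d) (s : Fin p → Equiv.Perm (Fin 4))
    (x : TetFlag (Fin p)) : Option (TetFlag (Fin d)) :=
  match t x.1 with
  | .inl j => if s x.1 x.2.1 = 0 then none else
      some (TetFlag.place A.tet A.frame (edgeFlag (j, s x.1 x.2.1, s x.1 x.2.2)))
  | .inr k => some (k, s x.1 x.2.1, s x.1 x.2.2)

/-- After the 3-2 move at the edge `A`, these flags are glued, by virtue of that move and of the
gluings around the edges `A` and `B`. -/
def GluedAfter {p : ℕ} (A B : EdgeFrame d) (t : Fin p → Fin 2 ⊕ Fin d)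
    (s : Fin p → Equiv.Perm (Fin 4)) (x y : TetFlag (Fin p)) : Prop :=
  (∃ j, t x.1 = .inl j ∧ t y.1 = .inl (j + 1) ∧ s x.1 x.2.1 = 0 ∧ s y.1 y.2.1 = 0 ∧
    s x.1 x.2.2 = s y.1 y.2.2) ∨
  ∃ z ∈ A.lift t s x, ∃ z' ∈ A.lift t s y, A.Glued z z' ∨ B.Glued z z'

instance {p : ℕ} (A B : EdgeFrame d) (t : Fin p → Fin 2 ⊕ Fin d)
    (s : Fin p → Equiv.Perm (Fin 4)) (x y : TetFlag (Fin p)) :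
    Decidable (A.GluedAfter B t s x y) := by unfold GluedAfter; infer_instance

/-- After the two 3-2 moves, the tetrahedra enumerated by `t` and by `t'` are glued in the same way
to one another and to the other tetrahedra. -/
def SameAfter {p : ℕ} (A B : EdgeFrame d) (t : Fin p → Fin 2 ⊕ Fin d)
    (s : Fin p → Equiv.Perm (Fin 4)) (t' : Fin p → Fin 2 ⊕ Fin d)
    (s' : Fin p → Equiv.Perm (Fin 4)) : Prop :=
  ∀ x : TetFlag (Fin p), x.2.2 ≠ x.2.1 → (∃ z ∈ A.lift t s x, z ∈ B.lift t' s' x) ∨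
    ∃ y : TetFlag (Fin p), y.2.2 ≠ y.2.1 ∧ A.GluedAfter B t s x y ∧ B.GluedAfter A t' s' x y

instance {p : ℕ} (A B : EdgeFrame d) (t : Fin p → Fin 2 ⊕ Fin d)
    (s : Fin p → Equiv.Perm (Fin 4)) (t' : Fin p → Fin 2 ⊕ Fin d)
    (s' : Fin p → Equiv.Perm (Fin 4)) : Decidable (A.SameAfter B t s t' s') := by
  unfold SameAfter; infer_instance

/-- After the 3-2 move at the edge `A`, the tetrahedron `t i`, with its vertices in the order `s`,
has two faces glued by a twist as in `FaceGluing.IsTwisted`. -/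
def TwistedAfter {p : ℕ} (A B : EdgeFrame d) (t : Fin p → Fin 2 ⊕ Fin d) (i : Fin p)
    (s : Equiv.Perm (Fin 4)) : Prop :=
  ∀ v, v ≠ 3 → A.GluedAfter B t 1 (i, s 3, s v) (i, s 1, s (FaceGluing.rot3 v))

instance {p : ℕ} (A B : EdgeFrame d) (t : Fin p → Fin 2 ⊕ Fin d) (i : Fin p)
    (s : Equiv.Perm (Fin 4)) : Decidable (A.TwistedAfter B t i s) := by
  unfold TwistedAfter; infer_instance

/-- The tetrahedra `t i` are all those present after the 3-2 move at the edge, each once. -/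
def Enumerates {p : ℕ} (A : EdgeFrame d) (t : Fin p → Fin 2 ⊕ Fin d) : Prop :=
  Function.Injective t ∧ (∀ j, ∃ i, t i = .inl j) ∧
    ∀ k, (∃ i, t i = .inr k) ↔ ∀ i, A.tet i ≠ k

instance {p : ℕ} (A : EdgeFrame d) (t : Fin p → Fin 2 ⊕ Fin d) : Decidable (A.Enumerates t) := by
  unfold Enumerates; infer_instance

end EdgeFrame

section Overlap

variable {ι ι' κ : Type} {d : ℕ}

/-- In the gluing `J`, the tetrahedra `W k`, with their vertices reordered by `ν k`, contain the
template `A` of an edge of degree three, and the 3-2 move at that edge gives `T`. -/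
abbrev IsBistellarAt (J : FaceGluing κ) (W : Fin d → κ) (ν : Fin d → Equiv.Perm (Fin 4))
    (A : EdgeFrame d) (T : FaceGluing ι) (c : Fin 2 → ι) (γ : Fin 2 → Equiv.Perm (Fin 4))
    (o : κ → ι) (ω : κ → Equiv.Perm (Fin 4)) : Prop :=
  IsBistellar J (fun i => W (A.tet i)) (fun i => ν (A.tet i) * A.frame i) T c γ o ω

/-- The tetrahedra enumerated by `t`. -/
def overlapTet {p : ℕ} (W : Fin d → κ) (c : Fin 2 → ι) (o : κ → ι) (t : Fin p → Fin 2 ⊕ Fin d)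
    (i : Fin p) : ι :=
  Sum.elim c (fun k => o (W k)) (t i)

/-- The frames of the tetrahedra enumerated by `t`, up to the reorderings `s`. -/
def overlapFrame {p : ℕ} (W : Fin d → κ) (ν : Fin d → Equiv.Perm (Fin 4))
    (γ : Fin 2 → Equiv.Perm (Fin 4)) (ω : κ → Equiv.Perm (Fin 4)) (t : Fin p → Fin 2 ⊕ Fin d)
    (s : Fin p → Equiv.Perm (Fin 4)) (i : Fin p) : Equiv.Perm (Fin 4) :=
  Sum.elim γ (fun k => ω (W k) * ν k) (t i) * s i

variable {J : FaceGluing κ} {W : Fin d → κ} {ν : Fin d → Equiv.Perm (Fin 4)}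
  {A B : EdgeFrame d} {T : FaceGluing ι} {c : Fin 2 → ι} {γ : Fin 2 → Equiv.Perm (Fin 4)}
  {o : κ → ι} {ω : κ → Equiv.Perm (Fin 4)} {T' : FaceGluing ι'} {c' : Fin 2 → ι'}
  {γ' : Fin 2 → Equiv.Perm (Fin 4)} {o' : κ → ι'} {ω' : κ → Equiv.Perm (Fin 4)}

theorem IsBistellarAt.flagGlue_of_glued (hA : IsBistellarAt J W ν A T c γ o ω)
    {x y : TetFlag (Fin d)} (h : A.Glued x y) : J.flagGlue (x.place W ν) = y.place W ν := by
  obtain ⟨i, v, ⟨rfl, rfl⟩ | ⟨rfl, rfl⟩⟩ := h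
  · exact hA.ring (i, 2, v) rfl
  · rw [J.flagGlue_eq_iff]
    exact hA.ring (i, 2, v) rfl

theorem IsBistellarAt.not_conflict (hW : Function.Injective W)
    (hA : IsBistellarAt J W ν A T c γ o ω)
    (hB : IsBistellarAt J W ν B T' c' γ' o' ω') : ¬ A.Conflict B := by
  rintro ⟨i, v, j, u, h⟩
  refine h ?_
  simp only [← (TetFlag.place_injective hW ν).eq_iff]
  have e1 : J.flagGlue (TetFlag.place W ν (TetFlag.place A.tet A.frame (i, 2, v))) =
    TetFlag.place W ν (TetFlag.place A.tet A.frame (ringNext (i, 2, v))) := hA.ring (i, 2, v) rfl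
  have e2 : J.flagGlue (TetFlag.place W ν (TetFlag.place B.tet B.frame (j, 2, u))) =
    TetFlag.place W ν (TetFlag.place B.tet B.frame (ringNext (j, 2, u))) := hB.ring (j, 2, u) rfl
  rw [← e1, ← e2]
  have inj : Function.Injective J.flagGlue := fun x y e => by
    rw [← J.flagGlue_flagGlue x, e, J.flagGlue_flagGlue]
  exact ⟨inj.eq_iff.symm, by rw [← inj.eq_iff, J.flagGlue_flagGlue]⟩

theorem IsBistellarAt.corr_of_lift {p : ℕ} (hW : Function.Injective W)
    {t : Fin p → Fin 2 ⊕ Fin d} (s : Fin p → Equiv.Perm (Fin 4)) (ht : A.Enumerates t)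
    {x : TetFlag (Fin p)} (hx : x.2.2 ≠ x.2.1) {z : TetFlag (Fin d)} (hz : z ∈ A.lift t s x) :
    BistellarCorr (fun i => W (A.tet i)) (fun i => ν (A.tet i) * A.frame i) c γ o ω
      (x.place (overlapTet W c o t) (overlapFrame W ν γ ω t s)) (z.place W ν) := by
  have hs : s x.1 x.2.2 ≠ s x.1 x.2.1 := fun e => hx ((s x.1).injective e)
  unfold EdgeFrame.lift at hz
  simp only [TetFlag.place, overlapTet, overlapFrame]
  rcases h : t x.1 with j | k
  · simp only [h] at hz
    split_ifs at hz with h0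
    · simp at hz
    · simp only [Option.mem_def, Option.some.injEq] at hz
      subst hz
      exact BistellarCorr.boundary (j, s x.1 x.2.1, s x.1 x.2.2) hs h0
  · simp only [h, Option.mem_def, Option.some.injEq] at hz
    subst hz
    refine BistellarCorr.outside (W k, ν k (s x.1 x.2.1), ν k (s x.1 x.2.2)) ?_ ?_
    · simpa using hs
    · rintro ⟨i, hi⟩
      exact (ht.2.2 k).1 ⟨_, h⟩ i (hW hi)

theorem IsBistellarAt.flagGlue_of_gluedAfter {p : ℕ} (hW : Function.Injective W)
    (hA : IsBistellarAt J W ν A T c γ o ω)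
    (hB : IsBistellarAt J W ν B T' c' γ' o' ω') {t : Fin p → Fin 2 ⊕ Fin d}
    {s : Fin p → Equiv.Perm (Fin 4)} (ht : A.Enumerates t) {x y : TetFlag (Fin p)}
    (hx : x.2.2 ≠ x.2.1) (hy : y.2.2 ≠ y.2.1) (h : A.GluedAfter B t s x y) :
    T.flagGlue (x.place (overlapTet W c o t) (overlapFrame W ν γ ω t s)) =
      y.place (overlapTet W c o t) (overlapFrame W ν γ ω t s) := by
  rcases h with ⟨j, h1, h2, h3, h4, h5⟩ | ⟨z, hz, z', hz', h⟩
  · simp only [TetFlag.place, overlapTet, overlapFrame, h1, h2, Equiv.Perm.mul_apply, h3, h4,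
      ← h5, Sum.elim_inl]
    exact hA.disk (j, 0, s x.1 x.2.2) rfl
  · rw [hA.compat _ _ _ _ (corr_of_lift hW s ht hx hz) (corr_of_lift hW s ht hy hz')]
    rcases h with h | h
    · exact hA.flagGlue_of_glued h
    · exact hB.flagGlue_of_glued h

theorem IsBistellarAt.isPartition {p : ℕ} (hA : IsBistellarAt J W ν A T c γ o ω)
    (hW : Function.Injective W) {t : Fin p → Fin 2 ⊕ Fin d} (ht : A.Enumerates t) :
    IsPartition (overlapTet W c o t) o (Set.range W)ᶜ := by
  have out : ∀ k, (∃ i, t i = .inr k) → W k ∈ (Set.range fun i => W (A.tet i))ᶜ := by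
    rintro k hk ⟨i, hi⟩
    exact (ht.2.2 k).1 hk i (hW hi)
  have sub : ∀ k ∈ (Set.range W)ᶜ, k ∈ (Set.range fun i => W (A.tet i))ᶜ := by
    rintro _ hk ⟨i, rfl⟩
    exact hk ⟨_, rfl⟩
  refine ⟨fun i i' e => ?_, fun k hk l hl e => hA.part.right_inj (sub _ hk) (sub _ hl) e,
    fun i k hk e => ?_, fun u => ?_⟩
  · apply ht.1
    simp only [overlapTet] at e
    rcases h : t i with j | k <;> rcases h' : t i' with j' | k' <;>
      simp only [h, h', Sum.elim_inl, Sum.elim_inr] at e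
    · rw [hA.part.left_inj e]
    · exact absurd e (hA.part.ne _ _ (out _ ⟨_, h'⟩))
    · exact absurd e.symm (hA.part.ne _ _ (out _ ⟨_, h⟩))
    · rw [hW (hA.part.right_inj (out _ ⟨_, h⟩) (out _ ⟨_, h'⟩) e)]
  · simp only [overlapTet] at e
    rcases h : t i with j | l <;> simp only [h, Sum.elim_inl, Sum.elim_inr] at e
    · exact hA.part.ne _ _ (sub _ hk) e
    · have := hA.part.right_inj (out _ ⟨_, h⟩) (sub _ hk) e
      exact hk ⟨_, this⟩
  · rcases hA.part.cover u with ⟨j, rfl⟩ | ⟨k, hk, rfl⟩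
    · obtain ⟨i, hi⟩ := ht.2.1 j
      exact .inl ⟨i, by simp [overlapTet, hi]⟩
    · by_cases hkW : k ∈ Set.range W
      · obtain ⟨k, rfl⟩ := hkW
        obtain ⟨i, hi⟩ := (ht.2.2 k).2 fun i e => hk ⟨i, by rw [← e]⟩
        exact .inl ⟨i, by simp [overlapTet, hi]⟩
      · exact .inr ⟨k, hkW, rfl⟩

/-- If the enumerated tetrahedra after the two 3-2 moves form two patches with the same boundary,
then the composition of the two moves exchanges the patches. -/
theorem IsBistellarAt.replacePatch {p q : ℕ} {L : Type} {P : Patch p L} {Q : Patch q L}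
    (hW : Function.Injective W) (hA : IsBistellarAt J W ν A T c γ o ω)
    (hB : IsBistellarAt J W ν B T' c' γ' o' ω')
    (t : Fin p → Fin 2 ⊕ Fin d) (s : Fin p → Equiv.Perm (Fin 4)) (ht : A.Enumerates t)
    (t' : Fin q → Fin 2 ⊕ Fin d) (s' : Fin q → Equiv.Perm (Fin 4)) (ht' : B.Enumerates t')
    (hP : ∀ x y : FaceCorner (Fin p), x ≠ y → P x = P y → A.GluedAfter B t s x.flag y.flag)
    (hQ : ∀ x y : FaceCorner (Fin q), x ≠ y → Q x = Q y → B.GluedAfter A t' s' x.flag y.flag)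
    (hPQ : ∀ x y, P x = Q y → ∃ z ∈ A.lift t s x.flag, z ∈ B.lift t' s' y.flag) :
    ReplacePatch P Q T T' := by
  refine ReplacePatch.of_partition (hA.isPartition hW ht) (overlapFrame W ν γ ω t s) ω
    (hB.isPartition hW ht') (overlapFrame W ν γ' ω' t' s') ω'
    (fun x y hxy h => hA.flagGlue_of_gluedAfter hW hB ht x.ne y.ne (hP x y hxy h))
    (fun x y hxy h => hB.flagGlue_of_gluedAfter hW hA ht' x.ne y.ne (hQ x y hxy h))
    (fun x x' => ∃ z, BistellarCorr (fun i => W (A.tet i)) (fun i => ν (A.tet i) * A.frame i)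
      c γ o ω x z ∧ BistellarCorr (fun i => W (B.tet i)) (fun i => ν (B.tet i) * B.frame i)
      c' γ' o' ω' x' z) ?_ ?_ ?_
  · rintro x y x' y' ⟨z, h1, h2⟩ ⟨z', h3, h4⟩ e
    rwa [hB.compat _ _ _ _ h2 h4, ← hA.compat _ _ _ _ h1 h3]
  · refine fun z hz hk => ⟨z, .outside z hz ?_, .outside z hz ?_⟩
    all_goals
      rintro ⟨i, hi⟩
      exact hk ⟨_, hi⟩
  · intro x y h
    obtain ⟨z, h1, h2⟩ := hPQ x y h
    exact ⟨_, IsBistellarAt.corr_of_lift hW s ht x.ne h1,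
      IsBistellarAt.corr_of_lift hW s' ht' y.ne h2⟩

/-- If the enumerated tetrahedra after the two 3-2 moves are glued in the same way, then the
composition of the two moves does not change the triangulation. -/
theorem IsBistellarAt.isomorphic {p : ℕ}
    (hW : Function.Injective W) (hA : IsBistellarAt J W ν A T c γ o ω)
    (hB : IsBistellarAt J W ν B T' c' γ' o' ω')
    (t : Fin p → Fin 2 ⊕ Fin d) (s : Fin p → Equiv.Perm (Fin 4)) (ht : A.Enumerates t)
    (t' : Fin p → Fin 2 ⊕ Fin d) (s' : Fin p → Equiv.Perm (Fin 4)) (ht' : B.Enumerates t')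
    (h : A.SameAfter B t s t' s') :
    T.Isomorphic T' := by
  let u := (hA.isPartition hW ht).equiv
  let r := Sum.elim (overlapFrame W ν γ ω t s) (fun k : (Set.range W)ᶜ.Elem => ω k)
  let u' := (hB.isPartition hW ht').equiv
  let r' := Sum.elim (overlapFrame W ν γ' ω' t' s') (fun k : (Set.range W)ᶜ.Elem => ω' k)
  let S := T.pull u r
  let S' := T'.pull u' r'
  have hS : ∀ x y, S.flagGlue x = y ↔ T.flagGlue (x.place u r) = y.place u r := fun x y => by
    rw [← FaceGluing.place_flagGlue_pull, (TetFlag.place_injective u.injective r).eq_iff]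
  have hS' : ∀ x y, S'.flagGlue x = y ↔ T'.flagGlue (x.place u' r') = y.place u' r' :=
    fun x y => by
      rw [← FaceGluing.place_flagGlue_pull, (TetFlag.place_injective u'.injective r').eq_iff]
  -- a corner is either glued in the same way inside, or corresponds to itself
  have key : ∀ x : TetFlag (Fin p ⊕ (Set.range W)ᶜ.Elem), x.2.2 ≠ x.2.1 →
      (∃ y, S.flagGlue x = y ∧ S'.flagGlue x = y) ∨
      ∃ z, BistellarCorr (fun i => W (A.tet i)) (fun i => ν (A.tet i) * A.frame i)
        c γ o ω (x.place u r) z ∧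
        BistellarCorr (fun i => W (B.tet i)) (fun i => ν (B.tet i) * B.frame i)
        c' γ' o' ω' (x.place u' r') z := by
    rintro ⟨i | k, f, v⟩ hx
    · rcases h (i, f, v) hx with ⟨z, h1, h2⟩ | ⟨y, hy, h1, h2⟩
      · exact .inr ⟨_, IsBistellarAt.corr_of_lift hW s ht hx h1,
          IsBistellarAt.corr_of_lift hW s' ht' hx h2⟩
      · exact .inl ⟨y.place Sum.inl (fun _ => 1),
          (hS _ _).2 (hA.flagGlue_of_gluedAfter hW hB ht hx hy h1),
          (hS' _ _).2 (hB.flagGlue_of_gluedAfter hW hA ht' hx hy h2)⟩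
    · refine .inr ⟨(k.1, f, v), .outside (k.1, f, v) hx ?_, .outside (k.1, f, v) hx ?_⟩
      all_goals
        rintro ⟨i, hi⟩
        exact k.2 ⟨_, hi⟩
  have same : ∀ x : TetFlag (Fin p ⊕ (Set.range W)ᶜ.Elem), x.2.2 ≠ x.2.1 →
      S'.flagGlue x = S.flagGlue x := by
    intro x hx
    rcases key x hx with ⟨y, h1, h2⟩ | ⟨z, h1, h2⟩
    · rw [h1, h2]
    · have hy : (S.flagGlue x).2.2 ≠ (S.flagGlue x).2.1 := by
        simpa [FaceGluing.flagGlue] using hx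
      rcases key _ hy with ⟨y, h3, h4⟩ | ⟨z', h3, h4⟩
      · rw [S.flagGlue_flagGlue] at h3
        subst h3
        exact S'.flagGlue_eq_iff.1 h4
      · rw [hS', hB.compat _ _ _ _ h2 h4, ← hA.compat _ _ _ _ h1 h3, ← hS]
  refine (T.isomorphic_pull u r).trans (.trans ?_ (T'.pull_isomorphic u' r'))
  refine FaceGluing.isomorphic_iff.2 ⟨Equiv.refl _, fun _ => 1, fun x => ?_⟩
  obtain ⟨k, f, v⟩ := x
  change S'.flagGlue (k, f, v) = S.flagGlue (k, f, v)
  by_cases hv : v = f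
  · subst hv
    have hv' : v + 1 ≠ v := by simp
    exact S'.flagGlue_face (same (k, v, v + 1) hv')
  · exact same _ hv

theorem IsBistellarAt.isTwisted {p : ℕ} (hW : Function.Injective W)
    (hA : IsBistellarAt J W ν A T c γ o ω) (hB : IsBistellarAt J W ν B T' c' γ' o' ω')
    (t : Fin p → Fin 2 ⊕ Fin d) (ht : A.Enumerates t)
    (i : Fin p) (s : Equiv.Perm (Fin 4))
    (h : A.TwistedAfter B t i s) :
    ∃ u s, T.IsTwisted u s := by
  refine ⟨overlapTet W c o t i, overlapFrame W ν γ ω t 1 i * s, ?_⟩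
  have key : ∀ v, v ≠ 3 → T.flagGlue (overlapTet W c o t i,
      (overlapFrame W ν γ ω t 1 i * s) 3, (overlapFrame W ν γ ω t 1 i * s) v) =
      (overlapTet W c o t i, (overlapFrame W ν γ ω t 1 i * s) 1,
      (overlapFrame W ν γ ω t 1 i * s) (FaceGluing.rot3 v)) := by
    intro v hv
    refine hA.flagGlue_of_gluedAfter hW hB ht (x := (i, s 3, s v))
      (y := (i, s 1, s (FaceGluing.rot3 v))) ?_ ?_ (h v hv)
    · simpa using hv
    · have : ∀ v : Fin 4, v ≠ 3 → FaceGluing.rot3 v ≠ 1 := by decide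
      simpa using this v hv
  have all : ∀ v, T.flagGlue (overlapTet W c o t i,
      (overlapFrame W ν γ ω t 1 i * s) 3, (overlapFrame W ν γ ω t 1 i * s) v) =
      (overlapTet W c o t i, (overlapFrame W ν γ ω t 1 i * s) 1,
      (overlapFrame W ν γ ω t 1 i * s) (FaceGluing.rot3 v)) := by
    intro v
    by_cases hv : v = 3
    · subst hv
      exact T.flagGlue_face (key 0 (by decide))
    · exact key v hv
  refine ⟨congrArg Prod.fst (all 0), ?_⟩
  ext1 v
  have := congrArg (fun x => x.2.2) (all ((overlapFrame W ν γ ω t 1 i * s)⁻¹ v))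
  simpa [FaceGluing.flagGlue] using this

end Overlap


/-! ### The possible overlaps -/

instance {p : ℕ} : Fintype (FaceCorner (Fin p)) :=
  Fintype.ofEquiv _ (FaceCorner.equivSubtype (Fin p)).symm

instance {p : ℕ} : DecidableEq (FaceCorner (Fin p)) := fun x y =>
  decidable_of_iff (x.flag = y.flag) FaceCorner.flag_injective.eq_iff

/-- The permutation with the given values. -/
def permOf (f : Fin 4 → Fin 4) (hf : Function.Injective f := by decide) : Equiv.Perm (Fin 4) where
  toFun := f
  invFun y := if f 0 = y then 0 else if f 1 = y then 1 else if f 2 = y then 2 else 3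
  left_inv := by
    have : ∀ f : Fin 4 → Fin 4, Function.Injective f → Function.LeftInverse
      (fun y => if f 0 = y then 0 else if f 1 = y then 1 else if f 2 = y then 2 else 3) f := by
      decide +kernel
    exact this f hf
  right_inv := by
    have : ∀ f : Fin 4 → Fin 4, Function.Injective f → Function.RightInverse
      (fun y => if f 0 = y then 0 else if f 1 = y then 1 else if f 2 = y then 2 else 3) f := by
      decide +kernel
    exact this f hf

/-- The reordering of the vertices of a tetrahedron that interchanges the edges `01` and `23`. -/
def oppositeEdge : Equiv.Perm (Fin 4) := permOf ![2, 3, 0, 1]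

namespace EdgeFrame

/-- The first three tetrahedra, in their frames. -/
def first (d : ℕ) : EdgeFrame (d + 3) := ⟨Fin.castLE (by omega), fun _ => 1⟩

/-- An edge that shares a vertex with the edge surrounded by `first`, two of the tetrahedra around
it being among the first three. -/
def adjacent : EdgeFrame 4 := ⟨![0, 3, 2], ![Equiv.swap 1 2, 1, Equiv.swap 1 3]⟩

/-- An edge that shares a vertex with the edge surrounded by `first`, the tetrahedra around the two
edges being the same. -/
def adjacentAll (g : Equiv.Perm (Fin 4)) : EdgeFrame 3 :=
  ⟨![0, 1, 2], ![Equiv.swap 1 2, g, Equiv.swap 1 3]⟩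

/-- An edge opposite to the edge surrounded by `first` in the only tetrahedron around both. -/
def oppositeOne : EdgeFrame 5 := ⟨![0, 3, 4], ![oppositeEdge, 1, 1]⟩

/-- An edge opposite to the edge surrounded by `first` in one of the two tetrahedra around both. -/
def oppositeTwo (g : Equiv.Perm (Fin 4)) : EdgeFrame 4 := ⟨![0, 1, 3], ![oppositeEdge, g, 1]⟩

/-- An edge opposite to the edge surrounded by `first` in a tetrahedron, the tetrahedra around the
two edges being the same. -/
def oppositeAll (g g' : Equiv.Perm (Fin 4)) : EdgeFrame 3 := ⟨![0, 1, 2], ![oppositeEdge, g, g']⟩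

end EdgeFrame

section Overlap

variable {ι ι' κ : Type}

variable {J : FaceGluing κ} {T : FaceGluing ι} {c : Fin 2 → ι} {γ : Fin 2 → Equiv.Perm (Fin 4)}
  {o : κ → ι} {ω : κ → Equiv.Perm (Fin 4)} {T' : FaceGluing ι'} {c' : Fin 2 → ι'}
  {γ' : Fin 2 → Equiv.Perm (Fin 4)} {o' : κ → ι'} {ω' : κ → Equiv.Perm (Fin 4)}

theorem IsBistellarAt.octahedronFlip {W : Fin 5 → κ} (hW : Function.Injective W)
    {ν : Fin 5 → Equiv.Perm (Fin 4)} (hA : IsBistellarAt J W ν (.first 2) T c γ o ω)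
    (hB : IsBistellarAt J W ν .oppositeOne T' c' γ' o' ω') : OctahedronFlip T T' :=
  hA.replacePatch hW hB
    ![.inl 0, .inl 1, .inr 3, .inr 4] ![permOf ![1, 2, 0, 3], permOf ![1, 2, 3, 0], 1, 1]
    (by decide +kernel)
    ![.inr 2, .inr 1, .inl 1, .inl 0]
    ![permOf ![0, 1, 3, 2], permOf ![0, 1, 3, 2], permOf ![1, 2, 0, 3], permOf ![1, 2, 3, 0]]
    (by decide +kernel) (by decide +kernel) (by decide +kernel) (by decide +kernel)

theorem IsBistellarAt.pillowFlip {W : Fin 4 → κ} (hW : Function.Injective W)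
    {ν : Fin 4 → Equiv.Perm (Fin 4)} (hA : IsBistellarAt J W ν (.first 1) T c γ o ω)
    (hB : IsBistellarAt J W ν .adjacent T' c' γ' o' ω') : PillowFlip T T' :=
  hA.replacePatch hW hB
    ![.inr 3, .inl 0, .inl 1] ![1, 1, permOf ![1, 2, 3, 0]] (by decide +kernel)
    ![.inr 1, .inl 0, .inl 1] ![1, 1, permOf ![0, 2, 3, 1]] (by decide +kernel)
    (by decide +kernel) (by decide +kernel) (by decide +kernel)

theorem IsBistellarAt.prismFlipB {W : Fin 4 → κ} (hW : Function.Injective W)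
    {ν : Fin 4 → Equiv.Perm (Fin 4)} (hA : IsBistellarAt J W ν (.first 1) T c γ o ω)
    (hB : IsBistellarAt J W ν (.oppositeTwo (permOf ![2, 3, 0, 1])) T' c' γ' o' ω') :
    PrismFlipB T T' :=
  hA.replacePatch hW hB
    ![.inl 0, .inl 1, .inr 3]
    ![permOf ![3, 1, 0, 2], permOf ![3, 1, 0, 2], permOf ![1, 3, 2, 0]] (by decide +kernel)
    ![.inl 0, .inl 1, .inr 2]
    ![permOf ![3, 1, 0, 2], permOf ![3, 1, 0, 2], permOf ![1, 3, 2, 0]] (by decide +kernel)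
    (by decide +kernel) (by decide +kernel) (by decide +kernel)

theorem IsBistellarAt.prismFlipA {W : Fin 4 → κ} (hW : Function.Injective W)
    {ν : Fin 4 → Equiv.Perm (Fin 4)} (hA : IsBistellarAt J W ν (.first 1) T c γ o ω)
    (hB : IsBistellarAt J W ν (.oppositeTwo (permOf ![3, 2, 1, 0])) T' c' γ' o' ω') :
    PrismFlipA T T' :=
  hA.replacePatch hW hB
    ![.inl 1, .inl 0, .inr 3]
    ![permOf ![1, 3, 0, 2], permOf ![1, 3, 0, 2], permOf ![0, 2, 3, 1]] (by decide +kernel)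
    ![.inl 1, .inl 0, .inr 2]
    ![permOf ![1, 3, 0, 2], permOf ![1, 3, 0, 2], permOf ![0, 2, 3, 1]] (by decide +kernel)
    (by decide +kernel) (by decide +kernel) (by decide +kernel)

/-- If the two edges are opposite in two tetrahedra, the gluings around them determine how the
vertices of the second tetrahedron are ordered, up to four cases.  In two of them one of the results
contains a twisted tetrahedron; the other two give the two prism flips. -/
theorem IsBistellarAt.prismFlip {W : Fin 4 → κ} (hW : Function.Injective W)
    {ν : Fin 4 → Equiv.Perm (Fin 4)} {g : Equiv.Perm (Fin 4)}
    (hA : IsBistellarAt J W ν (.first 1) T c γ o ω)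
    (hB : IsBistellarAt J W ν (.oppositeTwo g) T' c' γ' o' ω')
    (hT : ∀ t s, ¬ T.IsTwisted t s) (hT' : ∀ t s, ¬ T'.IsTwisted t s) :
    PrismFlipA T T' ∨ PrismFlipB T T' := by
  have key : ∀ g, (EdgeFrame.first 1).Conflict (.oppositeTwo g) ∨
      g = permOf ![3, 2, 1, 0] ∨ g = permOf ![2, 3, 0, 1] ∨
      (EdgeFrame.first 1).TwistedAfter (.oppositeTwo g)
        (![.inl 0, .inl 1, .inr 3] : Fin 3 → Fin 2 ⊕ Fin 4) 1 1 ∨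
      (EdgeFrame.oppositeTwo g).TwistedAfter (.first 1)
        (![.inl 0, .inl 1, .inr 2] : Fin 3 → Fin 2 ⊕ Fin 4) 1 1 := by
    decide +kernel
  rcases (key g).resolve_left (hA.not_conflict hW hB) with rfl | rfl | h | h
  · exact .inl (hA.prismFlipA hW hB)
  · exact .inr (hA.prismFlipB hW hB)
  · obtain ⟨t, s, h⟩ := hA.isTwisted hW hB _ (by decide +kernel) 1 1 h
    exact absurd h (hT t s)
  · have e : (EdgeFrame.oppositeTwo g).Enumerates
        (![.inl 0, .inl 1, .inr 2] : Fin 3 → Fin 2 ⊕ Fin 4) :=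
      (by decide +kernel : (EdgeFrame.oppositeTwo 1).Enumerates
        (![.inl 0, .inl 1, .inr 2] : Fin 3 → Fin 2 ⊕ Fin 4))
    obtain ⟨t, s, h⟩ := hB.isTwisted hW hA _ e 1 1 h
    exact absurd h (hT' t s)

theorem IsBistellarAt.isomorphic_of_first {W : Fin 3 → κ} (hW : Function.Injective W)
    {ν : Fin 3 → Equiv.Perm (Fin 4)} (hA : IsBistellarAt J W ν (.first 0) T c γ o ω)
    (hB : IsBistellarAt J W ν (.first 0) T' c' γ' o' ω') : T.Isomorphic T' :=
  hA.isomorphic hW hB Sum.inl 1 (by decide +kernel) Sum.inl 1 (by decide +kernel)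
    (by decide +kernel)

theorem IsBistellarAt.isomorphic_of_adjacentAll {W : Fin 3 → κ} (hW : Function.Injective W)
    {ν : Fin 3 → Equiv.Perm (Fin 4)} {g : Equiv.Perm (Fin 4)}
    (hA : IsBistellarAt J W ν (.first 0) T c γ o ω)
    (hB : IsBistellarAt J W ν (.adjacentAll g) T' c' γ' o' ω') : T.Isomorphic T' := by
  have key : ∀ g, (EdgeFrame.first 0).Conflict (.adjacentAll g) ∨
      (EdgeFrame.first 0).SameAfter (.adjacentAll g) (Sum.inl : Fin 2 → Fin 2 ⊕ Fin 3) 1 Sum.inl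
        ![g, Equiv.swap 0 1] := by
    decide +kernel
  have e : (EdgeFrame.adjacentAll g).Enumerates (Sum.inl : Fin 2 → Fin 2 ⊕ Fin 3) :=
    (by decide +kernel : (EdgeFrame.adjacentAll 1).Enumerates (Sum.inl : Fin 2 → Fin 2 ⊕ Fin 3))
  exact hA.isomorphic hW hB Sum.inl 1 (by decide +kernel) Sum.inl _ e
    ((key g).resolve_left (hA.not_conflict hW hB))

/-- If the two edges are opposite in a tetrahedron, and the tetrahedra around them are the same,
then either one of the results contains a twisted tetrahedron, or the results are isomorphic. -/
theorem IsBistellarAt.isomorphic_of_oppositeAll {W : Fin 3 → κ} (hW : Function.Injective W)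
    {ν : Fin 3 → Equiv.Perm (Fin 4)} {g g' : Equiv.Perm (Fin 4)}
    (hA : IsBistellarAt J W ν (.first 0) T c γ o ω)
    (hB : IsBistellarAt J W ν (.oppositeAll g g') T' c' γ' o' ω')
    (hT : ∀ t s, ¬ T.IsTwisted t s) (hT' : ∀ t s, ¬ T'.IsTwisted t s) : T.Isomorphic T' := by
  -- The triples `r` list, over all admissible `g` and `g'`, how the two new tetrahedra of `T`
  -- correspond to those of `T'`: whether they are interchanged, and the reorderings of vertices.
  have key : ∀ g g', (EdgeFrame.first 0).Conflict (.oppositeAll g g') ∨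
      (∃ s ∈ [permOf ![0, 1, 3, 2], permOf ![0, 2, 1, 3]],
        (EdgeFrame.first 0).TwistedAfter (.oppositeAll g g')
          (Sum.inl : Fin 2 → Fin 2 ⊕ Fin 3) 0 s) ∨
      (∃ s ∈ [permOf ![0, 1, 3, 2], permOf ![0, 2, 1, 3]],
        (EdgeFrame.oppositeAll g g').TwistedAfter (.first 0)
          (fun j => .inl (j + 0) : Fin 2 → Fin 2 ⊕ Fin 3) 0 s) ∨
      ∃ r ∈ [((0, 1, 1) : Fin 2 × Equiv.Perm (Fin 4) × Equiv.Perm (Fin 4)),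
          (0, permOf ![0, 1, 3, 2], permOf ![0, 1, 3, 2]),
          (0, permOf ![1, 0, 3, 2], permOf ![3, 1, 2, 0]),
          (0, permOf ![3, 1, 2, 0], permOf ![2, 3, 0, 1]),
          (1, permOf ![3, 1, 2, 0], permOf ![1, 3, 0, 2]),
          (1, permOf ![2, 0, 3, 1], permOf ![3, 1, 2, 0])],
        (EdgeFrame.first 0).SameAfter (.oppositeAll g g') (Sum.inl : Fin 2 → Fin 2 ⊕ Fin 3) 1
          (fun j => .inl (j + r.1)) ![r.2.1, r.2.2] := by
    decide +kernel
  have e : ∀ k, (EdgeFrame.oppositeAll g g').Enumerates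
      (fun j => .inl (j + k) : Fin 2 → Fin 2 ⊕ Fin 3) :=
    (by decide +kernel : ∀ k, (EdgeFrame.oppositeAll 1 1).Enumerates
      (fun j => .inl (j + k) : Fin 2 → Fin 2 ⊕ Fin 3))
  rcases (key g g').resolve_left (hA.not_conflict hW hB) with ⟨s, -, h⟩ | ⟨s, -, h⟩ | ⟨r, -, h⟩
  · obtain ⟨t, s, h⟩ := hA.isTwisted hW hB _ (by decide +kernel) 0 s h
    exact absurd h (hT t s)
  · obtain ⟨t, s, h⟩ := hB.isTwisted hW hA _ (e 0) 0 s h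
    exact absurd h (hT' t s)
  · exact hA.isomorphic hW hB Sum.inl 1 (by decide +kernel) _ _ (e r.1) h

end Overlap


/-! ### Constructing the result of a 3-2 move -/

section Construction

variable {ι κ : Type}

/-- A gluing given by its map of flags, which sends the flags of a face to those of a face, and the
flag `(t, f, f)` of a face to a flag of the same kind. -/
def FaceGluing.ofFlagMap (G : TetFlag ι → TetFlag ι) (hG : Function.Involutive G)
    (hface : ∀ t f v, (G (t, f, v)).1 = (G (t, f, f)).1 ∧ (G (t, f, v)).2.1 = (G (t, f, f)).2.2)
    (hne : ∀ t f, G (t, f, f) ≠ (t, f, f)) : FaceGluing ι where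
  adj t f := (G (t, f, f)).1
  perm t f :=
    { toFun := fun v => (G (t, f, v)).2.2
      invFun := fun v => (G ((G (t, f, f)).1, (G (t, f, f)).2.2, v)).2.2
      left_inv := fun v => by
        change (G ((G (t, f, f)).1, (G (t, f, f)).2.2, (G (t, f, v)).2.2)).2.2 = v
        rw [← (hface t f v).1, ← (hface t f v).2, hG]
      right_inv := fun v => by
        generalize hx : G ((G (t, f, f)).1, (G (t, f, f)).2.2, v) = x
        have h1 := hface (G (t, f, f)).1 (G (t, f, f)).2.2 v
        have h2 : ((G (t, f, f)).1, (G (t, f, f)).2.2, (G (t, f, f)).2.2) = G (t, f, f) := by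
          rw [← (hface t f f).2]
          have := (hface t f f).2
          ext <;> simp [this]
        rw [h2, hG, hx] at h1
        have h3 : (t, f, x.2.2) = x := by ext <;> simp [h1]
        change (G (t, f, (G ((G (t, f, f)).1, (G (t, f, f)).2.2, v)).2.2)).2.2 = v
        rw [hx, h3, ← hx, hG] }
  adj_adj t f := by
    have h2 : ((G (t, f, f)).1, (G (t, f, f)).2.2, (G (t, f, f)).2.2) = G (t, f, f) := by
      have := (hface t f f).2
      ext <;> simp [this]
    simp [h2, hG (t, f, f)]
  perm_perm t f := by
    ext v
    rfl
  ne_self t f h := hne t f (by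
    have := (hface t f f).2
    have h' : (G (t, f, f)).1 = t ∧ (G (t, f, f)).2.2 = f := h
    ext <;> simp [this, h'])

theorem FaceGluing.flagGlue_ofFlagMap {G : TetFlag ι → TetFlag ι} (hG : Function.Involutive G)
    (hface : ∀ t f v, (G (t, f, v)).1 = (G (t, f, f)).1 ∧ (G (t, f, v)).2.1 = (G (t, f, f)).2.2)
    (hne : ∀ t f, G (t, f, f) ≠ (t, f, f)) (x : TetFlag ι) :
    (FaceGluing.ofFlagMap G hG hface hne).flagGlue x = G x := by
  obtain ⟨t, f, v⟩ := x
  have := hface t f v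
  ext
  · exact this.1.symm
  · exact congrArg Fin.val this.2.symm
  · rfl

theorem FaceGluing.flagGlue_face_ne (J : FaceGluing κ) (t : κ) (f : Fin 4) :
    J.flagGlue (t, f, f) ≠ (t, f, f) := by
  intro h
  simp only [FaceGluing.flagGlue, Prod.mk.injEq] at h
  exact J.ne_self t f ⟨h.1, h.2.1⟩

/-- The flag of the original gluing that corresponds to a flag of the gluing after a 3-2 move.  On
the common face of the two new tetrahedra the value has no meaning. -/
def ringFlag (b : Fin 3 → κ) (β : Fin 3 → Equiv.Perm (Fin 4)) :
    TetFlag (Fin 2 ⊕ (Set.range b)ᶜ.Elem) → TetFlag κ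
  | (.inl j, f, v) => (edgeFlag (j, f, v)).place b β
  | (.inr k, f, v) => (k, f, v)

/-- The flag belongs to the common face of the two tetrahedra made by a 3-2 move. -/
def IsDisk {ρ : Type} (x : TetFlag (Fin 2 ⊕ ρ)) : Prop := x.1.isLeft ∧ x.2.1 = 0

theorem edgeFlag_injective : ∀ x y : TetFlag (Fin 2), x.2.1 ≠ 0 ∧ y.2.1 ≠ 0 ∧
    edgeFlag x = edgeFlag y → x = y := by
  decide +kernel

/-- Whenever three different tetrahedra surround an edge, the 3-2 move can be performed. -/
theorem exists_reduces_of_ring {J : FaceGluing κ} {b : Fin 3 → κ} (hb : Function.Injective b)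
    {β : Fin 3 → Equiv.Perm (Fin 4)}
    (ring : ∀ x : TetFlag (Fin 3), x.2.1 = 2 →
      J.flagGlue (x.place b β) = (ringNext x).place b β) :
    ∃ S : FaceGluing (Fin 2 ⊕ (Set.range b)ᶜ.Elem), Reduces J b β S := by
  -- the flags inside the union of the three tetrahedra
  let Inner : TetFlag κ → Prop := fun y => ∃ x : TetFlag (Fin 3), 2 ≤ x.2.1 ∧ y = x.place b β
  have hinner : ∀ y, Inner y → Inner (J.flagGlue y) := by
    rintro _ ⟨⟨i, f, v⟩, hf, rfl⟩
    have key : ∀ f : Fin 4, 2 ≤ f → f = 2 ∨ f = 3 := by decide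
    have := key f hf
    rcases this with rfl | rfl
    · exact ⟨_, (by decide : (2 : Fin 4) ≤ 3), ring (i, 2, v) rfl⟩
    · refine ⟨(i - 1, 2, Equiv.swap 2 3 v), le_rfl, ?_⟩
      rw [J.flagGlue_eq_iff, ring _ rfl]
      simp [ringNext]
  have hinner' : ∀ y, ¬ Inner y → ¬ Inner (J.flagGlue y) := fun y hy h => hy (by
    have := hinner _ h
    rwa [J.flagGlue_flagGlue] at this)
  have hout : ∀ x, ¬ IsDisk x → ¬ Inner (ringFlag b β x) := by
    rintro ⟨j | k, f, v⟩ hx ⟨x, hx2, e⟩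
    · have e := TetFlag.place_injective hb β e
      have key : ∀ y : TetFlag (Fin 2), y.2.1 ≠ 0 → ¬ 2 ≤ (edgeFlag y).2.1 := by decide
      exact key (j, f, v) (fun h => hx ⟨rfl, h⟩) (by rw [e]; exact hx2)
    · exact k.2 ⟨x.1, (congrArg Prod.fst e).symm⟩
  have hsurj : ∀ y, ¬ Inner y → ∃ x, ¬ IsDisk x ∧ ringFlag b β x = y := by
    rintro ⟨t, f, v⟩ hy
    by_cases ht : t ∈ Set.range b
    · obtain ⟨i, rfl⟩ := ht
      have key : ∀ y : TetFlag (Fin 3), ¬ 2 ≤ y.2.1 →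
          ∃ x : TetFlag (Fin 2), x.2.1 ≠ 0 ∧ edgeFlag x = y := by decide
      obtain ⟨x, hx, e⟩ := key (i, (β i)⁻¹ f, (β i)⁻¹ v) fun h =>
        hy ⟨_, h, by simp [TetFlag.place]⟩
      refine ⟨(.inl x.1, x.2.1, x.2.2), fun h => hx h.2, ?_⟩
      simp [ringFlag, e, TetFlag.place]
    · exact ⟨(.inr ⟨t, ht⟩, f, v), fun h => by simpa [IsDisk] using h.1, rfl⟩
  have hinj : ∀ x y, ¬ IsDisk x → ¬ IsDisk y → ringFlag b β x = ringFlag b β y → x = y := by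
    rintro ⟨j | k, f, v⟩ ⟨j' | k', f', v'⟩ hx hy e
    · have e := TetFlag.place_injective hb β e
      have := edgeFlag_injective (j, f, v) (j', f', v')
        ⟨fun h => hx ⟨rfl, h⟩, fun h => hy ⟨rfl, h⟩, e⟩
      simp only [Prod.mk.injEq] at this ⊢
      exact ⟨by rw [this.1], this.2⟩
    · exact absurd ⟨_, congrArg Prod.fst e⟩ k'.2
    · exact absurd ⟨_, (congrArg Prod.fst e).symm⟩ k.2
    · simp only [ringFlag, Prod.mk.injEq] at e ⊢
      exact ⟨by rw [Subtype.ext e.1], e.2⟩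
  choose G hG using fun x (hx : ¬ IsDisk x) => hsurj _ (hinner' _ (hout x hx))
  classical
  let G' : TetFlag (Fin 2 ⊕ (Set.range b)ᶜ.Elem) → TetFlag (Fin 2 ⊕ (Set.range b)ᶜ.Elem) :=
    fun x => if hx : IsDisk x then (x.1.map (· + 1) id, x.2) else G x hx
  have hG1 : ∀ x, IsDisk x → G' x = (x.1.map (· + 1) id, x.2) := fun x hx => dif_pos hx
  have hG2 : ∀ x, ¬ IsDisk x →
      ¬ IsDisk (G' x) ∧ ringFlag b β (G' x) = J.flagGlue (ringFlag b β x) := fun x hx => by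
    simpa only [G', dif_neg hx] using hG x hx
  have hinv : Function.Involutive G' := by
    intro x
    by_cases hx : IsDisk x
    · obtain ⟨j | k, f, v⟩ := x
      · rw [hG1 _ hx]
        have : ∀ j : Fin 2, j + 1 + 1 = j := by decide
        refine (hG1 (.inl (j + 1), f, v) ⟨rfl, hx.2⟩).trans ?_
        simp [this]
      · simpa using hx.1
    · have h1 := hG2 x hx
      have h2 := hG2 _ h1.1
      refine hinj _ _ h2.1 hx ?_
      rw [h2.2, h1.2, J.flagGlue_flagGlue]
  -- flags of the same face correspond to flags of the same face
  have hsame : ∀ t f v, ¬ IsDisk (t, f, v) →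
      (G' (t, f, v)).1 = (G' (t, f, f)).1 ∧ (G' (t, f, v)).2.1 = (G' (t, f, f)).2.2 := by
    intro t f v hx
    have hx' : ¬ IsDisk (t, f, f) := hx
    obtain ⟨h1, h2⟩ := hG2 _ hx
    obtain ⟨h3, h4⟩ := hG2 _ hx'
    have e : (ringFlag b β (t, f, v)).1 = (ringFlag b β (t, f, f)).1 ∧
        (ringFlag b β (t, f, v)).2.1 = (ringFlag b β (t, f, f)).2.1 ∧
        (ringFlag b β (t, f, f)).2.1 = (ringFlag b β (t, f, f)).2.2 := by
      rcases t with j | k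
      · exact ⟨rfl, rfl, rfl⟩
      · exact ⟨rfl, rfl, rfl⟩
    have e' : (ringFlag b β (G' (t, f, v))).1 = (ringFlag b β (G' (t, f, f))).1 ∧
        (ringFlag b β (G' (t, f, v))).2.1 = (ringFlag b β (G' (t, f, f))).2.2 ∧
        (ringFlag b β (G' (t, f, f))).2.1 = (ringFlag b β (G' (t, f, f))).2.2 := by
      rw [h2, h4]
      simp only [FaceGluing.flagGlue, e.1, e.2.1, ← e.2.2, and_self]
    revert h1 h3 e'
    generalize G' (t, f, v) = x
    generalize G' (t, f, f) = y
    clear * - hb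
    intro hx hy e
    obtain ⟨j | k, f, v⟩ := x <;> obtain ⟨j' | k', f', v'⟩ := y
    · have key : ∀ x y : TetFlag (Fin 2), x.2.1 ≠ 0 → y.2.1 ≠ 0 →
          (edgeFlag x).1 = (edgeFlag y).1 → (edgeFlag x).2.1 = (edgeFlag y).2.2 →
          (edgeFlag y).2.1 = (edgeFlag y).2.2 → x.1 = y.1 ∧ x.2.1 = y.2.2 := by decide
      obtain ⟨e1, e2, e3⟩ := e
      have e1 := hb e1
      simp only [ringFlag, TetFlag.place, EmbeddingLike.apply_eq_iff_eq] at e2 e3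
      rw [e1, EmbeddingLike.apply_eq_iff_eq] at e2
      have := key (j, f, v) (j', f', v') (fun h => hx ⟨rfl, h⟩) (fun h => hy ⟨rfl, h⟩) e1 e2 e3
      exact ⟨congrArg Sum.inl this.1, this.2⟩
    · exact absurd ⟨_, e.1⟩ k'.2
    · exact absurd ⟨_, e.1.symm⟩ k.2
    · exact ⟨congrArg Sum.inr (Subtype.ext e.1), e.2.1⟩
  have hface : ∀ t f v, (G' (t, f, v)).1 = (G' (t, f, f)).1 ∧
      (G' (t, f, v)).2.1 = (G' (t, f, f)).2.2 := by
    intro t f v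
    by_cases hx : IsDisk (t, f, v)
    · have hx' : IsDisk (t, f, f) := hx
      rw [hG1 _ hx, hG1 _ hx']
      exact ⟨rfl, rfl⟩
    · exact hsame t f v hx
  have hne : ∀ t f, G' (t, f, f) ≠ (t, f, f) := by
    intro t f h
    by_cases hx : IsDisk (t, f, f)
    · rw [hG1 _ hx] at h
      rcases t with j | k
      · have key : ∀ j : Fin 2, j + 1 ≠ j := by decide
        exact key j (Sum.inl_injective (congrArg Prod.fst h))
      · simpa using hx.1
    · have h2 := (hG2 _ hx).2
      rw [h] at h2
      rcases t with j | k
      · exact J.flagGlue_face_ne _ _ h2.symm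
      · exact J.flagGlue_face_ne _ _ h2.symm
  let S := FaceGluing.ofFlagMap G' hinv hface hne
  have hS : ∀ x, S.flagGlue x = G' x := FaceGluing.flagGlue_ofFlagMap hinv hface hne
  let o : κ → Fin 2 ⊕ (Set.range b)ᶜ.Elem := fun k =>
    if h : k ∈ (Set.range b)ᶜ then .inr ⟨k, h⟩ else .inl 0
  have ho : ∀ k (h : k ∈ (Set.range b)ᶜ), o k = .inr ⟨k, h⟩ := fun k h => dif_pos h
  refine ⟨S, Sum.inl, fun _ => 1, o, fun _ => 1, hb,
    ⟨Sum.inl_injective, fun k hk l hl e => ?_, fun i k hk e => ?_, fun t => ?_⟩, ring, ?_, ?_⟩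
  · rw [ho k hk, ho l hl] at e
    exact congrArg Subtype.val (Sum.inr_injective e)
  · rw [ho k hk] at e
    simp at e
  · rcases t with j | k
    · exact .inl ⟨j, rfl⟩
    · exact .inr ⟨k, k.2, ho k k.2⟩
  · intro x hx
    rw [hS]
    exact hG1 _ ⟨rfl, hx⟩ |>.trans (by simp [TetFlag.place, hx])
  · have corr : ∀ x x', BistellarCorr b β Sum.inl (fun _ => 1) o (fun _ => 1) x x' →
        ¬ IsDisk x ∧ ringFlag b β x = x' := by
      intro x x' h
      cases h with
      | outside _ hz h =>
        obtain ⟨k, f, v⟩ := x'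
        have : o k = .inr ⟨k, h⟩ := ho k h
        simp [TetFlag.place, this, IsDisk, ringFlag]
      | boundary x hx h => exact ⟨fun e => h e.2, rfl⟩
    intro x y x' y' hx hy
    obtain ⟨hx', rfl⟩ := corr _ _ hx
    obtain ⟨hy', rfl⟩ := corr _ _ hy
    obtain ⟨h1, h2⟩ := hG2 x hx'
    rw [hS, ← h2]
    exact ⟨fun e => by rw [e], hinj _ _ h1 hy'⟩

end Construction


/-! ### Moves at edges without common tetrahedra -/

section Disjoint

variable {ι ι' ι'' κ : Type}

theorem ReplacePatch.trans_isomorphic {p q : ℕ} {L : Type} {P : Patch p L} {Q : Patch q L}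
    {T : FaceGluing ι} {T' : FaceGluing ι'} {T'' : FaceGluing ι''} (h : ReplacePatch P Q T T')
    (e : T'.Isomorphic T'') : ReplacePatch P Q T T'' := by
  obtain ⟨ρ, S, S', h1, h2, h3⟩ := h
  exact ⟨ρ, S, S', h1, h2.trans e, h3⟩

theorem FaceGluing.Isomorphic.trans_replacePatch {p q : ℕ} {L : Type} {P : Patch p L}
    {Q : Patch q L} {T : FaceGluing ι} {T' : FaceGluing ι'} {T'' : FaceGluing ι''}
    (e : T.Isomorphic T') (h : ReplacePatch P Q T' T'') : ReplacePatch P Q T T'' := by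
  obtain ⟨ρ, S, S', h1, h2, h3⟩ := h
  exact ⟨ρ, S, S', e.trans h1, h2, h3⟩

/-- The tetrahedra around an edge still surround an edge after a 3-2 move at tetrahedra different
from them. -/
theorem IsBistellar.ring_outside {J : FaceGluing κ} {a b : Fin 3 → κ}
    {α β : Fin 3 → Equiv.Perm (Fin 4)} {T : FaceGluing ι} {c : Fin 2 → ι}
    {γ : Fin 2 → Equiv.Perm (Fin 4)} {o : κ → ι} {ω : κ → Equiv.Perm (Fin 4)}
    (hA : IsBistellar J a α T c γ o ω) (hab : ∀ i, b i ∉ Set.range a)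
    (ring : ∀ x : TetFlag (Fin 3), x.2.1 = 2 →
      J.flagGlue (x.place b β) = (ringNext x).place b β) (x : TetFlag (Fin 3)) (hx : x.2.1 = 2) :
    T.flagGlue (x.place (fun i => o (b i)) (fun i => ω (b i) * β i)) =
      (ringNext x).place (fun i => o (b i)) (fun i => ω (b i) * β i) := by
  have key : ∀ i v, v ≠ 2 →
      T.flagGlue (TetFlag.place (fun i => o (b i)) (fun i => ω (b i) * β i) (i, 2, v)) =
        (ringNext (i, 2, v)).place (fun i => o (b i)) (fun i => ω (b i) * β i) := by
    intro i v hv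
    have h := ring (i, 2, v) rfl
    refine (hA.compat _ _ _ _ (.outside _ ?_ (hab i)) (.outside _ ?_ (hab (i + 1)))).2 h
    · simpa [TetFlag.place] using hv
    · have : ∀ v : Fin 4, v ≠ 2 → Equiv.swap 2 3 v ≠ 3 := by decide
      simpa [TetFlag.place, ringNext] using this v hv
  obtain ⟨i, f, v⟩ := x
  obtain rfl : f = 2 := hx
  by_cases hv : v = 2
  · subst hv
    have := T.flagGlue_face (key i 0 (by decide))
    simpa [ringNext, TetFlag.place] using this
  · exact key i v hv

theorem BistellarCorr.not_disk {J : FaceGluing κ} {a : Fin 3 → κ}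
    {α : Fin 3 → Equiv.Perm (Fin 4)} {T : FaceGluing ι} {c : Fin 2 → ι}
    {γ : Fin 2 → Equiv.Perm (Fin 4)} {o : κ → ι} {ω : κ → Equiv.Perm (Fin 4)}
    (hA : IsBistellar J a α T c γ o ω) {x : TetFlag ι} {z : TetFlag κ}
    (h : BistellarCorr a α c γ o ω x z) {X : TetFlag (Fin 2)} (hX : X.2.1 = 0) :
    x ≠ X.place c γ := by
  intro e
  cases h with
  | outside _ hz h =>
    exact hA.part.ne X.1 z.1 h (congrArg Prod.fst e).symm
  | boundary Y hY h0 =>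
    have := TetFlag.place_injective hA.part.left_inj γ e
    exact h0 (this ▸ hX)

/-- Moves at edges surrounded by different tetrahedra commute. -/
theorem Reduces.commute {J : FaceGluing κ} {a b : Fin 3 → κ} {α β : Fin 3 → Equiv.Perm (Fin 4)}
    {T : FaceGluing ι} {T' : FaceGluing ι'} (hA : Reduces J a α T) (hB : Reduces J b β T')
    (hab : ∀ i j, b j ≠ a i) :
    ∃ (a₁ : Fin 3 → ι') (α₁ : Fin 3 → Equiv.Perm (Fin 4)) (b₁ : Fin 3 → ι)
      (β₁ : Fin 3 → Equiv.Perm (Fin 4)) (S : FaceGluing (Fin 2 ⊕ (Set.range b₁)ᶜ.Elem)),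
      Reduces T b₁ β₁ S ∧ Reduces T' a₁ α₁ S := by
  obtain ⟨c, γ, o, ω, hA⟩ := hA
  obtain ⟨c', γ', o', ω', hB⟩ := hB
  have hba : ∀ j, b j ∉ Set.range a := by rintro j ⟨i, hi⟩; exact hab i j hi.symm
  have hab : ∀ i, a i ∉ Set.range b := by rintro i ⟨j, hj⟩; exact hab i j hj
  have hb₁ : Function.Injective fun j => o (b j) := fun i j e =>
    hB.inj (hA.part.right_inj (hba i) (hba j) e)
  obtain ⟨S, hS⟩ := exists_reduces_of_ring hb₁ (hA.ring_outside hba hB.ring)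
  refine ⟨fun i => o' (a i), fun i => ω' (a i) * α i, _, _, S, hS, ?_⟩
  obtain ⟨c₂, γ₂, o₂, ω₂, hS⟩ := hS
  -- tetrahedra of `T` outside the second edge
  have hc : ∀ j, c j ∉ Set.range fun j => o (b j) := by
    rintro j ⟨i, hi⟩
    exact hA.part.ne j _ (hba i) hi.symm
  have ho : ∀ k, k ∉ Set.range a → k ∉ Set.range b → o k ∉ Set.range fun j => o (b j) := by
    rintro k hk hkb ⟨i, hi⟩
    exact hkb ⟨i, hA.part.right_inj (hba i) hk hi⟩
  let o₃ : ι' → _ := fun t => Sum.elim c₂ (fun k => o₂ (o k.1)) (hB.part.equiv.symm t)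
  let ω₃ : ι' → Equiv.Perm (Fin 4) := fun t =>
    Sum.elim (fun j => γ₂ j * (γ' j)⁻¹) (fun k => ω₂ (o k.1) * ω k.1 * (ω' k.1)⁻¹)
      (hB.part.equiv.symm t)
  have e1 : ∀ j, hB.part.equiv.symm (c' j) = .inl j := fun j =>
    hB.part.equiv.symm_apply_eq.2 rfl
  have e2 : ∀ k (hk : k ∉ Set.range b), hB.part.equiv.symm (o' k) = .inr ⟨k, hk⟩ := fun k hk =>
    hB.part.equiv.symm_apply_eq.2 rfl
  have ho1 : ∀ j, o₃ (c' j) = c₂ j := fun j => by simp [o₃, e1]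
  have ho2 : ∀ k, k ∉ Set.range b → o₃ (o' k) = o₂ (o k) := fun k hk => by simp [o₃, e2 k hk]
  have hω1 : ∀ j, ω₃ (c' j) = γ₂ j * (γ' j)⁻¹ := fun j => by simp [ω₃, e1]
  have hω2 : ∀ k, k ∉ Set.range b → ω₃ (o' k) = ω₂ (o k) * ω k * (ω' k)⁻¹ := fun k hk => by
    simp [ω₃, e2 k hk]
  have out : ∀ t ∉ Set.range (fun i => o' (a i)),
      (∃ j, t = c' j) ∨ ∃ k, k ∉ Set.range a ∧ k ∉ Set.range b ∧ t = o' k := by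
    intro t ht
    rcases hB.part.cover t with ⟨j, rfl⟩ | ⟨k, hk, rfl⟩
    · exact .inl ⟨j, rfl⟩
    · refine .inr ⟨k, ?_, hk, rfl⟩
      rintro ⟨i, rfl⟩
      exact ht ⟨i, rfl⟩
  have corr : ∀ x x', BistellarCorr (fun i => o' (a i)) (fun i => ω' (a i) * α i)
      (fun j => o₂ (c j)) (fun j => ω₂ (c j) * γ j) o₃ ω₃ x x' →
      (∃ y z, BistellarCorr (fun j => o (b j)) (fun j => ω (b j) * β j) c₂ γ₂ o₂ ω₂ x y ∧
        BistellarCorr a α c γ o ω y z ∧ BistellarCorr b β c' γ' o' ω' x' z) ∨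
      ∃ X : TetFlag (Fin 2), X.2.1 = 0 ∧ x = X.place c₂ γ₂ ∧ x' = X.place c' γ' := by
    intro x x' h
    cases h with
    | outside _ hz h =>
      obtain ⟨t, f, v⟩ := x'
      have hz : v ≠ f := hz
      rcases out t h with ⟨j, rfl⟩ | ⟨k, hk, hkb, rfl⟩
      · have ex : TetFlag.place o₃ ω₃ (c' j, f, v) =
            TetFlag.place c₂ γ₂ (j, (γ' j)⁻¹ f, (γ' j)⁻¹ v) := by
          simp [TetFlag.place, ho1, hω1]
        have ex' : (c' j, f, v) = TetFlag.place c' γ' (j, (γ' j)⁻¹ f, (γ' j)⁻¹ v) := by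
          simp [TetFlag.place]
        rw [ex, ex']
        by_cases h0 : (γ' j)⁻¹ f = 0
        · exact .inr ⟨_, h0, rfl, rfl⟩
        · have hv : (γ' j)⁻¹ v ≠ (γ' j)⁻¹ f := fun e => hz ((γ' j)⁻¹.injective e)
          refine .inl ⟨_, _, .boundary _ hv h0, .outside ((edgeFlag _).place b β) ?_ (hba _),
            .boundary _ hv h0⟩
          exact fun e => edgeFlag_corner (j, (γ' j)⁻¹ f, (γ' j)⁻¹ v) hv h0 ((β _).injective e)
      · have ex : TetFlag.place o₃ ω₃ (o' k, f, v) = TetFlag.place o₂ ω₂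
            (TetFlag.place o ω (k, (ω' k)⁻¹ f, (ω' k)⁻¹ v)) := by
          simp [TetFlag.place, ho2 k hkb, hω2 k hkb]
        have ex' : (o' k, f, v) = TetFlag.place o' ω' (k, (ω' k)⁻¹ f, (ω' k)⁻¹ v) := by
          simp [TetFlag.place]
        have hv : (ω' k)⁻¹ v ≠ (ω' k)⁻¹ f := fun e => hz ((ω' k)⁻¹.injective e)
        rw [ex, ex']
        refine .inl ⟨_, _, .outside _ ?_ (ho k hk hkb), .outside _ hv hk, .outside _ hv hkb⟩
        exact fun e => hv ((ω k).injective e)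
    | boundary X hX h0 =>
      refine .inl ⟨_, _, .outside (X.place c γ) ?_ (hc _), .boundary X hX h0,
        .outside ((edgeFlag X).place a α) ?_ (hab _)⟩
      · exact fun e => hX ((γ _).injective e)
      · exact fun e => edgeFlag_corner X hX h0 ((α _).injective e)
  refine ⟨fun j => o₂ (c j), fun j => ω₂ (c j) * γ j, o₃, ω₃, ?_, ⟨?_, ?_, ?_, ?_⟩, ?_, ?_, ?_⟩
  · exact fun i j e => hA.inj (hB.part.right_inj (hab i) (hab j) e)
  · exact fun i j e => hA.part.left_inj (hS.part.right_inj (hc i) (hc j) e)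
  · intro t ht t' ht' e
    rcases out t ht with ⟨j, rfl⟩ | ⟨k, hk, hkb, rfl⟩ <;>
      rcases out t' ht' with ⟨j', rfl⟩ | ⟨k', hk', hkb', rfl⟩
    · rw [ho1, ho1] at e
      rw [hS.part.left_inj e]
    · rw [ho1, ho2 k' hkb'] at e
      exact absurd e (hS.part.ne _ _ (ho k' hk' hkb'))
    · rw [ho1, ho2 k hkb] at e
      exact absurd e.symm (hS.part.ne _ _ (ho k hk hkb))
    · rw [ho2 k hkb, ho2 k' hkb'] at e
      rw [hA.part.right_inj hk hk' (hS.part.right_inj (ho k hk hkb) (ho k' hk' hkb') e)]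
  · intro i t ht e
    rcases out t ht with ⟨j, rfl⟩ | ⟨k, hk, hkb, rfl⟩
    · rw [ho1] at e
      exact hS.part.ne _ _ (hc i) e.symm
    · rw [ho2 k hkb] at e
      exact hA.part.ne _ _ hk (hS.part.right_inj (hc i) (ho k hk hkb) e)
  · intro s
    rcases hS.part.cover s with ⟨j, rfl⟩ | ⟨t, ht, rfl⟩
    · refine .inr ⟨c' j, ?_, ho1 j⟩
      rintro ⟨i, hi⟩
      exact hB.part.ne j _ (hab i) hi.symm
    · rcases hA.part.cover t with ⟨j, rfl⟩ | ⟨k, hk, rfl⟩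
      · exact .inl ⟨j, rfl⟩
      · have hkb : k ∉ Set.range b := by
          rintro ⟨j, rfl⟩
          exact ht ⟨j, rfl⟩
        refine .inr ⟨o' k, ?_, ho2 k hkb⟩
        rintro ⟨i, hi⟩
        exact hk ⟨i, hB.part.right_inj (hab i) hkb hi⟩
  · exact hB.ring_outside hab hA.ring
  · have key : ∀ j v, v ≠ 0 → S.flagGlue (TetFlag.place o₂ ω₂ (TetFlag.place c γ (j, 0, v))) =
        TetFlag.place o₂ ω₂ (TetFlag.place c γ (j + 1, 0, v)) := by
      intro j v hv
      have h := hA.disk (j, 0, v) rfl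
      refine (hS.compat _ _ _ _ (.outside _ ?_ (hc j)) (.outside _ ?_ (hc (j + 1)))).2 h
      · simpa [TetFlag.place] using hv
      · simpa [TetFlag.place] using hv
    rintro ⟨j, f, v⟩ hf
    obtain rfl : f = 0 := hf
    by_cases hv : v = 0
    · subst hv
      exact S.flagGlue_face (key j 1 (by decide))
    · exact key j v hv
  · intro x y x' y' hx hy
    rcases corr _ _ hx with ⟨x₁, x₂, h1, h2, h3⟩ | ⟨X, hX, rfl, rfl⟩ <;>
      rcases corr _ _ hy with ⟨y₁, y₂, h4, h5, h6⟩ | ⟨Y, hY, rfl, rfl⟩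
    · rw [hS.compat _ _ _ _ h1 h4, hA.compat _ _ _ _ h2 h5, hB.compat _ _ _ _ h3 h6]
    · rw [S.flagGlue_eq_iff, T'.flagGlue_eq_iff, hS.disk Y hY, hB.disk Y hY]
      exact iff_of_false (h1.not_disk hS rfl).symm (h3.not_disk hB rfl).symm
    · rw [hS.disk X hX, hB.disk X hX]
      exact iff_of_false (h4.not_disk hS rfl).symm (h6.not_disk hB rfl).symm
    · rw [hS.disk X hX, hB.disk X hX, (TetFlag.place_injective hS.part.left_inj γ₂).eq_iff,
        (TetFlag.place_injective hB.part.left_inj γ').eq_iff]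

end Disjoint


/-! ### Moves at edges with common tetrahedra -/

section Common

variable {ι ι' κ : Type} {J : FaceGluing κ} {a b : Fin 3 → κ} {α β : Fin 3 → Equiv.Perm (Fin 4)}
  {T : FaceGluing ι} {T' : FaceGluing ι'}

theorem Reduces.isBistellarAt {d : ℕ} (h : Reduces J a α T) {W : Fin d → κ}
    {ν : Fin d → Equiv.Perm (Fin 4)} {A : EdgeFrame d} (hW : ∀ i, W (A.tet i) = a i)
    (hν : ∀ i, ν (A.tet i) * A.frame i = α i) :
    ∃ c γ o ω, IsBistellarAt J W ν A T c γ o ω := by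
  obtain rfl : (fun i => W (A.tet i)) = a := funext hW
  obtain rfl : (fun i => ν (A.tet i) * A.frame i) = α := funext hν
  exact h

/-- If the axes of two bipyramids lie in a common face of two tetrahedra that both contain, then
both also contain the tetrahedron on the other side of that face. -/
theorem Reduces.pred_eq (hA : Reduces J a α T) (hB : Reduces J b β T') (i : Fin 3)
    {τ : Equiv.Perm (Fin 4)} (hτ : τ 3 = 3) (h : b (i + 1) = a (i + 1))
    (hβ : β (i + 1) = α (i + 1) * τ) :
    b i = a i ∧ β i = α i * (Equiv.swap 2 3 * τ * Equiv.swap 2 3) := by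
  have key : ∀ v, (b i, β i 2, β i (Equiv.swap 2 3 v)) =
      (a i, α i 2, α i (Equiv.swap 2 3 (τ v))) := by
    intro v
    rw [← hB.flagGlue_three, ← hA.flagGlue_three, h, hβ, Equiv.Perm.mul_apply, hτ,
      Equiv.Perm.mul_apply]
  refine ⟨congrArg Prod.fst (key 0), ?_⟩
  ext1 v
  have := congrArg (fun x => x.2.2) (key (Equiv.swap 2 3 v))
  simpa using this

theorem Reduces.isomorphic_of_eq (hA : Reduces J a α T) (hB : Reduces J b β T')
    (h : b 0 = a 0) (hβ : β 0 = α 0) : T.Isomorphic T' := by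
  have h2 := hA.pred_eq hB 2 (τ := 1) rfl h (by rw [mul_one]; exact hβ)
  have h1 := hA.pred_eq hB 1 (τ := 1) rfl h2.1 (h2.2.trans (by simp))
  simp only [mul_one, Equiv.swap_mul_self] at h1 h2
  have hb : b = a := by
    funext i
    fin_cases i
    exacts [h, h1.1, h2.1]
  have hβ' : β = α := by
    funext i
    fin_cases i
    exacts [hβ, h1.2, h2.2]
  subst hb hβ'
  obtain ⟨c, γ, o, ω, hA'⟩ := hA.isBistellarAt (A := .first 0) (W := b) (ν := β)
    (fun _ => rfl) (fun i => mul_one (β i))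
  obtain ⟨c', γ', o', ω', hB'⟩ := hB.isBistellarAt (A := .first 0) (W := b) (ν := β)
    (fun _ => rfl) (fun i => mul_one (β i))
  exact hA'.isomorphic_of_first hA.injective hB'

/-- The case that the edges lie in a common face of a common tetrahedron. -/
theorem Reduces.of_adjacent (hA : Reduces J a α T) (hB : Reduces J b β T')
    (h : b 0 = a 0) (hβ : β 0 = α 0 * Equiv.swap 1 2) : T.Isomorphic T' ∨ PillowFlip T T' := by
  obtain ⟨h2, hβ2⟩ := hA.pred_eq hB 2 (by decide) h hβ
  have e : (Equiv.swap 2 3 * Equiv.swap 1 2 * Equiv.swap 2 3 : Equiv.Perm (Fin 4)) =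
    Equiv.swap 1 3 := by decide
  rw [e] at hβ2
  have hb := hB.injective
  by_cases h1 : b 1 = a 1
  · left
    obtain ⟨c, γ, o, ω, hA'⟩ := hA.isBistellarAt (A := .first 0) (W := a) (ν := α)
      (fun _ => rfl) (fun i => mul_one (α i))
    obtain ⟨c', γ', o', ω', hB'⟩ := hB.isBistellarAt (A := .adjacentAll ((α 1)⁻¹ * β 1))
      (W := a) (ν := α)
      (by intro i; fin_cases i; exacts [h.symm, h1.symm, h2.symm])
      (by intro i; fin_cases i; exacts [hβ.symm, mul_inv_cancel_left _ _, hβ2.symm])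
    exact hA'.isomorphic_of_adjacentAll hA.injective hB'
  · right
    have h1' : ∀ i, a i ≠ b 1 := by
      intro i e
      fin_cases i
      · exact absurd (hb (h.trans e)) (by decide)
      · exact h1 e.symm
      · exact absurd (hb (h2.trans e)) (by decide)
    have hW : Function.Injective (Fin.append a fun _ : Fin 1 => b 1) :=
      Fin.append_injective_iff.2 ⟨hA.injective, Function.injective_of_subsingleton _,
        fun i _ => h1' i⟩
    obtain ⟨c, γ, o, ω, hA'⟩ := hA.isBistellarAt (A := .first 1)
      (W := Fin.append a fun _ : Fin 1 => b 1) (ν := Fin.append α fun _ : Fin 1 => β 1)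
      (by intro i; fin_cases i <;> rfl) (by intro i; fin_cases i <;> exact mul_one _)
    obtain ⟨c', γ', o', ω', hB'⟩ := hB.isBistellarAt (A := .adjacent)
      (W := Fin.append a fun _ : Fin 1 => b 1) (ν := Fin.append α fun _ : Fin 1 => β 1)
      (by intro i; fin_cases i; exacts [h.symm, rfl, h2.symm])
      (by intro i; fin_cases i; exacts [hβ.symm, mul_one _, hβ2.symm])
    exact hA'.pillowFlip hW hB'

/-- The case that the edges are opposite in two of the common tetrahedra. -/
theorem Reduces.of_opposite_two (hA : Reduces J a α T) (hB : Reduces J b β T')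
    (hT : ∀ t s, ¬ T.IsTwisted t s) (hT' : ∀ t s, ¬ T'.IsTwisted t s)
    (h : b 0 = a 0) (hβ : β 0 = α 0 * oppositeEdge) (h1 : b 1 = a 1) :
    T.Isomorphic T' ∨ PrismFlipA T T' ∨ PrismFlipB T T' := by
  have hb := hB.injective
  by_cases h2 : b 2 = a 2
  · left
    obtain ⟨c, γ, o, ω, hA'⟩ := hA.isBistellarAt (A := .first 0) (W := a) (ν := α)
      (fun _ => rfl) (fun i => mul_one (α i))
    obtain ⟨c', γ', o', ω', hB'⟩ := hB.isBistellarAt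
      (A := .oppositeAll ((α 1)⁻¹ * β 1) ((α 2)⁻¹ * β 2)) (W := a) (ν := α)
      (by intro i; fin_cases i; exacts [h.symm, h1.symm, h2.symm])
      (by
        intro i; fin_cases i
        exacts [hβ.symm, mul_inv_cancel_left _ _, mul_inv_cancel_left _ _])
    exact hA'.isomorphic_of_oppositeAll hA.injective hB' hT hT'
  · right
    have h2' : ∀ i, a i ≠ b 2 := by
      intro i e
      fin_cases i
      · exact absurd (hb (h.trans e)) (by decide)
      · exact absurd (hb (h1.trans e)) (by decide)
      · exact h2 e.symm
    have hW : Function.Injective (Fin.append a fun _ : Fin 1 => b 2) :=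
      Fin.append_injective_iff.2 ⟨hA.injective, Function.injective_of_subsingleton _,
        fun i _ => h2' i⟩
    obtain ⟨c, γ, o, ω, hA'⟩ := hA.isBistellarAt (A := .first 1)
      (W := Fin.append a fun _ : Fin 1 => b 2) (ν := Fin.append α fun _ : Fin 1 => β 2)
      (by intro i; fin_cases i <;> rfl) (by intro i; fin_cases i <;> exact mul_one _)
    obtain ⟨c', γ', o', ω', hB'⟩ := hB.isBistellarAt (A := .oppositeTwo ((α 1)⁻¹ * β 1))
      (W := Fin.append a fun _ : Fin 1 => b 2) (ν := Fin.append α fun _ : Fin 1 => β 2)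
      (by intro i; fin_cases i; exacts [h.symm, h1.symm, rfl])
      (by intro i; fin_cases i; exacts [hβ.symm, mul_inv_cancel_left _ _, mul_one _])
    exact hA'.prismFlip hW hB' hT hT'

/-- The case that the edges are opposite in a common tetrahedron. -/
theorem Reduces.of_opposite (hA : Reduces J a α T) (hB : Reduces J b β T')
    (hT : ∀ t s, ¬ T.IsTwisted t s) (hT' : ∀ t s, ¬ T'.IsTwisted t s)
    (h : b 0 = a 0) (hβ : β 0 = α 0 * oppositeEdge) :
    T.Isomorphic T' ∨ OctahedronFlip T T' ∨ PrismFlipA T T' ∨ PrismFlipB T T' := by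
  have hb := hB.injective
  have ha := hA.injective
  have key : ∀ i : Fin 3, i ≠ 0 → i = 1 ∨ i = 2 := by decide
  by_cases hcommon : ∃ i j, j ≠ 0 ∧ a i = b j
  · -- reflections that preserve the two edges bring a second common tetrahedron to the index `1`
    have e1 : (oppositeEdge * Equiv.swap 0 1 : Equiv.Perm (Fin 4)) =
      Equiv.swap 2 3 * oppositeEdge := by decide
    have e2 : (oppositeEdge * Equiv.swap 2 3 : Equiv.Perm (Fin 4)) =
      Equiv.swap 0 1 * oppositeEdge := by decide
    suffices T.Isomorphic T' ∨ PrismFlipA T T' ∨ PrismFlipB T T' by tauto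
    have of_one : ∀ {a b : Fin 3 → κ} {α β : Fin 3 → Equiv.Perm (Fin 4)}, Reduces J a α T →
        Reduces J b β T' → b 0 = a 0 → β 0 = α 0 * oppositeEdge → ∀ i, i ≠ 0 → a i = b 1 →
        T.Isomorphic T' ∨ PrismFlipA T T' ∨ PrismFlipB T T' := by
      intro a b α β hA hB h hβ i hi hab
      rcases key i hi with rfl | rfl
      · exact hA.of_opposite_two hB hT hT' h hβ hab.symm
      · refine hA.reflect.of_opposite_two hB.flip hT hT' h ?_ hab.symm
        rw [hβ, mul_assoc, mul_assoc, e1]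
        rfl
    obtain ⟨i, j, hj, hij⟩ := hcommon
    have hi : i ≠ 0 := by
      rintro rfl
      exact hj (hb (h.trans hij)).symm
    rcases key j hj with rfl | rfl
    · exact of_one hA hB h hβ i hi hij
    · refine of_one hA.flip hB.reflect h ?_ i hi hij
      change β 0 * _ = _
      rw [hβ, mul_assoc, mul_assoc, e2]
  · right; left
    have hW : Function.Injective (Fin.append a fun j : Fin 2 => b j.succ) :=
      Fin.append_injective_iff.2 ⟨hA.injective, hb.comp (Fin.succ_injective 2),
        fun i j e => hcommon ⟨i, j.succ, Fin.succ_ne_zero j, e⟩⟩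
    obtain ⟨c, γ, o, ω, hA'⟩ := hA.isBistellarAt (A := .first 2)
      (W := Fin.append a fun j : Fin 2 => b j.succ) (ν := Fin.append α fun j : Fin 2 => β j.succ)
      (by intro i; fin_cases i <;> rfl) (by intro i; fin_cases i <;> exact mul_one _)
    obtain ⟨c', γ', o', ω', hB'⟩ := hB.isBistellarAt (A := .oppositeOne)
      (W := Fin.append a fun j : Fin 2 => b j.succ) (ν := Fin.append α fun j : Fin 2 => β j.succ)
      (by intro i; fin_cases i; exacts [h.symm, rfl, rfl])
      (by intro i; fin_cases i; exacts [hβ.symm, mul_one _, mul_one _])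
    exact hA'.octahedronFlip hW hB'

/-- The symmetries of an edge that fix one of the tetrahedra around it. -/
theorem Reduces.exists_symmetry (h : Reduces J a α T) {g : Equiv.Perm (Fin 4)}
    (hg : g ∈ [1, Equiv.swap 0 1, Equiv.swap 2 3, Equiv.swap 2 3 * Equiv.swap 0 1]) :
    ∃ a' α', Reduces J a' α' T ∧ a' 0 = a 0 ∧ α' 0 = α 0 * g := by
  simp only [List.mem_cons, List.not_mem_nil, or_false] at hg
  rcases hg with rfl | rfl | rfl | rfl
  · exact ⟨a, α, h, rfl, (mul_one _).symm⟩
  · exact ⟨_, _, h.flip, rfl, rfl⟩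
  · exact ⟨_, _, h.reflect, rfl, rfl⟩
  · exact ⟨_, _, h.reflect.flip, rfl, mul_assoc _ _ _⟩

/-- Two moves at edges of a common tetrahedron. -/
theorem Reduces.of_common (hA : Reduces J a α T) (hB : Reduces J b β T')
    (hT : ∀ t s, ¬ T.IsTwisted t s) (hT' : ∀ t s, ¬ T'.IsTwisted t s) (h : b 0 = a 0) :
    T.Isomorphic T' ∨ OctahedronFlip T T' ∨ PillowFlip T T' ∨ PrismFlipA T T' ∨
      PrismFlipB T T' := by
  -- two edges of a tetrahedron are equal, adjacent or opposite
  have key : ∀ g : Equiv.Perm (Fin 4),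
      ∃ l ∈ [1, Equiv.swap 0 1, Equiv.swap 2 3, Equiv.swap 2 3 * Equiv.swap 0 1],
      ∃ r ∈ [1, Equiv.swap 0 1, Equiv.swap 2 3, Equiv.swap 2 3 * Equiv.swap 0 1],
        l⁻¹ * g * r = 1 ∨ l⁻¹ * g * r = Equiv.swap 1 2 ∨ l⁻¹ * g * r = oppositeEdge := by
    decide +kernel
  obtain ⟨l, hl, r, hr, e⟩ := key ((α 0)⁻¹ * β 0)
  obtain ⟨a', α', hA', ha, hα⟩ := hA.exists_symmetry hl
  obtain ⟨b', β', hB', hb, hβ⟩ := hB.exists_symmetry hr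
  have h' : b' 0 = a' 0 := by rw [hb, ha, h]
  have e' : β' 0 = α' 0 * (l⁻¹ * ((α 0)⁻¹ * β 0) * r) := by rw [hα, hβ]; group
  rcases e with e | e | e
  · exact .inl (hA'.isomorphic_of_eq hB' h' (by rw [e', e, mul_one]))
  · have := hA'.of_adjacent hB' h' (by rw [e', e])
    tauto
  · have := hA'.of_opposite hB' hT hT' h' (by rw [e', e])
    tauto

end Common

theorem mainTheorem4 {n n' : ℕ} (T : FaceGluing (Fin n)) (T' : FaceGluing (Fin n'))
    (hT : T.IsThreeManifoldTriangulation) (hT' : T'.IsThreeManifoldTriangulation)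
    (h : ∃ (m : ℕ) (I : FaceGluing (Fin m)), Move23 T I ∧ Move32 I T') :
    T'.Isomorphic T ∨
      (∃ (m : ℕ) (I : FaceGluing (Fin m)), Move32 T I ∧ Move23 I T') ∨
      (OctahedronFlip T T' ∨ PillowFlip T T' ∨ PrismFlipA T T' ∨ PrismFlipB T T') := by
  obtain ⟨m, I, h1, h2⟩ := h
  obtain ⟨a, α, hA⟩ := h1.exists_reduces
  obtain ⟨b, β, hB⟩ := h2.exists_reduces
  by_cases hab : ∃ i j, b j = a i
  · obtain ⟨i, j, hij⟩ := hab
    have := (hA.rotate i).of_common (hB.rotate j) (fun t s => hT.not_isTwisted)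
      (fun t s => hT'.not_isTwisted) (by simpa using hij)
    rcases this with h | h
    · exact .inl h.symm
    · exact .inr (.inr h)
  · push Not at hab
    obtain ⟨a₁, α₁, b₁, β₁, S, hS, hS'⟩ := hA.commute hB hab
    let e := (Finite.equivFin (Fin 2 ⊕ (Set.range b₁)ᶜ.Elem)).symm
    exact .inr (.inl ⟨_, S.pull e fun _ => 1,
      ReplacePatch.trans_isomorphic hS.replaced.1 (S.isomorphic_pull _ _),
      (S.pull_isomorphic _ _).trans_replacePatch hS'.replaced.2⟩)
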